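/- Let $G$ be a complex connected semisimple Lie group with Lie algebra $\mathfrak g$ and Killing form $B$. Let $K\subseteq G$ be a maximal compact subgroup with Lie algebra $\mathfrak k$, and let $\sigma_K:\mathfrak g\to\mathfrak g$ be the antilinear involution $\sigma_K(u+iv)=u-iv$ ($u,v\in\mathfrak k$). Let $T\subseteq K$ be a maximal torus with Lie algebra $\mathfrak t$, and let $H\subseteq G$ be its complexification, the connected subgroup with Lie algebra $\mathfrak h=\mathfrak t\oplus i\mathfrak t$. Let $X$ be a connected complex manifold (for example a compact Kähler manifold) with universal covering $\tilde X$. Let $(P_G,\Phi,\sigma)$ be a $G$-harmonic bundle over $X$. That is, $P_G\to X$ is a holomorphic principal $G$-bundle. The Higgs field $\Phi$ is a holomorphic $(1,0)$-form with values in $\mathrm{ad}(P_G)$ such that $[\Phi\wedge\Phi]=0$. Further, $\sigma$ is a smooth antilinear involution of $\mathrm{ad}(P_G)$ which at each point is conjugate to $\sigma_K$ under $\mathrm{Ad}(G)$. Finally, the connection $D=\nabla^\sigma+\Phi-\sigma(\Phi)$ is flat, where $\nabla^\sigma$ is the Chern connection of $\sigma$, i.e. the connection that reduces to the $K$-subbundle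 $P_K\subseteq P_G$ on which $\sigma$ corresponds to $\sigma_K$, and whose $(0,1)$-part is the holomorphic structure of $P_G$. Let $P_H\subseteq P_G$ be a holomorphic $H$-subbundle and suppose that $\sigma$ preserves $P_H\times_H\mathfrak h\subseteq\mathrm{ad}(P_G)$. Let $\hat\sigma:\tilde X\to G/K$ be the map associated with $\sigma$: for a $D$-parallel section $s$ of the pullback of $P_G$ to $\tilde X$, $\hat\sigma(x)$ is the coset of all $g\in G$ such that $s(x)g\in P_K$. Equip $G/K$ and $G/T$ with the $G$-invariant Riemannian metrics induced by the left-invariant metric of $G$ that is given on $\mathfrak g$ by $-\mathrm{Re}\,B(\cdot,\sigma_K\,\cdot)$. Call a smooth map from a complex manifold to a Riemannian manifold pluriharmonic if its composition with every holomorphic curve is harmonic. Then $\hat\sigma$ is pluriharmonic, and there is a pluriharmonic map $\hat\sigma_T:\tilde X\to G/T$ such that $\hat\sigma=\pi\circ\hat\sigma_T$, where $\pi:G/T\to G/K$ is the projection. -/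

import Mathlib

open scoped Manifold ContDiff Topology RightActions

noncomputable section

namespace HiggsBundle

section LieGroups

variable (EG : Type*) [NormedAddCommGroup EG] [NormedSpace ℂ EG]
  {G : Type*} [TopologicalSpace G] [ChartedSpace EG G] [Group G]

/-- The Lie algebra `𝔤` of the complex Lie group `G`. -/
abbrev LieAlg (G : Type*) [TopologicalSpace G] [ChartedSpace EG G] [Group G] : Type _ :=
  GroupLieAlgebra 𝓘(ℂ, EG) G

/-- The adjoint representation: `Ad g` is the differential at `1` of `h ↦ g h g⁻¹`. -/
def Ad (g : G) : LieAlg EG G →L[ℂ] LieAlg EG G :=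
  (mfderiv 𝓘(ℂ, EG) 𝓘(ℂ, EG) (fun h : G => g * h * g⁻¹) 1 : EG →L[ℂ] EG)

/-- The bracket of `𝔤`, whose underlying vector space is `EG`. -/
def lieBracket (G : Type*) [TopologicalSpace G] [ChartedSpace EG G] [Group G] (v w : EG) : EG :=
  (Bracket.bracket (L := LieAlg EG G) (M := LieAlg EG G) v w)

/-- `γ` is a one-parameter subgroup of (the real Lie group underlying) `G` with velocity `v`,
that is `γ t = exp (t v)`. -/
structure IsOneParam (γ : ℝ → G) (v : LieAlg EG G) : Prop where
  map_add : ∀ s t : ℝ, γ (s + t) = γ s * γ t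
  smooth : ContMDiff 𝓘(ℝ, ℝ) 𝓘(ℝ, EG) ∞ γ
  velocity : (mfderiv 𝓘(ℝ, ℝ) 𝓘(ℝ, EG) γ 0 (1 : ℝ) : EG) = v

/-- The (real) Lie algebra of a closed subgroup `L` of `G`:
all `v` such that `exp (t v) ∈ L` for all real `t`. -/
def lieAlgOf (L : Subgroup G) : Set (LieAlg EG G) :=
  {v | ∃ γ : ℝ → G, IsOneParam EG γ v ∧ ∀ t, γ t ∈ L}

/-- `𝔩 + i 𝔩`, where `𝔩` is the Lie algebra of `L`. -/
def complexifiedLieAlgOf (L : Subgroup G) : Set (LieAlg EG G) :=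
  {v | ∃ a ∈ lieAlgOf EG L, ∃ b ∈ lieAlgOf EG L, v = a + Complex.I • b}

/-- The complexification in `G` of the compact torus `T`: the connected subgroup with Lie algebra
`𝔥 = 𝔱 + i 𝔱`, that is the subgroup generated by `exp 𝔥`. -/
def torusComplexification (T : Subgroup G) : Subgroup G :=
  Subgroup.closure {g | ∃ v ∈ complexifiedLieAlgOf EG T, ∃ γ : ℝ → G, IsOneParam EG γ v ∧ γ 1 = g}

/-- `K` is a maximal compact subgroup of `G`. -/
def IsMaximalCompact {G : Type*} [TopologicalSpace G] [Group G] (K : Subgroup G) : Prop :=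
  Maximal (fun L : Subgroup G => IsCompact (L : Set G)) K

/-- `T` is a maximal torus of the compact group `K`: a maximal element among the compact connected
abelian subgroups of `K`. -/
def IsMaximalTorus {G : Type*} [TopologicalSpace G] [Group G] (K T : Subgroup G) : Prop :=
  Maximal (fun L : Subgroup G => L ≤ K ∧ IsCompact (L : Set G) ∧ IsConnected (L : Set G) ∧
    ∀ a ∈ L, ∀ b ∈ L, a * b = b * a) T

/-- `τ` is the antilinear involution `σ_K` of `𝔤 = 𝔨 ⊕ i 𝔨` given by `u + i v ↦ u - i v` for
`u, v ∈ 𝔨`; equivalently, the antilinear involution whose fixed point set is `𝔨`. -/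
structure IsCompactConjugation (K : Subgroup G)
    (τ : LieAlg EG G →ₛₗ[starRingEnd ℂ] LieAlg EG G) : Prop where
  involutive : ∀ v, τ (τ v) = v
  fixed_iff : ∀ v, τ v = v ↔ v ∈ lieAlgOf EG K

variable [LieGroup 𝓘(ℂ, EG) ω G] [CompleteSpace EG]

/-- The square norm `|v|² = - Re B(v, σ_K v)` on `𝔤`, where `B` is the Killing form. -/
def normSqLie (τ : LieAlg EG G →ₛₗ[starRingEnd ℂ] LieAlg EG G) (v : LieAlg EG G) : ℝ :=
  -(killingForm ℂ (LieAlg EG G) v (τ v)).re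

/-- The induced quotient square norm on `𝔤 / 𝔩`, which is the tangent space of `G / L` at the
base point. -/
def normSqQuot (τ : LieAlg EG G →ₛₗ[starRingEnd ℂ] LieAlg EG G) (L : Subgroup G)
    (v : LieAlg EG G) : ℝ :=
  ⨅ w : {w : LieAlg EG G // w ∈ lieAlgOf EG L}, normSqLie EG τ (v - w.1)

end LieGroups

section HomogeneousSpaces

/-! ### Smooth, harmonic and pluriharmonic maps into `G / L`

`G / L` carries the smooth structure for which `G → G / L` is a submersion, so that a map into
`G / L` is smooth iff it has smooth local lifts to `G`, and the `G`-invariant Riemannian metric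
which is the quotient of the left-invariant metric `- Re B(·, σ_K ·)` on `G`. -/

variable (EG : Type*) [NormedAddCommGroup EG] [NormedSpace ℂ EG]
  {G : Type*} [TopologicalSpace G] [ChartedSpace EG G] [Group G]
  (EM : Type*) [NormedAddCommGroup EM] [NormedSpace ℝ EM]
  {M : Type*} [TopologicalSpace M] [ChartedSpace EM M]

/-- `s` is a smooth lift to `G`, near `z`, of the map `f : M → G / L`. -/
def IsLocalLift (L : Subgroup G) (f : M → G ⧸ L) (z : M) (s : M → G) : Prop :=
  ∃ V : Set M, IsOpen V ∧ z ∈ V ∧ ContMDiffOn 𝓘(ℝ, EM) 𝓘(ℝ, EG) ∞ s V ∧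
    ∀ w ∈ V, (s w : G ⧸ L) = f w

/-- The map `f : M → G / L` is smooth on `U`. -/
def IsSmoothOn (L : Subgroup G) (f : M → G ⧸ L) (U : Set M) : Prop :=
  ∀ z ∈ U, ∃ s : M → G, IsLocalLift EG EM L f z s

/-- The pullback `s⁻¹ ds` of the left Maurer-Cartan form by `s : M → G`. -/
def maurerCartan (s : M → G) (z : M) (v : TangentSpace 𝓘(ℝ, EM) z) : LieAlg EG G :=
  (mfderiv 𝓘(ℝ, EM) 𝓘(ℝ, EG) (fun w => (s z)⁻¹ * s w) z v : EG)

variable [LieGroup 𝓘(ℂ, EG) ω G] [CompleteSpace EG]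

open Classical in
/-- The square norm `|df_z(v)|²` in the invariant metric of `G / L`. It is computed by means of a
smooth local lift of `f`; it does not depend on the lift. -/
def normSqDiff (τ : LieAlg EG G →ₛₗ[starRingEnd ℂ] LieAlg EG G) (L : Subgroup G)
    (f : M → G ⧸ L) (z : M) (v : TangentSpace 𝓘(ℝ, EM) z) : ℝ :=
  if h : ∃ s : M → G, IsLocalLift EG EM L f z s then
    normSqQuot EG τ L (maurerCartan EG EM h.choose z v)
  else 0

/-- The energy density `(|∂f/∂x|² + |∂f/∂y|²) / 2` of a map from a domain in `ℂ` to `G / L`. -/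
def energyDensity (τ : LieAlg EG G →ₛₗ[starRingEnd ℂ] LieAlg EG G) (L : Subgroup G)
    (f : ℂ → G ⧸ L) (z : ℂ) : ℝ :=
  (normSqDiff EG ℂ τ L f z (1 : ℂ) + normSqDiff EG ℂ τ L f z Complex.I) / 2

/-- A smooth map `f` from the open set `O ⊆ ℂ` to `G / L` is harmonic if it is a critical point of
the energy for all smooth variations with compact support in `O`. -/
def IsHarmonicOn (τ : LieAlg EG G →ₛₗ[starRingEnd ℂ] LieAlg EG G) (L : Subgroup G)
    (f : ℂ → G ⧸ L) (O : Set ℂ) : Prop :=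
  IsSmoothOn EG ℂ L f O ∧
  ∀ (F : ℝ → ℂ → G ⧸ L) (C : Set ℂ), IsCompact C → C ⊆ O →
    IsSmoothOn EG (ℝ × ℂ) L (fun q : ℝ × ℂ => F q.1 q.2) (Set.univ ×ˢ O) →
    (∀ z ∈ O, F 0 z = f z) → (∀ t, ∀ z ∈ O \ C, F t z = f z) →
    HasDerivAt (fun t => ∫ z in C, energyDensity EG τ L (F t) z) 0 0

/-- A smooth map `f` from a complex manifold `M` to `G / L` is pluriharmonic if its composition
with every holomorphic curve in `M` is harmonic. (Harmonicity of maps from a Riemann surface is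
conformally invariant, so it suffices to consider curves parametrized by open subsets of `ℂ`.) -/
def IsPluriharmonic (EX : Type*) [NormedAddCommGroup EX] [NormedSpace ℂ EX]
    {M : Type*} [TopologicalSpace M] [ChartedSpace EX M]
    (τ : LieAlg EG G →ₛₗ[starRingEnd ℂ] LieAlg EG G) (L : Subgroup G) (f : M → G ⧸ L) : Prop :=
  IsSmoothOn EG EX L f Set.univ ∧
  ∀ (O : Set ℂ) (c : ℂ → M), IsOpen O → ContMDiffOn 𝓘(ℂ, ℂ) 𝓘(ℂ, EX) ω c O →
    IsHarmonicOn EG τ L (f ∘ c) O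

end HomogeneousSpaces

section Bundles

/-! ### Principal bundles, connections and Higgs fields

Sections of the bundle associated with a `G`-space `F` are described, as usual, by equivariant
maps `P → F`, and forms with values in `ad P` by the corresponding `𝔤`-valued forms on `P`. -/

variable (EX : Type*) [NormedAddCommGroup EX] [NormedSpace ℂ EX]
  {X : Type*} [TopologicalSpace X] [ChartedSpace EX X]
  (EG : Type*) [NormedAddCommGroup EG] [NormedSpace ℂ EG]
  {G : Type*} [TopologicalSpace G] [ChartedSpace EG G] [Group G]
  (EP : Type*) [NormedAddCommGroup EP] [NormedSpace ℂ EP]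
  {P : Type*} [TopologicalSpace P] [ChartedSpace EP P] [MulAction Gᵐᵒᵖ P]

/-- `proj : P → X` is a holomorphic principal bundle for the right action of `G` on `P`. -/
structure IsHolomorphicPrincipalBundle (proj : P → X) : Prop where
  holomorphic_proj : ContMDiff 𝓘(ℂ, EP) 𝓘(ℂ, EX) ω proj
  holomorphic_action : ContMDiff (𝓘(ℂ, EP).prod 𝓘(ℂ, EG)) 𝓘(ℂ, EP) ω
    (fun q : P × G => q.1 <• q.2)
  proj_action : ∀ (p : P) (g : G), proj (p <• g) = proj p
  free : ∀ (p : P) (g : G), p <• g = p → g = 1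
  /-- Around each point there are a holomorphic section `s` and a holomorphic `a` such that
  `p ↦ (proj p, a p)` is inverse to the trivialization `(y, g) ↦ s y · g`. -/
  locally_trivial : ∀ x : X, ∃ U : Set X, IsOpen U ∧ x ∈ U ∧ ∃ (s : X → P) (a : P → G),
    ContMDiffOn 𝓘(ℂ, EX) 𝓘(ℂ, EP) ω s U ∧ (∀ y ∈ U, proj (s y) = y) ∧
    ContMDiffOn 𝓘(ℂ, EP) 𝓘(ℂ, EG) ω a (proj ⁻¹' U) ∧
    ∀ p ∈ proj ⁻¹' U, s (proj p) <• a p = p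

/-- `Q ⊆ P` is a holomorphic principal subbundle with structure group the closed complex
subgroup `H` of `G`. -/
structure IsHolomorphicSubbundle (proj : P → X) (H : Subgroup G) (Q : Set P) : Prop where
  action_mem : ∀ p ∈ Q, ∀ h ∈ H, p <• h ∈ Q
  mem_of_action : ∀ p ∈ Q, ∀ g : G, p <• g ∈ Q → g ∈ H
  locally_section : ∀ x : X, ∃ U : Set X, IsOpen U ∧ x ∈ U ∧ ∃ s : X → P,
    ContMDiffOn 𝓘(ℂ, EX) 𝓘(ℂ, EP) ω s U ∧ ∀ y ∈ U, proj (s y) = y ∧ s y ∈ Q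

/-- Real `𝔤`-valued one-forms on `P`. -/
abbrev LieForm (G : Type*) [TopologicalSpace G] [ChartedSpace EG G] [Group G]
    (P : Type*) [TopologicalSpace P] [ChartedSpace EP P] : Type _ :=
  (p : P) → TangentSpace 𝓘(ℝ, EP) p →ₗ[ℝ] LieAlg EG G

/-- The value on the constant vector `v`, at the point `y` of the model space, of the form `η`
written in the chart of `P` at `p₀`. -/
def coordForm (η : LieForm EG EP G P) (p₀ : P) (v : EP) (y : EP) : EG :=
  η ((extChartAt 𝓘(ℝ, EP) p₀).symm y)
    (mfderiv 𝓘(ℝ, EP) 𝓘(ℝ, EP) (extChartAt 𝓘(ℝ, EP) p₀).symm y v)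

/-- The one-form `η` is smooth. -/
def IsSmoothForm (η : LieForm EG EP G P) : Prop :=
  ∀ (p₀ : P) (v : EP), ContDiffOn ℝ ∞ (coordForm EG EP η p₀ v) (extChartAt 𝓘(ℝ, EP) p₀).target

/-- The one-form `η` is a holomorphic form of type `(1,0)`: it is complex linear on tangent spaces
and has holomorphic coefficients. -/
def IsHolomorphicForm (η : LieForm EG EP G P) : Prop :=
  (∀ (p : P) (v : EP), η p (Complex.I • v : EP) = Complex.I • η p v) ∧
  ∀ (p₀ : P) (v : EP),
    DifferentiableOn ℂ (coordForm EG EP η p₀ v) (extChartAt 𝓘(ℝ, EP) p₀).target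

/-- `η` is equivariant: `R_g^* η = Ad (g⁻¹) η`. -/
def IsEquivariantForm (η : LieForm EG EP G P) : Prop :=
  ∀ (p : P) (g : G) (v : TangentSpace 𝓘(ℝ, EP) p),
    η (p <• g) (mfderiv 𝓘(ℝ, EP) 𝓘(ℝ, EP) (fun q : P => q <• g) p v) = Ad EG g⁻¹ (η p v)

/-- `θ` is the connection form of a (smooth) connection on the principal `G`-bundle `P`. -/
structure IsConnectionForm (θ : LieForm EG EP G P) : Prop where
  smooth : IsSmoothForm EG EP θ
  equivariant : IsEquivariantForm EG EP θ
  /-- `θ` takes the value `ξ` on the fundamental vector field of `ξ ∈ 𝔤`. -/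
  vertical : ∀ (p : P) (ξ : LieAlg EG G),
    θ (p <• (1 : G)) (mfderiv 𝓘(ℝ, EG) 𝓘(ℝ, EP) (fun g : G => p <• g) 1 ξ) = ξ

/-- The connection `θ` is flat: its curvature `dθ + [θ ∧ θ] / 2` vanishes. -/
def IsFlat (θ : LieForm EG EP G P) : Prop :=
  ∀ (p₀ : P), ∀ y ∈ (extChartAt 𝓘(ℝ, EP) p₀).target, ∀ u v : EP,
    fderiv ℝ (coordForm EG EP θ p₀ v) y u - fderiv ℝ (coordForm EG EP θ p₀ u) y v +
      lieBracket EG G (coordForm EG EP θ p₀ u y) (coordForm EG EP θ p₀ v y) = 0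

/-- `Φ` is a Higgs field: a holomorphic `(1,0)`-form with values in `ad P`, that is a holomorphic
equivariant `𝔤`-valued form on `P` that vanishes on vertical vectors, with `[Φ ∧ Φ] = 0`. -/
structure IsHiggsField (proj : P → X) (Φ : LieForm EG EP G P) : Prop where
  holomorphic : IsHolomorphicForm EG EP Φ
  equivariant : IsEquivariantForm EG EP Φ
  horizontal : ∀ (p : P) (v : TangentSpace 𝓘(ℝ, EP) p),
    mfderiv 𝓘(ℝ, EP) 𝓘(ℝ, EX) proj p v = 0 → Φ p v = 0
  bracket_eq_zero : ∀ (p : P) (u v : TangentSpace 𝓘(ℝ, EP) p), ⁅Φ p u, Φ p v⁆ = 0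

/-- `σ` is a smooth antilinear involution of `ad P`, pointwise conjugate to `σ_K = τ`. Here `σ p`
is the involution of `𝔤` that corresponds to `σ` under the identification of the fibre of `ad P`
with `𝔤` given by `p`. -/
structure IsAdjointInvolution (τ : LieAlg EG G →ₛₗ[starRingEnd ℂ] LieAlg EG G)
    (σ : P → LieAlg EG G →ₛₗ[starRingEnd ℂ] LieAlg EG G) : Prop where
  smooth : ∀ v : LieAlg EG G, ContMDiff (M' := EG) 𝓘(ℝ, EP) 𝓘(ℝ, EG) ∞ (fun p => σ p v)
  equivariant : ∀ (p : P) (g : G) (v : LieAlg EG G),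
    σ (p <• g) v = Ad EG g⁻¹ (σ p (Ad EG g v))
  conjugate : ∀ p : P, ∃ g : G, ∀ v : LieAlg EG G, σ p v = Ad EG g⁻¹ (τ (Ad EG g v))

/-- The `K`-subbundle `P_K` of `P` on which `σ` is the standard involution `σ_K = τ`. -/
def compactSubbundle (τ : LieAlg EG G →ₛₗ[starRingEnd ℂ] LieAlg EG G)
    (σ : P → LieAlg EG G →ₛₗ[starRingEnd ℂ] LieAlg EG G) : Set P :=
  {p | σ p = τ}

/-- `θ` is the Chern connection of `σ`: it restricts to a connection on `P_K` (it takes values in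
`𝔨` on velocities of curves in `P_K`), and its `(0,1)`-part in holomorphic local
trivializations is `∂bar` (its pullback by any holomorphic local section is of type `(1,0)`). -/
structure IsChernConnection (proj : P → X) (K : Subgroup G)
    (τ : LieAlg EG G →ₛₗ[starRingEnd ℂ] LieAlg EG G)
    (σ : P → LieAlg EG G →ₛₗ[starRingEnd ℂ] LieAlg EG G) (θ : LieForm EG EP G P) : Prop where
  isConnection : IsConnectionForm EG EP θ
  compact_valued : ∀ c : ℝ → P, ContMDiffAt 𝓘(ℝ, ℝ) 𝓘(ℝ, EP) ∞ c 0 →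
    (∀ᶠ t in 𝓝 (0 : ℝ), c t ∈ compactSubbundle EG τ σ) →
    θ (c 0) (mfderiv 𝓘(ℝ, ℝ) 𝓘(ℝ, EP) c 0 (1 : ℝ)) ∈ lieAlgOf EG K
  type_one_zero : ∀ (U : Set X) (s : X → P), IsOpen U → ContMDiffOn 𝓘(ℂ, EX) 𝓘(ℂ, EP) ω s U →
    (∀ y ∈ U, proj (s y) = y) → ∀ y ∈ U, ∀ v : EX,
    θ (s y) (mfderiv 𝓘(ℝ, EX) 𝓘(ℝ, EP) s y (Complex.I • v : EX)) =
      Complex.I • θ (s y) (mfderiv 𝓘(ℝ, EX) 𝓘(ℝ, EP) s y v)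

/-- The connection `D = ∇ + Φ - σ(Φ)`, where `θ` is the connection form of `∇`. -/
def harmonicConnection (θ Φ : LieForm EG EP G P)
    (σ : P → LieAlg EG G →ₛₗ[starRingEnd ℂ] LieAlg EG G) : LieForm EG EP G P := fun p =>
  { toFun := fun v => θ p v + Φ p v - σ p (Φ p v)
    map_add' := fun u v => by simp only [map_add]; abel
    map_smul' := fun r v => by
      have h : σ p (r • Φ p v) = r • σ p (Φ p v) := by
        rw [← Complex.coe_smul r (Φ p v), ← Complex.coe_smul r (σ p (Φ p v)), map_smulₛₗ,
          Complex.conj_ofReal]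
      simp only [map_smul, h, RingHom.id_apply, smul_add, smul_sub] }

/-- `(P, Φ, σ)` is a `G`-harmonic bundle over `X` with Chern connection `θ`: `P` is a holomorphic
principal bundle, `Φ` a Higgs field, and `D = ∇ + Φ - σ(Φ)` is flat. -/
structure IsHarmonicBundle (proj : P → X) (K : Subgroup G)
    (τ : LieAlg EG G →ₛₗ[starRingEnd ℂ] LieAlg EG G) (Φ : LieForm EG EP G P)
    (σ : P → LieAlg EG G →ₛₗ[starRingEnd ℂ] LieAlg EG G) (θ : LieForm EG EP G P) : Prop where
  principal : IsHolomorphicPrincipalBundle EX EG (G := G) EP proj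
  higgs : IsHiggsField EX EG EP proj Φ
  involution : IsAdjointInvolution EG EP τ σ
  chern : IsChernConnection EX EG EP proj K τ σ θ
  flat : IsFlat EG EP (harmonicConnection EG EP θ Φ σ)

/-- `σ` preserves `P_H ×_H 𝔥`, where `𝔥 = 𝔱 + i 𝔱` is the Lie algebra of `H`. -/
def PreservesDiagonal (T : Subgroup G) (PH : Set P)
    (σ : P → LieAlg EG G →ₛₗ[starRingEnd ℂ] LieAlg EG G) : Prop :=
  ∀ p ∈ PH, ∀ v ∈ complexifiedLieAlgOf EG T, σ p v ∈ complexifiedLieAlgOf EG T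

/-- `s : X' → P` is a smooth section, parallel for `D`, of the pullback of `P` by `q : X' → X`. -/
structure IsParallelSection {X' : Type*} [TopologicalSpace X'] [ChartedSpace EX X']
    (proj : P → X) (q : X' → X) (D : LieForm EG EP G P) (s : X' → P) : Prop where
  smooth : ContMDiff 𝓘(ℝ, EX) 𝓘(ℝ, EP) ∞ s
  proj_eq : ∀ x, proj (s x) = q x
  parallel : ∀ (x : X') (v : TangentSpace 𝓘(ℝ, EX) x),
    D (s x) (mfderiv 𝓘(ℝ, EX) 𝓘(ℝ, EP) s x v) = 0

/-- `f : X' → G / K` is the map associated with `σ`, by means of a trivialization `s` of the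
pullback of `P` that is parallel for `D`: the coset `f x` consists of all `g` such that
`s x · g` lies in `P_K`. -/
def IsAssociatedMap {X' : Type*} [TopologicalSpace X'] [ChartedSpace EX X']
    (proj : P → X) (q : X' → X) (K : Subgroup G)
    (τ : LieAlg EG G →ₛₗ[starRingEnd ℂ] LieAlg EG G) (Φ : LieForm EG EP G P)
    (σ : P → LieAlg EG G →ₛₗ[starRingEnd ℂ] LieAlg EG G) (θ : LieForm EG EP G P)
    (f : X' → G ⧸ K) : Prop :=
  ∃ s : X' → P, IsParallelSection EX EG EP proj q (harmonicConnection EG EP θ Φ σ) s ∧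
    ∀ (x : X') (g : G), (g : G ⧸ K) = f x ↔ s x <• g ∈ compactSubbundle EG τ σ

/-- `q : X' → X` is a universal covering, with the pulled back complex structure on `X'`. -/
structure IsUniversalCovering {X' : Type*} [TopologicalSpace X'] [ChartedSpace EX X']
    (q : X' → X) : Prop where
  simplyConnected : SimplyConnectedSpace X'
  covering : IsCoveringMap q
  surjective : Function.Surjective q
  localDiffeo : IsLocalDiffeomorph 𝓘(ℂ, EX) 𝓘(ℂ, EX) ω q

end Bundles

end HiggsBundle

end

/-!
Everything happens along holomorphic curves and in a frame adapted to both reductions of the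
structure group. Let `p` be a point of `P_H`. As `σ_p` is conjugate to `σ_K`, the composition
`σ_p σ_K` is an automorphism of `𝔤` that is positive for the Hermitian inner product
`-B(σ_K ·, ·)`. Its logarithm is a derivation, hence inner, so that `σ_p σ_K = exp (ad η)` with
`σ_K η = -η`. As `σ_p` and `σ_K` preserve `𝔥`, so does `ad η`; for `v` in `𝔱` the vector `[i η, v]`
lies in `𝔥 ∩ 𝔨` and is isotropic for `B`, hence zero. So `i η` centralizes `𝔱`, and `i η ∈ 𝔱`
because `T` is maximal (`IsMaximalTorus.exists_log`). It follows that `p · exp (η / 2)` lies in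
`P_K ∩ P_H` (`exists_frame_log`). Since `H ∩ K = T`
(`IsMaximalTorus.mem_of_mem_torusComplexification`), the fibres of `P_K ∩ P_H` are `T`-orbits:
if `s` is a parallel frame on the universal covering, the elements `g` with
`s(x) g ∈ P_K ∩ P_H` form one coset of `T`. This coset is `σ̂_T(x)`, and it lies over `σ̂(x)`.

Locally `g` can be chosen with `s g = r exp (η / 2)` for a holomorphic section `r` of `P_H`, and
this `g` lifts both `σ̂` and `σ̂_T`. Since `s` is parallel, `g⁻¹ dg` is the pullback of
`θ + Φ - σ Φ` by `s g`. Along a holomorphic curve the pullback of `θ` is `𝔨`-valued, and it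
is `dη / 2` plus a form of type `(1,0)`, because `r` is holomorphic; this forces it to be
`(i / 2) dη(i ·)`, which takes values in `𝔱`. The rest is `φ - σ_K φ` with
`φ = exp (- ad η / 2) r^* Φ`, which is orthogonal to `𝔨` (`eventually_mcForm_eq`). As `r^* Φ` is
holomorphic, the tension field computed from these two parts vanishes, by the same cancellation
for every group between `T` and `K` (`tension_add_tension_eq_zero`). That a map with vanishing
tension field is a critical point of the energy is the first variation formula, a consequence of
the Maurer-Cartan equation and of the divergence theorem (`IsQuotProj.first_variation`,
`IsQuotProj.isHarmonicOn`).

The Lie theory behind this is developed through the adjoint representation. As `𝔤` is semisimple,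
`ad` is injective, so `Ad` is an immersion, and questions about one-parameter groups of `G`, the
exponential map and the Maurer-Cartan form reduce to questions about matrix-valued functions.
-/


set_option linter.unusedSectionVars false

/-! ### The real manifold underlying a complex manifold -/

section RestrictScalars

variable {E : Type*} [NormedAddCommGroup E] [NormedSpace ℂ E]
  {E' : Type*} [NormedAddCommGroup E'] [NormedSpace ℂ E']
  {E'' : Type*} [NormedAddCommGroup E''] [NormedSpace ℂ E'']
  {M : Type*} [TopologicalSpace M] [ChartedSpace E M]
  {M' : Type*} [TopologicalSpace M'] [ChartedSpace E' M']
  {M'' : Type*} [TopologicalSpace M''] [ChartedSpace E'' M'']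

theorem ContMDiffWithinAt.real_of_complex {n : WithTop ℕ∞} {f : M → M'} {s : Set M} {x : M}
    (h : ContMDiffWithinAt 𝓘(ℂ, E) 𝓘(ℂ, E') n f s x) :
    ContMDiffWithinAt 𝓘(ℝ, E) 𝓘(ℝ, E') n f s x := by
  rw [contMDiffWithinAt_iff] at h ⊢
  exact ⟨h.1, h.2.restrict_scalars ℝ⟩

theorem ContMDiffOn.real_of_complex {n : WithTop ℕ∞} {f : M → M'} {s : Set M}
    (h : ContMDiffOn 𝓘(ℂ, E) 𝓘(ℂ, E') n f s) : ContMDiffOn 𝓘(ℝ, E) 𝓘(ℝ, E') n f s :=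
  fun x hx => (h x hx).real_of_complex

theorem ContMDiffAt.real_of_complex {n : WithTop ℕ∞} {f : M → M'} {x : M}
    (h : ContMDiffAt 𝓘(ℂ, E) 𝓘(ℂ, E') n f x) : ContMDiffAt 𝓘(ℝ, E) 𝓘(ℝ, E') n f x :=
  ContMDiffWithinAt.real_of_complex h

theorem ContMDiff.real_of_complex {n : WithTop ℕ∞} {f : M → M'}
    (h : ContMDiff 𝓘(ℂ, E) 𝓘(ℂ, E') n f) : ContMDiff 𝓘(ℝ, E) 𝓘(ℝ, E') n f :=
  fun x => (h x).real_of_complex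

theorem ContMDiff.real_of_complex_prod {n : WithTop ℕ∞} {f : M × M' → M''}
    (h : ContMDiff (𝓘(ℂ, E).prod 𝓘(ℂ, E')) 𝓘(ℂ, E'') n f) :
    ContMDiff (𝓘(ℝ, E).prod 𝓘(ℝ, E')) 𝓘(ℝ, E'') n f := by
  intro x
  have h := h x
  rw [contMDiffAt_iff] at h ⊢
  exact ⟨h.1, h.2.restrict_scalars ℝ⟩

theorem HasMFDerivAt.real_of_complex {f : M → M'} {x : M} {f' : E →L[ℂ] E'}
    (h : HasMFDerivAt 𝓘(ℂ, E) 𝓘(ℂ, E') f x f') :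
    HasMFDerivAt 𝓘(ℝ, E) 𝓘(ℝ, E') f x (f'.restrictScalars ℝ : E →L[ℝ] E') :=
  ⟨h.1, HasFDerivWithinAt.restrictScalars ℝ h.2⟩

/-- A complex manifold is a real manifold with the same charts. -/
theorem IsManifold.real_of_complex (n : WithTop ℕ∞) [IsManifold 𝓘(ℂ, E) n M] :
    IsManifold 𝓘(ℝ, E) n M := by
  apply isManifold_of_contDiffOn
  intro e e' he he'
  have h := contMDiffOn_of_mem_contDiffGroupoid
    ((contDiffGroupoid n 𝓘(ℂ,E)).compatible he he')
  rw [contMDiffOn_iff_contDiffOn] at h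
  simpa using h.restrict_scalars ℝ

variable {G : Type*} [TopologicalSpace G] [ChartedSpace E G] [Group G]

theorem LieGroup.real_of_complex (n : WithTop ℕ∞) [LieGroup 𝓘(ℂ, E) n G] :
    LieGroup 𝓘(ℝ, E) n G where
  __ := IsManifold.real_of_complex (E := E) (M := G) n
  contMDiff_mul := (contMDiff_mul 𝓘(ℂ, E) n).real_of_complex_prod
  contMDiff_inv := (contMDiff_id (I := 𝓘(ℂ, E))).inv.real_of_complex

end RestrictScalars

namespace HiggsBundle

/-! ### The adjoint representation and its differential -/

section Adjoint

variable {EG : Type*} [NormedAddCommGroup EG] [NormedSpace ℂ EG]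
  {G : Type*} [TopologicalSpace G] [ChartedSpace EG G] [Group G]

variable (EG) in
/-- The adjoint representation, with values in the Banach algebra of endomorphisms of the model
space `EG`, which is the vector space underlying the Lie algebra. -/
noncomputable def AdEnd (g : G) : EG →L[ℂ] EG := Ad EG g

section Chart

local notation "φ" => extChartAt 𝓘(ℂ, EG) (1 : G)

/-- The differential at `1` in the chart at `1`, which identifies the tangent space with `EG`. -/
theorem mfderiv_one_eq_fderiv {k : G → EG} (hk : MDifferentiableAt 𝓘(ℂ, EG) 𝓘(ℂ, EG) k 1)
    (v : EG) :
    (mfderiv 𝓘(ℂ, EG) 𝓘(ℂ, EG) k 1 : EG →L[ℂ] EG) v = fderiv ℂ (k ∘ (φ).symm) (φ (1 : G)) v := by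
  have h : (mfderiv 𝓘(ℂ, EG) 𝓘(ℂ, EG) k 1 : EG →L[ℂ] EG) =
      fderivWithin ℂ (k ∘ (φ).symm) (Set.range 𝓘(ℂ, EG)) (φ (1 : G)) := by
    exact hk.mfderiv
  have hr : Set.range 𝓘(ℂ, EG) = (Set.univ : Set EG) := by simp
  rw [h, hr, fderivWithin_univ]
  rfl

theorem chart_one_mem : φ (1 : G) ∈ (φ).target := mem_extChartAt_target (1 : G)

theorem chart_symm_chart_one : (φ).symm (φ (1 : G)) = 1 := extChartAt_to_inv (1 : G)

end Chart

variable [LieGroup 𝓘(ℂ, EG) ω G]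

theorem contMDiff_conj (g : G) :
    ContMDiff 𝓘(ℂ, EG) 𝓘(ℂ, EG) ω (fun h : G => g * h * g⁻¹) :=
  (contMDiff_const.mul contMDiff_id).mul contMDiff_const

theorem hasMFDerivAt_conj (g : G) {x : G} (hx : x = 1) :
    HasMFDerivAt 𝓘(ℂ, EG) 𝓘(ℂ, EG) (fun h : G => g * h * g⁻¹) x (AdEnd EG g) := by
  subst hx
  exact ((contMDiff_conj g).mdifferentiableAt (by simp)).hasMFDerivAt

theorem AdEnd_one : AdEnd EG (1 : G) = 1 := by
  have h := hasMFDerivAt_conj (EG := EG) (1 : G) rfl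
  have h2 : HasMFDerivAt 𝓘(ℂ, EG) 𝓘(ℂ, EG) (fun h : G => (1 : G) * h * (1 : G)⁻¹) 1
      (ContinuousLinearMap.id ℂ EG) := by
    have : (fun h : G => (1 : G) * h * (1 : G)⁻¹) = id := by ext; simp
    rw [this]
    exact hasMFDerivAt_id _
  exact hasMFDerivAt_unique h h2

theorem AdEnd_mul (g h : G) : AdEnd EG (g * h) = AdEnd EG g * AdEnd EG h := by
  have h1 := hasMFDerivAt_conj (EG := EG) (g * h) rfl
  have h2 : HasMFDerivAt 𝓘(ℂ, EG) 𝓘(ℂ, EG) (fun x : G => g * h * x * (g * h)⁻¹) 1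
      (AdEnd EG g * AdEnd EG h : EG →L[ℂ] EG) := by
    have e : (fun x : G => g * h * x * (g * h)⁻¹) =
      (fun x : G => g * x * g⁻¹) ∘ (fun x : G => h * x * h⁻¹) := by
      ext x
      simp [mul_assoc]
    rw [e]
    exact HasMFDerivAt.comp (1 : G) (hasMFDerivAt_conj (EG := EG) g (x := h * 1 * h⁻¹) (by simp))
      (hasMFDerivAt_conj (EG := EG) h rfl)
  exact hasMFDerivAt_unique h1 h2

theorem AdEnd_inv_mul (g : G) : AdEnd EG g⁻¹ * AdEnd EG g = 1 := by
  rw [← AdEnd_mul, inv_mul_cancel, AdEnd_one]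

theorem AdEnd_mul_inv (g : G) : AdEnd EG g * AdEnd EG g⁻¹ = 1 := by
  rw [← AdEnd_mul, mul_inv_cancel, AdEnd_one]

theorem AdEnd_inv_apply (g : G) (v : EG) : AdEnd EG g⁻¹ (AdEnd EG g v) = v :=
  congrArg (fun A : EG →L[ℂ] EG => A v) (AdEnd_inv_mul g)

theorem AdEnd_apply_inv (g : G) (v : EG) : AdEnd EG g (AdEnd EG g⁻¹ v) = v :=
  congrArg (fun A : EG →L[ℂ] EG => A v) (AdEnd_mul_inv g)

/-- `Ad g` is the differential at `1` of `h ↦ g h g⁻¹`, so this is smooth dependence of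
differentials on parameters. The base points `g 1 g⁻¹` are all `1`, but not definitionally, and the
coordinate changes of the tangent bundle that occur are trivial. -/
theorem contMDiff_AdEnd :
    ContMDiff 𝓘(ℂ, EG) 𝓘(ℂ, EG →L[ℂ] EG) ω (fun g : G => AdEnd EG g) := by
  intro g₀
  have hI : IsManifold 𝓘(ℂ, EG) 1 G := IsManifold.of_le (n := ω) le_top
  have h : ContMDiffAt (𝓘(ℂ, EG).prod 𝓘(ℂ, EG)) 𝓘(ℂ, EG) ω
      (Function.uncurry fun g h : G => g * h * g⁻¹) (g₀, 1) :=
    ((contMDiff_fst.mul contMDiff_snd).mul (contMDiff_fst.inv)).contMDiffAt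
  have h2 := ContMDiffAt.mfderiv (m := ω) (n := ω) (fun g h : G => g * h * g⁻¹) (fun _ => (1 : G)) h
    contMDiffAt_const le_top
  refine h2.congr_of_eventuallyEq (Filter.Eventually.of_forall fun g => ?_)
  have key : ∀ x : G, x = 1 → ∀ v : EG, (tangentBundleCore 𝓘(ℂ, EG) G).coordChange
      (achart EG x) (achart EG (g₀ * 1 * g₀⁻¹)) x v = v := by
    rintro x rfl v
    have e : (g₀ * 1 * g₀⁻¹ : G) = 1 := by simp
    rw [e]
    exact (tangentBundleCore 𝓘(ℂ, EG) G).coordChange_self (achart EG (1 : G)) 1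
      (mem_achart_source EG 1) v
  have key2 : ∀ v : EG, (tangentBundleCore 𝓘(ℂ, EG) G).coordChange
      (achart EG (1 : G)) (achart EG (1 : G)) 1 v = v := fun v =>
    (tangentBundleCore 𝓘(ℂ, EG) G).coordChange_self (achart EG (1 : G)) 1
      (mem_achart_source EG 1) v
  refine Eq.trans ?_ (inTangentCoordinates_eq (I := 𝓘(ℂ, EG)) (I' := 𝓘(ℂ, EG)) (fun _ : G => (1 : G))
    (fun x : G => x * 1 * x⁻¹) (fun x : G => AdEnd EG x) (x₀ := g₀) (x := g) ?_ ?_).symm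
  · refine ContinuousLinearMap.ext fun v => ?_
    change AdEnd EG g v = (tangentBundleCore 𝓘(ℂ, EG) G).coordChange (achart EG (g * 1 * g⁻¹))
      (achart EG (g₀ * 1 * g₀⁻¹)) (g * 1 * g⁻¹) (AdEnd EG g
        ((tangentBundleCore 𝓘(ℂ, EG) G).coordChange (achart EG (1 : G)) (achart EG (1 : G)) 1 v))
    rw [key2, key _ (by simp)]
  · exact mem_chart_source EG _
  · simp only [mul_one, mul_inv_cancel]
    exact mem_chart_source EG _

/-- The adjoint representation of the Lie algebra, as the differential of `Ad` at `1`. -/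
noncomputable def adEnd (EG : Type*) [NormedAddCommGroup EG] [NormedSpace ℂ EG]
    (G : Type*) [TopologicalSpace G] [ChartedSpace EG G] [Group G] : EG →L[ℂ] EG →L[ℂ] EG :=
  mfderiv 𝓘(ℂ, EG) 𝓘(ℂ, EG →L[ℂ] EG) (fun g : G => AdEnd EG g) 1

theorem hasMFDerivAt_AdEnd_one :
    HasMFDerivAt 𝓘(ℂ, EG) 𝓘(ℂ, EG →L[ℂ] EG) (fun g : G => AdEnd EG g) 1 (adEnd EG G) :=
  ((contMDiff_AdEnd (EG := EG) (G := G)).mdifferentiableAt (by simp)).hasMFDerivAt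

/-- The comparison of left and right translations in a chart: if `m` is a multiplication in
coordinates, with unit `c`, and `A` relates its two partial differentials, then the differential
of `A` at `c` is the commutator of the second partial differentials of `m`. -/
theorem hasFDerivAt_of_partial_fderiv_eq {E : Type*} [NormedAddCommGroup E] [NormedSpace ℂ E]
    {m : E × E → E} {c : E} {A : E → E →L[ℂ] E} {A' : E →L[ℂ] E →L[ℂ] E}
    (hm : ContDiffAt ℂ 2 m (c, c)) (hA : HasFDerivAt A A' c) (hA1 : A c = 1)
    (h1 : ∀ w, fderiv ℂ m (c, c) (w, 0) = w)
    (h : ∀ᶠ x in 𝓝 c, ∀ w, fderiv ℂ m (x, c) (0, w) = fderiv ℂ m (c, x) (A x w, 0)) (v w : E) :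
    A' v w = fderiv ℂ (fun x => fderiv ℂ m (x, c) (0, w)) c v -
      fderiv ℂ (fun x => fderiv ℂ m (x, c) (0, v)) c w := by
  have hsymm : IsSymmSndFDerivAt ℂ m (c, c) := hm.isSymmSndFDerivAt (by simp)
  have hd : HasFDerivAt (fderiv ℂ m) (fderiv ℂ (fderiv ℂ m) (c, c)) (c, c) :=
    ((hm.fderiv_right (m := 1) (by norm_num)).differentiableAt (by simp)).hasFDerivAt
  set D2 := fderiv ℂ (fderiv ℂ m) (c, c) with hD2
  have hl : HasFDerivAt (fun x : E => (x, c)) (ContinuousLinearMap.inl ℂ E E) c :=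
    hasFDerivAt_prodMk_left c c
  have hr : HasFDerivAt (fun x : E => (c, x)) (ContinuousLinearMap.inr ℂ E E) c :=
    hasFDerivAt_prodMk_right c c
  have e1 : ∀ w : E, HasFDerivAt (fun x => fderiv ℂ m (x, c) (0, w)) _ c := fun w =>
    HasFDerivAt.clm_apply (HasFDerivAt.comp (f := fun x : E => (x, c)) c hd hl)
      (hasFDerivAt_const ((0 : E), w) c)
  have e2 : HasFDerivAt (fun x => fderiv ℂ m (c, x) (A x w, 0)) _ c :=
    HasFDerivAt.clm_apply (HasFDerivAt.comp (f := fun x : E => (c, x)) c hd hr)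
      (HasFDerivAt.prodMk (HasFDerivAt.clm_apply hA (hasFDerivAt_const w c))
        (hasFDerivAt_const (0 : E) c))
  have e3 := (e1 w).unique (e2.congr_of_eventuallyEq (h.mono fun x hx => hx w))
  have e4 := congrArg (fun T : E →L[ℂ] E => T v) e3
  rw [(e1 w).fderiv, (e1 v).fderiv]
  have e5 := hsymm (0, v) (w, 0)
  simp [hA1, h1] at e4 e5 ⊢
  rw [e4, ← e5]
  abel

section Bracket

local notation "φ" => extChartAt 𝓘(ℂ, EG) (1 : G)

variable (EG G) in
/-- The multiplication of `G` in the chart at `1`. -/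
noncomputable def mulInChart : EG × EG → EG := fun x => φ ((φ).symm x.1 * (φ).symm x.2)

theorem contMDiffAt_chart_symm {x : EG} (hx : x ∈ (φ).target) :
    ContMDiffAt 𝓘(ℂ, EG) 𝓘(ℂ, EG) ω (φ).symm x :=
  (contMDiffOn_extChartAt_symm (1 : G)).contMDiffAt (extChartAt_target_mem_nhds' hx)

theorem contMDiffAt_chart {g : G} (hg : g ∈ (φ).source) :
    ContMDiffAt 𝓘(ℂ, EG) 𝓘(ℂ, EG) ω φ g :=
  contMDiffAt_extChartAt' (by simpa using hg)

theorem contDiffAt_mulInChart {x y : EG} (hx : x ∈ (φ).target) (hy : y ∈ (φ).target)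
    (h : (φ).symm x * (φ).symm y ∈ (φ).source) : ContDiffAt ℂ ω (mulInChart EG G) (x, y) := by
  rw [← contMDiffAt_iff_contDiffAt]
  have h1 : ContMDiffAt 𝓘(ℂ, EG × EG) 𝓘(ℂ, EG) ω (fun p : EG × EG => (φ).symm p.1) (x, y) :=
    (contMDiffAt_chart_symm hx).comp (x, y) contDiff_fst.contMDiff.contMDiffAt
  have h2 : ContMDiffAt 𝓘(ℂ, EG × EG) 𝓘(ℂ, EG) ω (fun p : EG × EG => (φ).symm p.2) (x, y) :=
    (contMDiffAt_chart_symm hy).comp (x, y) contDiff_snd.contMDiff.contMDiffAt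
  exact (contMDiffAt_chart h).comp (x, y) (h1.mul h2)

/-- The second partial differential of the multiplication is the differential of a left
translation. -/
theorem fderiv_mulInChart_inr {x : EG} (hx : x ∈ (φ).target) (v : EG) :
    fderiv ℂ (mulInChart EG G) (x, φ (1 : G)) (0, v) =
      (mfderiv 𝓘(ℂ, EG) 𝓘(ℂ, EG) (fun h : G => φ ((φ).symm x * h)) 1 : EG →L[ℂ] EG) v := by
  have hs : (φ).symm x * (φ).symm (φ (1 : G)) ∈ (φ).source := by
    rw [chart_symm_chart_one, mul_one]
    exact (φ).map_target hx
  have hm := (contDiffAt_mulInChart hx chart_one_mem hs).differentiableAt (by simp)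
  have hk : MDifferentiableAt 𝓘(ℂ, EG) 𝓘(ℂ, EG) (fun h : G => φ ((φ).symm x * h)) 1 := by
    refine ContMDiffAt.mdifferentiableAt (n := ω) ?_ (by simp)
    refine ContMDiffAt.comp (1 : G) (g := φ) (contMDiffAt_chart ?_)
      (contMDiff_const.mul contMDiff_id).contMDiffAt
    simpa using (φ).map_target hx
  rw [mfderiv_one_eq_fderiv hk]
  have e : (fun h : G => φ ((φ).symm x * h)) ∘ (φ).symm = fun y => mulInChart EG G (x, y) := rfl
  rw [e]
  have h2 : HasFDerivAt (fun y => mulInChart EG G (x, y)) _ (φ (1 : G)) :=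
    HasFDerivAt.comp (f := fun y : EG => (x, y)) (φ (1 : G)) hm.hasFDerivAt
      (hasFDerivAt_prodMk_right x (φ (1 : G)))
  rw [h2.fderiv]
  simp

/-- The first partial differential of the multiplication is the differential of a right
translation. -/
theorem fderiv_mulInChart_inl {x : EG} (hx : x ∈ (φ).target) (v : EG) :
    fderiv ℂ (mulInChart EG G) (φ (1 : G), x) (v, 0) =
      (mfderiv 𝓘(ℂ, EG) 𝓘(ℂ, EG) (fun h : G => φ (h * (φ).symm x)) 1 : EG →L[ℂ] EG) v := by
  have hs : (φ).symm (φ (1 : G)) * (φ).symm x ∈ (φ).source := by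
    rw [chart_symm_chart_one, one_mul]
    exact (φ).map_target hx
  have hm := (contDiffAt_mulInChart chart_one_mem hx hs).differentiableAt (by simp)
  have hk : MDifferentiableAt 𝓘(ℂ, EG) 𝓘(ℂ, EG) (fun h : G => φ (h * (φ).symm x)) 1 := by
    refine ContMDiffAt.mdifferentiableAt (n := ω) ?_ (by simp)
    refine ContMDiffAt.comp (1 : G) (g := φ) (contMDiffAt_chart ?_)
      (contMDiff_id.mul contMDiff_const).contMDiffAt
    simpa using (φ).map_target hx
  rw [mfderiv_one_eq_fderiv hk]
  have e : (fun h : G => φ (h * (φ).symm x)) ∘ (φ).symm = fun y => mulInChart EG G (y, x) := rfl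
  rw [e]
  have h2 : HasFDerivAt (fun y => mulInChart EG G (y, x)) _ (φ (1 : G)) :=
    HasFDerivAt.comp (f := fun y : EG => (y, x)) (φ (1 : G)) hm.hasFDerivAt
      (hasFDerivAt_prodMk_left (φ (1 : G)) x)
  rw [h2.fderiv]
  simp

/-- Left and right translation by `g` differ by `Ad g`, since `g h = (g h g⁻¹) g`. -/
theorem fderiv_mulInChart_inr_eq_inl {x : EG} (hx : x ∈ (φ).target) (w : EG) :
    fderiv ℂ (mulInChart EG G) (x, φ (1 : G)) (0, w) =
      fderiv ℂ (mulInChart EG G) (φ (1 : G), x) (AdEnd EG ((φ).symm x) w, 0) := by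
  rw [fderiv_mulInChart_inr hx, fderiv_mulInChart_inl hx]
  set g := (φ).symm x
  have hg : g ∈ (φ).source := (φ).map_target hx
  have hk : ∀ y : G, y = 1 → HasMFDerivAt 𝓘(ℂ, EG) 𝓘(ℂ, EG) (fun h : G => φ (h * g)) y
      (mfderiv 𝓘(ℂ, EG) 𝓘(ℂ, EG) (fun h : G => φ (h * g)) 1 : EG →L[ℂ] EG) := by
    rintro _ rfl
    refine MDifferentiableAt.hasMFDerivAt (ContMDiffAt.mdifferentiableAt (n := ω) ?_ (by simp))
    refine ContMDiffAt.comp (1 : G) (g := φ) (contMDiffAt_chart ?_)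
      (contMDiff_id.mul contMDiff_const).contMDiffAt
    simpa using hg
  have h1 := HasMFDerivAt.comp (1 : G) (hk (g * 1 * g⁻¹) (by simp))
    (hasMFDerivAt_conj (EG := EG) g rfl)
  have e : ((fun h : G => φ (h * g)) ∘ fun h : G => g * h * g⁻¹) = fun h => φ (g * h) := by
    ext h
    simp
  rw [e] at h1
  exact congrArg (fun T : EG →L[ℂ] EG => T w) h1.mfderiv

theorem fderiv_mulInChart_one_inr (u : EG) :
    fderiv ℂ (mulInChart EG G) (φ (1 : G), φ (1 : G)) (0, u) = u := by
  have hI : IsManifold 𝓘(ℂ, EG) 1 G := IsManifold.of_le (n := ω) le_top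
  rw [fderiv_mulInChart_inr chart_one_mem]
  have e : (fun h : G => φ ((φ).symm (φ (1 : G)) * h)) = φ := by
    ext h
    rw [chart_symm_chart_one, one_mul]
  have h2 := mfderiv_extChartAt_self (I := 𝓘(ℂ, EG)) (x := (1 : G))
  rw [← e] at h2
  exact congrArg (fun T : EG →L[ℂ] EG => T u) h2

theorem fderiv_mulInChart_one_inl (u : EG) :
    fderiv ℂ (mulInChart EG G) (φ (1 : G), φ (1 : G)) (u, 0) = u := by
  have h := fderiv_mulInChart_inr_eq_inl (chart_one_mem (EG := EG) (G := G)) u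
  rw [chart_symm_chart_one, AdEnd_one, fderiv_mulInChart_one_inr] at h
  exact h.symm

/-- The left-invariant vector field of `v` in the chart at `1`. -/
theorem mpullbackWithin_mulInvariantVectorField {x : EG} (hx : x ∈ (φ).target) (v : EG) :
    (VectorField.mpullbackWithin 𝓘(ℂ, EG) 𝓘(ℂ, EG) (φ).symm
      (mulInvariantVectorField (I := 𝓘(ℂ, EG)) (G := G) v) (Set.range 𝓘(ℂ, EG)) x : EG) =
      fderiv ℂ (mulInChart EG G) (x, φ (1 : G)) (0, v) := by
  have hI : IsManifold 𝓘(ℂ, EG) 1 G := IsManifold.of_le (n := ω) le_top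
  rw [fderiv_mulInChart_inr hx, VectorField.mpullbackWithin_apply,
    ContinuousLinearMap.inverse_eq
      (mfderivWithin_extChartAt_symm_comp_mfderiv_extChartAt hx)
      (mfderiv_extChartAt_comp_mfderivWithin_extChartAt_symm hx)]
  set g := (φ).symm x
  have hg : g ∈ (φ).source := (φ).map_target hx
  have h1 : HasMFDerivAt 𝓘(ℂ, EG) 𝓘(ℂ, EG) (fun h : G => g * h) 1
      (mfderiv 𝓘(ℂ, EG) 𝓘(ℂ, EG) (fun h : G => g * h) 1) :=
    ((contMDiff_mul_left (I := 𝓘(ℂ, EG)) (n := ω) (a := g)).mdifferentiableAt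
      (by simp)).hasMFDerivAt
  have h2 : ∀ y : G, y = g → HasMFDerivAt 𝓘(ℂ, EG) 𝓘(ℂ, EG) φ y
      (mfderiv 𝓘(ℂ, EG) 𝓘(ℂ, EG) φ g : EG →L[ℂ] EG) := by
    rintro _ rfl
    exact ((contMDiffAt_chart hg).mdifferentiableAt (by simp)).hasMFDerivAt
  have h3 := HasMFDerivAt.comp (1 : G) (h2 (g * 1) (mul_one g)) h1
  exact (congrArg (fun T : EG →L[ℂ] EG => T v) h3.mfderiv).symm

/-- The bracket of `𝔤`, that is, the value at `1` of the bracket of left-invariant vector fields,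
in the chart at `1`. -/
theorem lieBracket_eq_sub (v w : EG) :
    lieBracket EG G v w =
      fderiv ℂ (fun x => fderiv ℂ (mulInChart EG G) (x, φ (1 : G)) (0, w)) (φ (1 : G)) v -
      fderiv ℂ (fun x => fderiv ℂ (mulInChart EG G) (x, φ (1 : G)) (0, v)) (φ (1 : G)) w := by
  have hI : IsManifold 𝓘(ℂ, EG) 1 G := IsManifold.of_le (n := ω) le_top
  have hc := fderiv_mulInChart_one_inr (EG := EG) (G := G)
  let V : EG → EG → EG := fun u => VectorField.mpullbackWithin 𝓘(ℂ, EG) 𝓘(ℂ, EG) (φ).symm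
    (mulInvariantVectorField (I := 𝓘(ℂ, EG)) (G := G) u) (Set.range 𝓘(ℂ, EG))
  have e : (φ).symm ⁻¹' Set.univ ∩ Set.range 𝓘(ℂ, EG) = (Set.univ : Set EG) := by simp
  have h : lieBracket EG G v w = VectorField.lieBracketWithin ℂ (V v) (V w)
      ((φ).symm ⁻¹' Set.univ ∩ Set.range 𝓘(ℂ, EG)) (φ (1 : G)) := by
    change (mfderiv 𝓘(ℂ, EG) 𝓘(ℂ, EG) φ (1 : G)).inverse _ = _
    rw [mfderiv_extChartAt_self]
    exact congrArg (fun T : EG →L[ℂ] EG => T _) ContinuousLinearMap.inverse_id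
  have hev : ∀ u : EG, V u
      =ᶠ[𝓝 (φ (1 : G))] fun x => fderiv ℂ (mulInChart EG G) (x, φ (1 : G)) (0, u) := fun u => by
    filter_upwards [extChartAt_target_mem_nhds (I := 𝓘(ℂ, EG)) (1 : G)] with x hx
    exact mpullbackWithin_mulInvariantVectorField hx u
  rw [h, e, VectorField.lieBracketWithin_univ, VectorField.lieBracket_eq]
  beta_reduce
  rw [(hev v).eq_of_nhds, (hev w).eq_of_nhds, (hev v).fderiv_eq, (hev w).fderiv_eq, hc, hc]

theorem hasFDerivAt_AdEnd_chart_symm :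
    HasFDerivAt (fun x => AdEnd EG ((φ).symm x)) (adEnd EG G) (φ (1 : G)) := by
  have hI : IsManifold 𝓘(ℂ, EG) 1 G := IsManifold.of_le (n := ω) le_top
  have hs : HasMFDerivAt 𝓘(ℂ, EG) 𝓘(ℂ, EG) (φ).symm (φ (1 : G)) (1 : EG →L[ℂ] EG) := by
    have h := ((contMDiffAt_chart_symm (chart_one_mem (EG := EG) (G := G))).mdifferentiableAt
      (by simp)).hasMFDerivAt
    have h2 := mfderivWithin_range_extChartAt_symm (I := 𝓘(ℂ, EG)) (x := (1 : G))
    have hr : Set.range 𝓘(ℂ, EG) = (Set.univ : Set EG) := by simp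
    rw [hr, mfderivWithin_univ] at h2
    rw [h2] at h
    exact h
  have h1 : ∀ y : G, y = 1 → HasMFDerivAt 𝓘(ℂ, EG) 𝓘(ℂ, EG →L[ℂ] EG)
      (fun g : G => AdEnd EG g) y (adEnd EG G) := by
    rintro _ rfl
    exact hasMFDerivAt_AdEnd_one
  exact (HasMFDerivAt.comp (φ (1 : G)) (h1 _ chart_symm_chart_one) hs).hasFDerivAt

/-- The differential of `Ad` is the adjoint representation of `𝔤`. -/
theorem adEnd_apply (v w : EG) : adEnd EG G v w = lieBracket EG G v w := by
  rw [lieBracket_eq_sub]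
  have hA := hasFDerivAt_AdEnd_chart_symm (EG := EG) (G := G)
  refine hasFDerivAt_of_partial_fderiv_eq ((contDiffAt_mulInChart chart_one_mem chart_one_mem
    ?_).of_le le_top) hA ?_ fderiv_mulInChart_one_inl ?_ v w
  · rw [chart_symm_chart_one, one_mul]
    exact mem_extChartAt_source (1 : G)
  · rw [chart_symm_chart_one, AdEnd_one]
  · filter_upwards [extChartAt_target_mem_nhds (I := 𝓘(ℂ, EG)) (1 : G)] with x hx w
    exact fderiv_mulInChart_inr_eq_inl hx w

end Bracket

/-- `Ad g` is an automorphism of `𝔤`. -/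
theorem AdEnd_adEnd (g : G) (v w : EG) :
    AdEnd EG g (adEnd EG G v w) = adEnd EG G (AdEnd EG g v) (AdEnd EG g w) := by
  have h1 : ∀ y : G, y = 1 → HasMFDerivAt 𝓘(ℂ, EG) 𝓘(ℂ, EG →L[ℂ] EG)
      (fun g : G => AdEnd EG g) y (adEnd EG G) := by
    rintro _ rfl
    exact hasMFDerivAt_AdEnd_one
  have h2 := HasMFDerivAt.comp (1 : G) (h1 (g * 1 * g⁻¹) (by simp))
    (hasMFDerivAt_conj (EG := EG) g rfl)
  have h3 : HasMFDerivAt 𝓘(ℂ, EG →L[ℂ] EG) 𝓘(ℂ, EG →L[ℂ] EG)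
      (fun A : EG →L[ℂ] EG => AdEnd EG g * A * AdEnd EG g⁻¹) (AdEnd EG (1 : G)) _ :=
    (((hasFDerivAt_id _).const_mul (AdEnd EG g)).mul_const' (AdEnd EG g⁻¹)).hasMFDerivAt
  have h4 := HasMFDerivAt.comp (1 : G) h3 (hasMFDerivAt_AdEnd_one (EG := EG) (G := G))
  have e : ((fun g : G => AdEnd EG g) ∘ fun h : G => g * h * g⁻¹) =
      (fun A : EG →L[ℂ] EG => AdEnd EG g * A * AdEnd EG g⁻¹) ∘ fun g : G => AdEnd EG g := by
    ext1 h
    simp [AdEnd_mul]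
  rw [e] at h2
  have h5 := congrArg (fun T : EG →L[ℂ] EG →L[ℂ] EG => T v (AdEnd EG g w))
    (hasMFDerivAt_unique h4 h2)
  refine Eq.trans ?_ h5
  change _ = AdEnd EG g (adEnd EG G v (AdEnd EG g⁻¹ (AdEnd EG g w)))
  rw [AdEnd_inv_apply]

end Adjoint
end HiggsBundle

namespace HiggsBundle

/-! ### One-parameter subgroups and the exponential map -/

section Exponential

variable {EG : Type*} [NormedAddCommGroup EG] [NormedSpace ℂ EG]
  {G : Type*} [TopologicalSpace G] [ChartedSpace EG G] [Group G] [LieGroup 𝓘(ℂ, EG) ω G]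

theorem hasMFDerivAt_AdEnd_of_eq_one {g : G} (hg : g = 1) :
    HasMFDerivAt 𝓘(ℝ, EG) 𝓘(ℝ, EG →L[ℂ] EG) (fun g : G => AdEnd EG g) g
      ((adEnd EG G).restrictScalars ℝ : EG →L[ℝ] EG →L[ℂ] EG) := by
  subst hg
  exact hasMFDerivAt_AdEnd_one.real_of_complex

/-- The differential of `Ad ∘ s` is `Ad ∘ s` times the adjoint action of the Maurer-Cartan
form of `s`. -/
theorem hasFDerivAt_AdEnd_comp {F : Type*} [NormedAddCommGroup F] [NormedSpace ℝ F] {s : F → G}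
    {z : F} (hs : MDifferentiableAt 𝓘(ℝ, F) 𝓘(ℝ, EG) s z) :
    ∃ L : F →L[ℝ] EG →L[ℂ] EG, HasFDerivAt (fun w => AdEnd EG (s w)) L z ∧
      ∀ v : F, L v = AdEnd EG (s z) * adEnd EG G (maurerCartan EG F s z v) := by
  have hG : LieGroup 𝓘(ℝ, EG) ω G := LieGroup.real_of_complex ω
  have h1 : HasMFDerivAt 𝓘(ℝ, F) 𝓘(ℝ, EG) (fun w => (s z)⁻¹ * s w) z
      (mfderiv 𝓘(ℝ, F) 𝓘(ℝ, EG) (fun w => (s z)⁻¹ * s w) z) := by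
    refine MDifferentiableAt.hasMFDerivAt ?_
    exact MDifferentiableAt.comp z (g := fun g : G => (s z)⁻¹ * g)
      ((contMDiff_mul_left (I := 𝓘(ℝ, EG)) (n := ω)).mdifferentiableAt (by simp)) hs
  have h2 := HasMFDerivAt.comp z (hasMFDerivAt_AdEnd_of_eq_one (inv_mul_cancel (s z))) h1
  have h3 : HasMFDerivAt 𝓘(ℝ, EG →L[ℂ] EG) 𝓘(ℝ, EG →L[ℂ] EG)
      (fun A : EG →L[ℂ] EG => AdEnd EG (s z) * A) (AdEnd EG ((s z)⁻¹ * s z)) _ :=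
    ((hasFDerivAt_id _).const_mul (AdEnd EG (s z))).hasMFDerivAt
  have h4 := HasMFDerivAt.comp z h3 h2
  have e : ((fun A : EG →L[ℂ] EG => AdEnd EG (s z) * A) ∘ (fun g : G => AdEnd EG g) ∘
      fun w => (s z)⁻¹ * s w) = fun w => AdEnd EG (s w) := by
    ext1 w
    simp only [Function.comp_apply]
    rw [← AdEnd_mul, mul_inv_cancel_left]
  rw [e] at h4
  exact ⟨_, h4.hasFDerivAt, fun v => rfl⟩

/-- The differential at `0` of a homomorphism `ℝ → G` with velocity `v` determines its image
under `Ad`. -/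
theorem AdEnd_hom_eq_exp [CompleteSpace EG] {γ : ℝ → G} {v : EG}
    (hadd : ∀ s t, γ (s + t) = γ s * γ t)
    (h : HasMFDerivAt 𝓘(ℝ, ℝ) 𝓘(ℝ, EG) γ 0
      (ContinuousLinearMap.smulRight (1 : ℝ →L[ℝ] ℝ) v)) (t : ℝ) :
    AdEnd EG (γ t) = NormedSpace.exp (t • adEnd EG G v) := by
  have h0 : γ 0 = 1 := by simpa using hadd 0 0
  have h1 := HasMFDerivAt.comp (0 : ℝ) (hasMFDerivAt_AdEnd_of_eq_one h0) h
  have h2 : HasDerivAt (fun t => AdEnd EG (γ t)) (adEnd EG G v) 0 := by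
    have h3 : HasFDerivAt (fun t => AdEnd EG (γ t))
        (((adEnd EG G).restrictScalars ℝ : EG →L[ℝ] EG →L[ℂ] EG).comp
          (ContinuousLinearMap.smulRight (1 : ℝ →L[ℝ] ℝ) v)) 0 := h1.hasFDerivAt
    refine h3.hasDerivAt.congr_deriv ?_
    change adEnd EG G ((1 : ℝ) • v) = _
    rw [one_smul]
  have h3 : ∀ t, HasDerivAt (fun t => AdEnd EG (γ t)) (AdEnd EG (γ t) * adEnd EG G v) t := by
    intro t
    have h4 : HasDerivAt (fun x => AdEnd EG (γ (x - t))) (adEnd EG G v) t := by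
      have := HasDerivAt.scomp_of_eq (g₁ := fun t => AdEnd EG (γ t)) t h2
        ((hasDerivAt_id t).sub_const t) (by simp)
      exact this.congr_deriv (one_smul _ _)
    have h5 := h4.const_mul (AdEnd EG (γ t))
    refine h5.congr_of_eventuallyEq (Filter.Eventually.of_forall fun x => ?_)
    change _ = AdEnd EG (γ t) * AdEnd EG (γ (x - t))
    rw [← AdEnd_mul, ← hadd]
    simp
  have h4 : ∀ t, HasDerivAt (fun t => AdEnd EG (γ t) *
      NormedSpace.exp (t • -adEnd EG G v)) 0 t := by
    intro t
    have h5 := (h3 t).mul (hasDerivAt_exp_smul_const' (𝕂 := ℝ) (-adEnd EG G v) t)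
    refine h5.congr_deriv ?_
    simp only [neg_mul, mul_neg, mul_assoc]
    simp
  have h5 := is_const_of_deriv_eq_zero (fun t => (h4 t).differentiableAt)
    (fun t => (h4 t).deriv) t 0
  have h6 : NormedSpace.exp (t • -adEnd EG G v) * NormedSpace.exp (t • adEnd EG G v) = 1 := by
    let _ : NormedAlgebra ℚ (EG →L[ℂ] EG) := NormedAlgebra.restrictScalars ℚ ℂ _
    rw [← NormedSpace.exp_add_of_commute]
    · simp
    · simp [Commute, SemiconjBy]
  simp only [h0, zero_smul, NormedSpace.exp_zero, AdEnd_one, mul_one] at h5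
  calc AdEnd EG (γ t) = AdEnd EG (γ t) * (NormedSpace.exp (t • -adEnd EG G v) *
        NormedSpace.exp (t • adEnd EG G v)) := by rw [h6, mul_one]
    _ = _ := by rw [← mul_assoc, h5, one_mul]

variable [CompleteSpace EG] [T2Space G]

/-- The integral curve through `1` of the left-invariant vector field of `v` is defined on all of
`ℝ`, and it is a homomorphism. -/
theorem exists_hom_of_velocity (v : EG) :
    ∃ γ : ℝ → G, (∀ s t, γ (s + t) = γ s * γ t) ∧ Continuous γ ∧
      HasMFDerivAt 𝓘(ℝ, ℝ) 𝓘(ℝ, EG) γ 0 (ContinuousLinearMap.smulRight (1 : ℝ →L[ℝ] ℝ) v) := by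
  have hG : LieGroup 𝓘(ℝ, EG) (minSmoothness ℝ 3) G :=
    LieGroup.of_le (n := ω) (by simp) (h := LieGroup.real_of_complex ω)
  have hI : IsManifold 𝓘(ℝ, EG) 1 G := IsManifold.of_le (n := minSmoothness ℝ 3) (by simp)
  let V : (g : G) → TangentSpace 𝓘(ℝ, EG) g := mulInvariantVectorField (I := 𝓘(ℝ, EG)) v
  have hV : ContMDiff 𝓘(ℝ, EG) 𝓘(ℝ, EG).tangent 1 (fun g => (⟨g, V g⟩ : TangentBundle 𝓘(ℝ, EG) G)) :=
    (contMDiff_mulInvariantVectorField (I := 𝓘(ℝ, EG)) v).of_le (by simp)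
  have hmul : ∀ g h x : G, x = h → HasMFDerivAt 𝓘(ℝ, EG) 𝓘(ℝ, EG) (fun y : G => g * y) x
      (mfderiv 𝓘(ℝ, EG) 𝓘(ℝ, EG) (fun y : G => g * y) h : EG →L[ℝ] EG) := by
    rintro g h _ rfl
    exact ((contMDiff_mul_left (I := 𝓘(ℝ, EG)) (n := minSmoothness ℝ 3)).mdifferentiableAt
      (by simp)).hasMFDerivAt
  -- left translations preserve `V`, hence translate integral curves to integral curves
  have hinv : ∀ g h : G, (mfderiv 𝓘(ℝ, EG) 𝓘(ℝ, EG) (fun y : G => g * y) h : EG →L[ℝ] EG) (V h) =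
      V (g * h) := by
    intro g h
    have h1 := HasMFDerivAt.comp (1 : G) (hmul g h (h * 1) (mul_one h)) (hmul h 1 1 rfl)
    have e : (fun y : G => g * y) ∘ (fun y : G => h * y) = fun y => g * h * y := by
      ext1 y
      simp [mul_assoc]
    rw [e] at h1
    exact congrArg (fun T : EG →L[ℝ] EG => T v) (hasMFDerivAt_unique h1 (hmul (g * h) 1 1 rfl))
  have hV1 : V 1 = v := by
    have e : (fun y : G => 1 * y) = id := by ext1 y; simp
    have h2 : HasMFDerivAt 𝓘(ℝ, EG) 𝓘(ℝ, EG) (fun y : G => 1 * y) 1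
        (ContinuousLinearMap.id ℝ EG) := by
      rw [e]
      exact hasMFDerivAt_id _
    exact congrArg (fun T : EG →L[ℝ] EG => T v) h2.mfderiv
  have htrans : ∀ (g : G) (γ : ℝ → G) (s : Set ℝ), IsMIntegralCurveOn γ V s →
      IsMIntegralCurveOn (fun t => g * γ t) V s := by
    intro g γ s hγ t ht
    have h1 := HasMFDerivAt.comp_hasMFDerivWithinAt t (hmul g (γ t) (γ t) rfl) (hγ t ht)
    have e : (mfderiv 𝓘(ℝ, EG) 𝓘(ℝ, EG) (fun y : G => g * y) (γ t) : EG →L[ℝ] EG).comp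
        (ContinuousLinearMap.smulRight (1 : ℝ →L[ℝ] ℝ) (V (γ t) : EG)) =
        ContinuousLinearMap.smulRight (1 : ℝ →L[ℝ] ℝ) (V (g * γ t) : EG) := by
      rw [← hinv g (γ t)]
      ext
      simp
    exact e ▸ h1
  -- translates of the curve through `1` give all points the same time of existence, so the curve
  -- extends to `ℝ`
  obtain ⟨γ₀, hγ₀, hint⟩ := exists_isMIntegralCurveAt_of_contMDiffAt_boundaryless (I := 𝓘(ℝ, EG))
    (0 : ℝ) (hV.contMDiffAt (x := (1 : G)))
  obtain ⟨ε, hε, hint⟩ := isMIntegralCurveAt_iff'.1 hint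
  rw [Real.ball_eq_Ioo, zero_sub, zero_add] at hint
  obtain ⟨γ, hγ, hγint⟩ := exists_isMIntegralCurve_of_isMIntegralCurveOn hV hε
    (fun g => ⟨fun t => g * γ₀ t, by simp [hγ₀], htrans g γ₀ _ hint⟩) 1
  refine ⟨γ, fun s t => ?_, hγint.continuous, ?_⟩
  · have h1 : IsMIntegralCurve (fun t => γ s * γ t) V := by
      rw [isMIntegralCurve_iff_isMIntegralCurveOn] at hγint ⊢
      exact htrans (γ s) γ _ hγint
    have h2 := isMIntegralCurve_Ioo_eq_of_contMDiff_boundaryless (t₀ := 0) hV h1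
      (hγint.comp_add s) (by simp [hγ])
    rw [add_comm]
    exact (congrFun h2 t).symm
  · have h1 := hγint 0
    have e : ∀ g : G, g = 1 → (V g : EG) = v := by
      rintro _ rfl
      exact hV1
    have e2 : ContinuousLinearMap.smulRight (1 : ℝ →L[ℝ] ℝ) (V (γ 0) : EG) =
        ContinuousLinearMap.smulRight (1 : ℝ →L[ℝ] ℝ) v := by
      rw [e _ hγ]
      rfl
    exact e2 ▸ h1

variable [FiniteDimensional ℂ EG] [LieAlgebra.IsSemisimple ℂ (LieAlg EG G)]

/-- A semisimple Lie algebra has trivial centre. -/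
theorem _root_.LieAlgebra.eq_zero_of_forall_lie_eq_zero {L : Type*} [LieRing L] [LieAlgebra ℂ L]
    [LieAlgebra.IsSemisimple ℂ L] {v : L} (h : ∀ w : L, ⁅v, w⁆ = 0) : v = 0 := by
  have hv : v ∈ LieAlgebra.center ℂ L := by
    rw [LieModule.mem_maxTrivSubmodule]
    intro w
    rw [← lie_skew, h, neg_zero]
  rwa [LieAlgebra.center_eq_bot, LieSubmodule.mem_bot] at hv

variable (EG G) in
theorem adEnd_injective : Function.Injective (adEnd EG G) := by
  rw [injective_iff_map_eq_zero]
  intro v hv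
  refine LieAlgebra.eq_zero_of_forall_lie_eq_zero (L := LieAlg EG G) (v := v) fun w => ?_
  have h := adEnd_apply (G := G) v w
  rw [hv] at h
  exact h.symm

/-- Since `ad` is injective, `Ad` is an immersion, and it has a holomorphic left inverse
near `1`. -/
theorem exists_local_leftInverse_AdEnd : ∃ r : (EG →L[ℂ] EG) → G, r 1 = 1 ∧
    (∀ᶠ A in 𝓝 1, ContMDiffAt 𝓘(ℂ, EG →L[ℂ] EG) 𝓘(ℂ, EG) ω r A) ∧
    ∀ᶠ g in 𝓝 (1 : G), r (AdEnd EG g) = g := by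
  obtain ⟨π₀, hπ₀⟩ := LinearMap.exists_leftInverse_of_injective
    (adEnd EG G : EG →ₗ[ℂ] EG →L[ℂ] EG) (LinearMap.ker_eq_bot.2 (adEnd_injective EG G))
  let π : (EG →L[ℂ] EG) →L[ℂ] EG := LinearMap.toContinuousLinearMap π₀
  have hπ : ∀ v, π (adEnd EG G v) = v := fun v => LinearMap.congr_fun hπ₀ v
  let φ := extChartAt 𝓘(ℂ, EG) (1 : G)
  let k : EG → EG := fun x => π (AdEnd EG (φ.symm x))
  have hk : ContDiffAt ℂ ω k (φ 1) := by
    rw [← contMDiffAt_iff_contDiffAt]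
    exact π.contMDiff.contMDiffAt.comp (φ 1) ((contMDiff_AdEnd (EG := EG) (G := G)).contMDiffAt.comp
      (φ 1) (contMDiffAt_chart_symm chart_one_mem))
  have hk' : HasFDerivAt k ((ContinuousLinearEquiv.refl ℂ EG : EG ≃L[ℂ] EG) : EG →L[ℂ] EG) (φ 1) := by
    have h := π.hasFDerivAt.comp (φ 1) (hasFDerivAt_AdEnd_chart_symm (EG := EG) (G := G))
    refine h.congr_fderiv ?_
    ext v
    exact hπ v
  let ℓ := hk.localInverse hk' (by simp)
  have hℓ : ContDiffAt ℂ ω ℓ (k (φ 1)) := hk.to_localInverse hk' (by simp)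
  have hk1 : k (φ 1) = π 1 := by
    change π (AdEnd EG (φ.symm (φ 1))) = _
    rw [chart_symm_chart_one, AdEnd_one]
  have hℓk : ∀ᶠ x in 𝓝 (φ 1), ℓ (k x) = x := HasStrictFDerivAt.eventually_left_inverse _
  rw [hk1] at hℓ
  have hℓ1 : ℓ (π 1) = φ 1 := by rw [← hk1]; exact hℓk.self_of_nhds
  refine ⟨fun A => φ.symm (ℓ (π A)), ?_, ?_, ?_⟩
  · change φ.symm (ℓ (π 1)) = 1
    rw [hℓ1, chart_symm_chart_one]
  · have h1 : ∀ᶠ A in 𝓝 (1 : EG →L[ℂ] EG), ContDiffAt ℂ ω ℓ (π A) :=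
      π.continuous.continuousAt.eventually (hℓ.eventually (by simp))
    have h2 : ∀ᶠ A in 𝓝 (1 : EG →L[ℂ] EG), ℓ (π A) ∈ φ.target := by
      have hc : ContinuousAt (fun A => ℓ (π A)) (1 : EG →L[ℂ] EG) :=
        ContinuousAt.comp hℓ.continuousAt π.continuous.continuousAt
      refine hc.eventually ?_
      change ∀ᶠ y in 𝓝 (ℓ (π 1)), _
      rw [hℓ1]
      exact extChartAt_target_mem_nhds _
    filter_upwards [h1, h2] with A hA1 hA2
    exact (contMDiffAt_chart_symm hA2).comp A (hA1.contMDiffAt.comp A π.contMDiff.contMDiffAt)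
  · have hc : ContinuousAt φ (1 : G) := continuousAt_extChartAt _
    filter_upwards [hc.eventually hℓk, extChartAt_source_mem_nhds (I := 𝓘(ℂ, EG)) (1 : G)]
      with g hg hgs
    have e : k (φ g) = π (AdEnd EG g) := by
      change π (AdEnd EG (φ.symm (φ g))) = _
      rw [φ.left_inv hgs]
    change φ.symm (ℓ (π (AdEnd EG g))) = g
    rw [← e, hg, φ.left_inv hgs]

/-- A homomorphism `ℝ → G` is determined by its velocity: its image under `Ad` is, and `Ad` is
injective near `1`. -/
theorem eq_of_hom_of_velocity {γ γ' : ℝ → G} {v : EG}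
    (hadd : ∀ s t, γ (s + t) = γ s * γ t) (hc : Continuous γ)
    (h : HasMFDerivAt 𝓘(ℝ, ℝ) 𝓘(ℝ, EG) γ 0 (ContinuousLinearMap.smulRight (1 : ℝ →L[ℝ] ℝ) v))
    (hadd' : ∀ s t, γ' (s + t) = γ' s * γ' t) (hc' : Continuous γ')
    (h' : HasMFDerivAt 𝓘(ℝ, ℝ) 𝓘(ℝ, EG) γ' 0 (ContinuousLinearMap.smulRight (1 : ℝ →L[ℝ] ℝ) v)) :
    γ = γ' := by
  have hG : LieGroup 𝓘(ℂ, EG) ω G := inferInstance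
  have hTG : IsTopologicalGroup G := topologicalGroup_of_lieGroup 𝓘(ℂ, EG) ω
  obtain ⟨r, hr1, -, hr⟩ := exists_local_leftInverse_AdEnd (EG := EG) (G := G)
  have hAd : ∀ t, AdEnd EG ((γ t)⁻¹ * γ' t) = 1 := by
    intro t
    rw [AdEnd_mul, AdEnd_hom_eq_exp hadd' h', ← AdEnd_hom_eq_exp hadd h, AdEnd_inv_mul]
  have h0 : γ 0 = 1 := by simpa using hadd 0 0
  have h0' : γ' 0 = 1 := by simpa using hadd' 0 0
  -- the set where the homomorphisms agree is open, as `Ad` is injective near `1`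
  have hcl : IsClopen {t | (γ t)⁻¹ * γ' t = 1} := by
    refine ⟨isClosed_eq (hc.inv.mul hc') continuous_const, ?_⟩
    rw [isOpen_iff_mem_nhds]
    intro t ht
    have hcont : ContinuousAt (fun t => (γ t)⁻¹ * γ' t) t := (hc.inv.mul hc').continuousAt
    have h1 : ∀ᶠ g in 𝓝 ((γ t)⁻¹ * γ' t), r (AdEnd EG g) = g := by
      have ht' : (γ t)⁻¹ * γ' t = 1 := ht
      rwa [ht']
    filter_upwards [hcont.eventually h1] with x hx
    rw [← hx, hAd, hr1]
  have huniv := hcl.eq_univ ⟨0, by simp [h0, h0']⟩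
  ext1 t
  have ht : t ∈ {t | (γ t)⁻¹ * γ' t = 1} := huniv ▸ Set.mem_univ t
  exact (inv_mul_eq_one.1 ht)

/-- The exponential map `t ↦ exp (t v)`, as a homomorphism `ℝ → G`. -/
noncomputable def expLieHom (v : EG) : ℝ → G := (exists_hom_of_velocity (G := G) v).choose

/-- The exponential map of the Lie group `G`. -/
noncomputable def expLie (v : EG) : G := expLieHom v 1

theorem expLieHom_add (v : EG) (s t : ℝ) :
    (expLieHom v (s + t) : G) = expLieHom v s * expLieHom v t :=
  (exists_hom_of_velocity (G := G) v).choose_spec.1 s t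

theorem continuous_expLieHom (v : EG) : Continuous (expLieHom v : ℝ → G) :=
  (exists_hom_of_velocity (G := G) v).choose_spec.2.1

theorem hasMFDerivAt_expLieHom (v : EG) : HasMFDerivAt 𝓘(ℝ, ℝ) 𝓘(ℝ, EG) (expLieHom v : ℝ → G) 0
    (ContinuousLinearMap.smulRight (1 : ℝ →L[ℝ] ℝ) v) :=
  (exists_hom_of_velocity (G := G) v).choose_spec.2.2

/-- Every homomorphism `ℝ → G` is `t ↦ exp (t v)`, where `v` is its velocity. -/
theorem hom_eq_expLie {γ : ℝ → G} {v : EG}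
    (hadd : ∀ s t, γ (s + t) = γ s * γ t) (hc : Continuous γ)
    (h : HasMFDerivAt 𝓘(ℝ, ℝ) 𝓘(ℝ, EG) γ 0 (ContinuousLinearMap.smulRight (1 : ℝ →L[ℝ] ℝ) v))
    (t : ℝ) : γ t = expLie (t • v) := by
  have h1 : HasMFDerivAt 𝓘(ℝ, ℝ) 𝓘(ℝ, EG) (fun s => γ (s * t)) 0
      (ContinuousLinearMap.smulRight (1 : ℝ →L[ℝ] ℝ) (t • v)) := by
    have h2 : HasFDerivAt (fun s : ℝ => s * t)
        (ContinuousLinearMap.smulRight (1 : ℝ →L[ℝ] ℝ) t) 0 :=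
      ((hasDerivAt_id (0 : ℝ)).mul_const t).hasFDerivAt.congr_fderiv (by ext; simp)
    have h3 : ∀ x : ℝ, x = 0 → HasMFDerivAt 𝓘(ℝ, ℝ) 𝓘(ℝ, EG) γ x
      (ContinuousLinearMap.smulRight (1 : ℝ →L[ℝ] ℝ) v) := by rintro _ rfl; exact h
    refine (HasMFDerivAt.comp (0 : ℝ) (h3 (0 * t) (zero_mul t)) h2.hasMFDerivAt).congr_mfderiv ?_
    refine ContinuousLinearMap.ext fun s => ?_
    exact smul_assoc (M := ℝ) (N := ℝ) (α := EG) s t v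
  have h4 := eq_of_hom_of_velocity (γ := fun s => γ (s * t)) (fun a b => by rw [add_mul, hadd])
    (hc.comp (continuous_id.mul continuous_const)) h1 (expLieHom_add (t • v))
    (continuous_expLieHom _) (hasMFDerivAt_expLieHom _)
  simpa [expLie] using congrFun h4 1

theorem expLieHom_eq (v : EG) (t : ℝ) : (expLieHom v t : G) = expLie (t • v) :=
  hom_eq_expLie (expLieHom_add v) (continuous_expLieHom v) (hasMFDerivAt_expLieHom v) t

theorem expLie_add_smul (v : EG) (s t : ℝ) :
    (expLie ((s + t) • v) : G) = expLie (s • v) * expLie (t • v) := by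
  simp only [← expLieHom_eq, expLieHom_add]

theorem AdEnd_expLie (v : EG) :
    AdEnd EG (expLie v : G) = NormedSpace.exp (adEnd EG G v) := by
  have h := AdEnd_hom_eq_exp (expLieHom_add (G := G) v) (hasMFDerivAt_expLieHom v) 1
  rwa [one_smul] at h

variable (G) in
theorem expLie_zero : (expLie (0 : EG) : G) = 1 := by
  have h := expLie_add_smul (G := G) (0 : EG) 0 0
  simpa using h

theorem expLie_neg (v : EG) : (expLie (-v) : G) = (expLie v)⁻¹ := by
  have h := expLie_add_smul (G := G) v (-1) 1
  rw [neg_add_cancel, zero_smul, expLie_zero, neg_one_smul, one_smul] at h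
  exact eq_inv_of_mul_eq_one_left h.symm

theorem expLie_nsmul (v : EG) (n : ℕ) : (expLie (n • v) : G) = expLie v ^ n := by
  induction n with
  | zero => simp [expLie_zero]
  | succ n ih =>
    have h := expLie_add_smul (G := G) v n 1
    rw [one_smul, Nat.cast_smul_eq_nsmul] at h
    rw [pow_succ, ← ih, ← h, ← Nat.cast_smul_eq_nsmul ℝ]
    norm_num

theorem continuous_expLie_smul (v : EG) : Continuous (fun t : ℝ => (expLie (t • v) : G)) := by
  simp only [← expLieHom_eq]
  exact continuous_expLieHom v

theorem hasMFDerivAt_expLie_smul (v : EG) :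
    HasMFDerivAt 𝓘(ℝ, ℝ) 𝓘(ℝ, EG) (fun t : ℝ => (expLie (t • v) : G)) 0
      (ContinuousLinearMap.smulRight (1 : ℝ →L[ℝ] ℝ) v) := by
  have h := hasMFDerivAt_expLieHom (G := G) v
  have e : (expLieHom v : ℝ → G) = fun t : ℝ => (expLie (t • v) : G) := funext (expLieHom_eq v)
  rwa [e] at h

end Exponential
end HiggsBundle

namespace HiggsBundle

/-! ### Smoothness of the exponential map and closed subgroups -/

section ClosedSubgroups

variable {EG : Type*} [NormedAddCommGroup EG] [NormedSpace ℂ EG]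
  {G : Type*} [TopologicalSpace G] [ChartedSpace EG G] [Group G] [LieGroup 𝓘(ℂ, EG) ω G]

/-- The differential of the multiplication at `(1, 1)` is the addition. -/
theorem hasMFDerivAt_mul_of_eq_one {F : Type*} [NormedAddCommGroup F] [NormedSpace ℝ F]
    {s l : F → G} {z : F} {S L : F →L[ℝ] EG} (hs1 : s z = 1) (hl1 : l z = 1)
    (hs : HasMFDerivAt 𝓘(ℝ, F) 𝓘(ℝ, EG) s z S) (hl : HasMFDerivAt 𝓘(ℝ, F) 𝓘(ℝ, EG) l z L) :
    HasMFDerivAt 𝓘(ℝ, F) 𝓘(ℝ, EG) (fun w => s w * l w) z (S + L) := by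
  have hG : LieGroup 𝓘(ℝ, EG) ω G := LieGroup.real_of_complex ω
  have hm : ∀ p : G × G, p = (1, 1) → HasMFDerivAt (𝓘(ℝ, EG).prod 𝓘(ℝ, EG)) 𝓘(ℝ, EG)
      (fun p : G × G => p.1 * p.2) p
      (ContinuousLinearMap.fst ℝ EG EG + ContinuousLinearMap.snd ℝ EG EG) := by
    rintro _ rfl
    have h0 : MDifferentiableAt (𝓘(ℝ, EG).prod 𝓘(ℝ, EG)) 𝓘(ℝ, EG)
      (fun p : G × G => p.1 * p.2) (1, 1) := (contMDiff_mul 𝓘(ℝ, EG) ω).mdifferentiableAt (by simp)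
    refine h0.hasMFDerivAt.congr_mfderiv ?_
    refine ContinuousLinearMap.ext fun v => ?_
    refine (mfderiv_prod_eq_add_apply h0).trans ?_
    have e1 : HasMFDerivAt 𝓘(ℝ, EG) 𝓘(ℝ, EG) (fun z : G => z * 1) 1
        (ContinuousLinearMap.id ℝ EG) :=
      HasMFDerivAt.congr_of_eventuallyEq (hasMFDerivAt_id (1 : G))
        (Filter.Eventually.of_forall mul_one)
    have e2 : HasMFDerivAt 𝓘(ℝ, EG) 𝓘(ℝ, EG) (fun z : G => 1 * z) 1
        (ContinuousLinearMap.id ℝ EG) :=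
      HasMFDerivAt.congr_of_eventuallyEq (hasMFDerivAt_id (1 : G))
        (Filter.Eventually.of_forall one_mul)
    exact congrArg₂ (· + ·) (congrArg (fun T : EG →L[ℝ] EG => T v.1) e1.mfderiv)
      (congrArg (fun T : EG →L[ℝ] EG => T v.2) e2.mfderiv)
  exact HasMFDerivAt.comp z (hm (s z, l z) (by rw [hs1, hl1])) (hs.prodMk hl)

variable [CompleteSpace EG] [T2Space G] [FiniteDimensional ℂ EG]
  [LieAlgebra.IsSemisimple ℂ (LieAlg EG G)]

/-- Near `0` the exponential map is smooth, because it is `v ↦ r (exp (ad v))` for a local left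
inverse `r` of `Ad`. -/
theorem contMDiffAt_expLie_zero :
    ∀ᶠ v in 𝓝 (0 : EG), ContMDiffAt 𝓘(ℂ, EG) 𝓘(ℂ, EG) ω (expLie : EG → G) v := by
  obtain ⟨r, hr1, hrs, hr⟩ := exists_local_leftInverse_AdEnd (EG := EG) (G := G)
  obtain ⟨U, hU, hUo, h1U⟩ := eventually_nhds_iff.1 hr
  have hrc : ContinuousAt r 1 := hrs.self_of_nhds.continuousAt
  have hrU : ∀ᶠ A in 𝓝 (1 : EG →L[ℂ] EG), r A ∈ U :=
    hrc.eventually (by rw [hr1]; exact hUo.mem_nhds h1U)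
  have hexp : ContDiff ℂ ω (fun v : EG => NormedSpace.exp (adEnd EG G v)) :=
    ContDiff.comp (g := fun A : EG →L[ℂ] EG => NormedSpace.exp A)
      (contDiff_iff_contDiffAt.2 fun A => (NormedSpace.exp_analytic (𝕂 := ℂ) A).contDiffAt)
      (adEnd EG G).contDiff
  have hev : ∀ᶠ v in 𝓝 (0 : EG), ContMDiffAt 𝓘(ℂ, EG →L[ℂ] EG) 𝓘(ℂ, EG) ω r
      (NormedSpace.exp (adEnd EG G v)) ∧ r (NormedSpace.exp (adEnd EG G v)) ∈ U := by
    have hc : ContinuousAt (fun v : EG => NormedSpace.exp (adEnd EG G v)) 0 :=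
      hexp.continuous.continuousAt
    have h1 : ∀ᶠ A in 𝓝 (NormedSpace.exp (adEnd EG G (0 : EG))),
        ContMDiffAt 𝓘(ℂ, EG →L[ℂ] EG) 𝓘(ℂ, EG) ω r A ∧ r A ∈ U := by
      rw [map_zero, NormedSpace.exp_zero]
      exact hrs.and hrU
    exact hc.eventually h1
  obtain ⟨δ, hδ, hball⟩ := Metric.eventually_nhds_iff.1 hev
  have key : ∀ v : EG, ‖v‖ < δ → (expLie v : G) = r (NormedSpace.exp (adEnd EG G v)) := by
    intro v hv
    have hb : ∀ t : unitInterval, dist ((t : ℝ) • v) 0 < δ := by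
      intro t
      rw [dist_zero_right, norm_smul, Real.norm_of_nonneg t.2.1]
      exact (mul_le_of_le_one_left (norm_nonneg v) t.2.2).trans_lt hv
    have hcont1 : Continuous fun t : unitInterval => (expLie ((t : ℝ) • v) : G) :=
      (continuous_expLie_smul v).comp continuous_subtype_val
    have hcont2 : Continuous fun t : unitInterval =>
        r (NormedSpace.exp (adEnd EG G ((t : ℝ) • v))) := by
      rw [continuous_iff_continuousAt]
      intro t
      refine ContinuousAt.comp (g := r) (hball (hb t)).1.continuousAt ?_
      exact (hexp.continuous.comp (continuous_subtype_val.smul continuous_const)).continuousAt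
    -- the two sides agree for `t = 0`, and the set of `t` for which they do is open and closed
    have hcl : IsClopen {t : unitInterval | (expLie ((t : ℝ) • v) : G) =
        r (NormedSpace.exp (adEnd EG G ((t : ℝ) • v)))} := by
      refine ⟨isClosed_eq hcont1 hcont2, ?_⟩
      rw [isOpen_iff_mem_nhds]
      intro t ht
      have hmem : (expLie ((t : ℝ) • v) : G) ∈ U := by
        have ht' : (expLie ((t : ℝ) • v) : G) =
          r (NormedSpace.exp (adEnd EG G ((t : ℝ) • v))) := ht
        rw [ht']
        exact (hball (hb t)).2
      filter_upwards [hcont1.continuousAt.eventually (hUo.mem_nhds hmem)] with x hx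
      have h2 := hU _ hx
      rw [AdEnd_expLie] at h2
      exact h2.symm
    have huniv := hcl.eq_univ ⟨0, by simp [expLie_zero, hr1]⟩
    have h1 : (1 : unitInterval) ∈ {t : unitInterval | (expLie ((t : ℝ) • v) : G) =
        r (NormedSpace.exp (adEnd EG G ((t : ℝ) • v)))} := huniv ▸ Set.mem_univ _
    simpa using h1
  have hd : ∀ᶠ v in 𝓝 (0 : EG), ‖v‖ < δ := by
    filter_upwards [Metric.ball_mem_nhds (0 : EG) hδ] with v hv
    simpa using hv
  filter_upwards [hd.eventually_nhds, hev] with v hv hv2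
  refine ContMDiffAt.congr_of_eventuallyEq (f := r ∘ fun v : EG => NormedSpace.exp (adEnd EG G v))
    ?_ (hv.mono fun w hw => key w hw)
  exact hv2.1.comp v hexp.contMDiff.contMDiffAt

/-- Smoothness near `0` implies smoothness at `v`, since `exp v = exp (v / n) ^ n`. -/
theorem contMDiff_expLie : ContMDiff 𝓘(ℂ, EG) 𝓘(ℂ, EG) ω (expLie : EG → G) := by
  intro v
  have hlim : Filter.Tendsto (fun n : ℕ => ((n : ℂ)⁻¹) • v) Filter.atTop (𝓝 0) := by
    have h := (tendsto_inv_atTop_nhds_zero_nat (𝕜 := ℂ)).smul_const v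
    simpa using h
  obtain ⟨n, hn, hn0⟩ := ((hlim.eventually (contMDiffAt_expLie_zero (G := G))).and
    (Filter.eventually_gt_atTop 0)).exists
  have e : (expLie : EG → G) = fun w => expLie ((n : ℂ)⁻¹ • w) ^ n := by
    ext1 w
    rw [← expLie_nsmul, ← Nat.cast_smul_eq_nsmul ℂ, smul_smul,
      mul_inv_cancel₀ (by exact_mod_cast hn0.ne'), one_smul]
  rw [e]
  have hp : ContMDiff 𝓘(ℂ, EG) 𝓘(ℂ, EG) ω (fun g : G => g ^ n) := contMDiff_pow n
  refine hp.contMDiffAt.comp v ?_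
  exact ContMDiffAt.comp v (g := (expLie : EG → G)) hn
    ((contDiff_const_smul ((n : ℂ)⁻¹)).contMDiff.contMDiffAt)

/-- The differential of the exponential map at `0` is the identity. -/
theorem hasMFDerivAt_expLie_zero :
    HasMFDerivAt 𝓘(ℝ, EG) 𝓘(ℝ, EG) (expLie : EG → G) 0 (ContinuousLinearMap.id ℝ EG) := by
  have h := (((contMDiff_expLie (EG := EG) (G := G)).real_of_complex).mdifferentiableAt
    (x := 0) (by simp)).hasMFDerivAt
  refine h.congr_mfderiv (ContinuousLinearMap.ext fun (v : EG) => ?_)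
  have h1 : HasFDerivAt (fun t : ℝ => t • v) (ContinuousLinearMap.smulRight (1 : ℝ →L[ℝ] ℝ) v)
      0 := ((hasDerivAt_id (0 : ℝ)).smul_const v).hasFDerivAt.congr_fderiv (by ext; simp)
  have h2 : ∀ x : EG, x = 0 → HasMFDerivAt 𝓘(ℝ, EG) 𝓘(ℝ, EG) (expLie : EG → G) x
      (mfderiv 𝓘(ℝ, EG) 𝓘(ℝ, EG) (expLie : EG → G) 0 : EG →L[ℝ] EG) := by
    rintro _ rfl
    exact h
  have h3 := HasMFDerivAt.comp (0 : ℝ) (h2 ((0 : ℝ) • v) (zero_smul ℝ v)) h1.hasMFDerivAt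
  have h4 := congrArg (fun T : ℝ →L[ℝ] EG => T 1)
    (hasMFDerivAt_unique h3 (hasMFDerivAt_expLie_smul (G := G) v))
  have e1 : ((1 : ℝ) • v : EG) = v := one_smul ℝ v
  change (mfderiv 𝓘(ℝ, EG) 𝓘(ℝ, EG) (expLie : EG → G) 0 : EG →L[ℝ] EG) ((1 : ℝ) • v) =
    (1 : ℝ) • v at h4
  rw [e1] at h4
  exact h4

/-- A local inverse of a smooth map from the Lie algebra to `G` with invertible differential
at `0`. -/
theorem exists_local_inverse {Ψ : EG → G} (h0 : Ψ 0 = 1)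
    (hs : ContMDiff 𝓘(ℝ, EG) 𝓘(ℝ, EG) ∞ Ψ)
    (hd : HasMFDerivAt 𝓘(ℝ, EG) 𝓘(ℝ, EG) Ψ 0 (ContinuousLinearMap.id ℝ EG)) :
    ∃ log : G → EG, log 1 = 0 ∧ HasMFDerivAt 𝓘(ℝ, EG) 𝓘(ℝ, EG) log 1 (ContinuousLinearMap.id ℝ EG) ∧
      ∀ᶠ g in 𝓝 (1 : G), Ψ (log g) = g := by
  have hG : LieGroup 𝓘(ℝ, EG) ω G := LieGroup.real_of_complex ω
  have hI : IsManifold 𝓘(ℝ, EG) 1 G := IsManifold.of_le (n := ω) le_top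
  let φ := extChartAt 𝓘(ℝ, EG) (1 : G)
  let k : EG → EG := fun v => φ (Ψ v)
  have hφ : ∀ g : G, g = 1 →
      HasMFDerivAt 𝓘(ℝ, EG) 𝓘(ℝ, EG) φ g (ContinuousLinearMap.id ℝ EG) := by
    rintro _ rfl
    have h1 := (mdifferentiableAt_extChartAt (I := 𝓘(ℝ, EG)) (mem_chart_source EG (1 : G))).hasMFDerivAt
    rw [mfderiv_extChartAt_self] at h1
    exact h1
  have hk : ContDiffAt ℝ ∞ k 0 := by
    rw [← contMDiffAt_iff_contDiffAt]
    refine ContMDiffAt.comp (0 : EG) (g := φ) ?_ hs.contMDiffAt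
    rw [h0]
    exact contMDiffAt_extChartAt
  have hk' : HasFDerivAt k ((ContinuousLinearEquiv.refl ℝ EG : EG ≃L[ℝ] EG) : EG →L[ℝ] EG) 0 :=
    (HasMFDerivAt.comp (0 : EG) (hφ (Ψ 0) h0) hd).hasFDerivAt
  have hks : HasStrictFDerivAt k ((ContinuousLinearEquiv.refl ℝ EG : EG ≃L[ℝ] EG) : EG →L[ℝ] EG) 0 :=
    hk.hasStrictFDerivAt' hk' (by simp)
  have hk0 : k 0 = φ 1 := by change φ (Ψ 0) = _; rw [h0]
  let ℓ := hks.localInverse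
  have hℓ : HasFDerivAt ℓ (ContinuousLinearMap.id ℝ EG) (k 0) := hks.to_localInverse.hasFDerivAt
  have hℓk : ∀ᶠ y in 𝓝 (k 0), k (ℓ y) = y := hks.eventually_right_inverse
  have hℓ0 : ℓ (k 0) = 0 := hks.localInverse_apply_image
  rw [hk0] at hℓ hℓk hℓ0
  have hφc : ContinuousAt φ (1 : G) := continuousAt_extChartAt _
  have hd2 : HasMFDerivAt 𝓘(ℝ, EG) 𝓘(ℝ, EG) (fun g => ℓ (φ g)) 1 (ContinuousLinearMap.id ℝ EG) :=
    HasMFDerivAt.comp (1 : G) hℓ.hasMFDerivAt (hφ 1 rfl)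
  refine ⟨fun g => ℓ (φ g), hℓ0, hd2, ?_⟩
  have h1 : ∀ᶠ g in 𝓝 (1 : G), Ψ (ℓ (φ g)) ∈ φ.source := by
    have hc : ContinuousAt (fun g => Ψ (ℓ (φ g))) (1 : G) :=
      ContinuousAt.comp hs.continuous.continuousAt hd2.continuousAt
    refine hc.eventually ?_
    change ∀ᶠ x in 𝓝 (Ψ (ℓ (φ 1))), _
    rw [hℓ0, h0]
    exact extChartAt_source_mem_nhds _
  filter_upwards [h1, hφc.eventually hℓk, extChartAt_source_mem_nhds (I := 𝓘(ℝ, EG)) (1 : G)]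
    with g hg1 hg2 hg3
  exact φ.injOn hg1 hg3 hg2

theorem isOneParam_expLie (v : EG) : IsOneParam EG (fun t : ℝ => (expLie (t • v) : G)) v where
  map_add s t := expLie_add_smul v s t
  smooth := by
    refine ContMDiff.comp (g := (expLie : EG → G))
      ((contMDiff_expLie (EG := EG) (G := G)).real_of_complex.of_le (by simp)) ?_
    exact (contDiff_id.smul contDiff_const).contMDiff
  velocity := by
    rw [(hasMFDerivAt_expLie_smul v).mfderiv]
    exact one_smul ℝ v

theorem IsOneParam.eq_expLie {γ : ℝ → G} {v : EG} (h : IsOneParam EG γ v) (t : ℝ) :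
    γ t = expLie (t • v) := by
  refine hom_eq_expLie h.map_add h.smooth.continuous ?_ t
  refine ((h.smooth.mdifferentiableAt (x := 0) (by simp)).hasMFDerivAt).congr_mfderiv ?_
  refine ContinuousLinearMap.ext_ring ?_
  refine Eq.trans h.velocity ?_
  exact (one_smul ℝ v).symm

theorem mem_lieAlgOf_iff {L : Subgroup G} {v : EG} :
    v ∈ lieAlgOf EG L ↔ ∀ t : ℝ, (expLie (t • v) : G) ∈ L := by
  constructor
  · rintro ⟨γ, hγ, hL⟩ t
    rw [← hγ.eq_expLie]
    exact hL t
  · exact fun h => ⟨_, isOneParam_expLie v, h⟩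

/-- The velocity at `1` of a curve in a closed subgroup belongs to its Lie algebra, because
`exp (t v)` is the limit of the powers `γ (t / n) ^ n`. -/
theorem velocity_mem_lieAlgOf {L : Subgroup G} (hL : IsClosed (L : Set G)) {γ : ℝ → G} {v : EG}
    (h0 : γ 0 = 1)
    (h : HasMFDerivAt 𝓘(ℝ, ℝ) 𝓘(ℝ, EG) γ 0 (ContinuousLinearMap.smulRight (1 : ℝ →L[ℝ] ℝ) v))
    (hγ : ∀ᶠ t in 𝓝 (0 : ℝ), γ t ∈ L) : v ∈ lieAlgOf EG L := by
  obtain ⟨log, hlog1, hlog, hexp⟩ := exists_local_inverse (expLie_zero (EG := EG) G)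
    ((contMDiff_expLie (EG := EG) (G := G)).real_of_complex.of_le (by simp)) hasMFDerivAt_expLie_zero
  have hlog' : ∀ g : G, g = 1 →
      HasMFDerivAt 𝓘(ℝ, EG) 𝓘(ℝ, EG) log g (ContinuousLinearMap.id ℝ EG) := by
    rintro _ rfl
    exact hlog
  have hξ : HasFDerivAt (fun t => log (γ t)) (ContinuousLinearMap.smulRight (1 : ℝ →L[ℝ] ℝ) v) 0 :=
    (HasMFDerivAt.comp (0 : ℝ) (hlog' (γ 0) h0) h).hasFDerivAt
  have hξ' : HasDerivAt (fun t => log (γ t)) v 0 := hξ.hasDerivAt.congr_deriv (by simp)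
  have hexp' : ∀ᶠ t in 𝓝 (0 : ℝ), expLie (log (γ t)) = γ t := by
    refine h.continuousAt.eventually (p := fun g => expLie (log g) = g) ?_
    rwa [h0]
  rw [mem_lieAlgOf_iff]
  intro t
  have hlim0 : Filter.Tendsto (fun n : ℕ => (n : ℝ)⁻¹) Filter.atTop (𝓝 0) :=
    tendsto_inv_atTop_nhds_zero_nat
  have hlimt : Filter.Tendsto (fun n : ℕ => (n : ℝ)⁻¹ * t) Filter.atTop (𝓝 0) := by
    simpa using hlim0.mul_const t
  have hlim : Filter.Tendsto (fun n : ℕ => n • log (γ ((n : ℝ)⁻¹ * t))) Filter.atTop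
      (𝓝 (t • v)) := by
    have h1 : HasDerivAt (fun s : ℝ => log (γ (s * t))) (t • v) 0 := by
      refine (HasDerivAt.scomp_of_eq (g₁ := fun t => log (γ t)) (0 : ℝ) hξ'
        ((hasDerivAt_id (0 : ℝ)).mul_const t) (by simp)).congr_deriv ?_
      simp
    have h2 := h1.tendsto_slope_zero.comp (f := fun n : ℕ => (n : ℝ)⁻¹) (x := Filter.atTop)
      (tendsto_nhdsWithin_iff.2 ⟨hlim0, by
        filter_upwards [Filter.eventually_gt_atTop 0] with n hn
        simpa using hn.ne'⟩)
    refine h2.congr fun n => ?_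
    simp [h0, hlog1, ← Nat.cast_smul_eq_nsmul ℝ]
  have hlim2 := ((contMDiff_expLie (EG := EG) (G := G)).continuous.tendsto (t • v)).comp hlim
  refine hL.mem_of_tendsto hlim2 ?_
  filter_upwards [hlimt.eventually hexp', hlimt.eventually hγ] with n hn1 hn2
  simp only [Function.comp_apply]
  rw [expLie_nsmul, hn1]
  exact L.pow_mem hn2 n

/-- The Lie algebra of a closed subgroup, as a real subspace. -/
noncomputable def lieSubspace (L : Subgroup G) (hL : IsClosed (L : Set G)) : Submodule ℝ EG where
  carrier := lieAlgOf EG L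
  zero_mem' := mem_lieAlgOf_iff.2 fun t => by
    have e : t • (0 : EG) = 0 := smul_zero t
    rw [e, expLie_zero]
    exact L.one_mem
  add_mem' {a b} ha hb := by
    have h1 := hasMFDerivAt_mul_of_eq_one (s := fun t : ℝ => (expLie (t • (a : EG)) : G))
      (l := fun t : ℝ => (expLie (t • (b : EG)) : G)) (z := 0)
      (by simp [expLie_zero]) (by simp [expLie_zero]) (hasMFDerivAt_expLie_smul (a : EG))
      (hasMFDerivAt_expLie_smul (b : EG))
    refine velocity_mem_lieAlgOf (EG := EG) (v := (a + b : EG)) hL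
      (γ := fun t : ℝ => (expLie (t • (a : EG)) : G) * expLie (t • (b : EG)))
      (by simp [expLie_zero]) (h1.congr_mfderiv ?_)
      (Filter.Eventually.of_forall fun t =>
        L.mul_mem (mem_lieAlgOf_iff.1 ha t) (mem_lieAlgOf_iff.1 hb t))
    exact ContinuousLinearMap.ext fun (x : ℝ) => (smul_add (x : ℝ) (a : EG) (b : EG)).symm
  smul_mem' c v hv := mem_lieAlgOf_iff.2 fun t => by
    have e : t • c • (v : EG) = (t * c) • (v : EG) := smul_smul t c v
    rw [e]
    exact mem_lieAlgOf_iff.1 hv _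

theorem mem_lieSubspace {L : Subgroup G} {hL : IsClosed (L : Set G)} {v : EG} :
    v ∈ lieSubspace L hL ↔ v ∈ lieAlgOf EG L := Iff.rfl

/-- The Maurer-Cartan form of a map into a closed subgroup takes values in its Lie algebra. -/
theorem maurerCartan_mem_lieAlgOf {F : Type*} [NormedAddCommGroup F] [NormedSpace ℝ F]
    {L : Subgroup G} (hL : IsClosed (L : Set G)) {l : F → G} {z : F}
    (hl : MDifferentiableAt 𝓘(ℝ, F) 𝓘(ℝ, EG) l z) (h : ∀ᶠ w in 𝓝 z, l w ∈ L) (v : F) :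
    maurerCartan EG F l z v ∈ lieAlgOf EG L := by
  have hG : LieGroup 𝓘(ℝ, EG) ω G := LieGroup.real_of_complex ω
  have h1 : ∀ w : F, w = z → HasMFDerivAt 𝓘(ℝ, F) 𝓘(ℝ, EG) (fun w => (l z)⁻¹ * l w) w
      (mfderiv 𝓘(ℝ, F) 𝓘(ℝ, EG) (fun w => (l z)⁻¹ * l w) z : F →L[ℝ] EG) := by
    rintro _ rfl
    refine MDifferentiableAt.hasMFDerivAt ?_
    exact MDifferentiableAt.comp _ (g := fun g : G => (l _)⁻¹ * g)
      ((contMDiff_mul_left (I := 𝓘(ℝ, EG)) (n := ω)).mdifferentiableAt (by simp)) hl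
  have h2 : HasFDerivAt (fun t : ℝ => z + t • v)
      (ContinuousLinearMap.smulRight (1 : ℝ →L[ℝ] ℝ) v) 0 :=
    (((hasDerivAt_id (0 : ℝ)).smul_const v).const_add z).hasFDerivAt.congr_fderiv (by ext; simp)
  have h3 := HasMFDerivAt.comp (0 : ℝ) (h1 (z + (0 : ℝ) • v) (by simp)) h2.hasMFDerivAt
  refine velocity_mem_lieAlgOf (EG := EG) hL
    (v := (mfderiv 𝓘(ℝ, F) 𝓘(ℝ, EG) (fun w => (l z)⁻¹ * l w) z : F →L[ℝ] EG) v)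
    (γ := fun t : ℝ => (l z)⁻¹ * l (z + t • v)) (by simp) (h3.congr_mfderiv ?_) ?_
  · refine ContinuousLinearMap.ext fun (x : ℝ) => ?_
    exact (mfderiv 𝓘(ℝ, F) 𝓘(ℝ, EG) (fun w => (l z)⁻¹ * l w) z : F →L[ℝ] EG).map_smul x v
  · have hc : ContinuousAt (fun t : ℝ => z + t • v) 0 := h2.continuousAt
    have h4 : ∀ᶠ w in 𝓝 (z + (0 : ℝ) • v), l w ∈ L := by simpa using h
    filter_upwards [hc.eventually h4] with t ht
    exact L.mul_mem (L.inv_mem h.self_of_nhds) ht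

theorem exp_smul_adEnd_apply_of_eq_zero {a b : EG} (h : adEnd EG G a b = 0) :
    NormedSpace.exp (adEnd EG G a) b = b := by
  have h1 : ∀ t : ℝ, HasDerivAt (fun t : ℝ => NormedSpace.exp (t • adEnd EG G a) b) 0 t := by
    intro t
    have h2 := (hasDerivAt_exp_smul_const (𝕂 := ℝ) (adEnd EG G a) t)
    have h3 := (ContinuousLinearMap.apply ℂ EG b).restrictScalars ℝ |>.hasFDerivAt.comp_hasDerivAt t h2
    refine h3.congr_deriv ?_
    change NormedSpace.exp (t • adEnd EG G a) (adEnd EG G a b) = 0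
    rw [h, map_zero]
  have h2 := is_const_of_deriv_eq_zero (fun t => (h1 t).differentiableAt)
    (fun t => (h1 t).deriv) 1 0
  simpa using h2

theorem AdEnd_expLie_apply_of_eq_zero {a b : EG} (h : adEnd EG G a b = 0) :
    AdEnd EG (expLie a : G) b = b := by
  rw [AdEnd_expLie, exp_smul_adEnd_apply_of_eq_zero h]

theorem conj_expLie (g : G) (v : EG) :
    g * expLie v * g⁻¹ = expLie (AdEnd EG g v) := by
  have hc : Continuous fun t : ℝ => g * expLie (t • v) * g⁻¹ :=
    (contMDiff_conj (EG := EG) g).continuous.comp (continuous_expLie_smul v)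
  have h1 : ∀ x : G, x = 1 → HasMFDerivAt 𝓘(ℝ, EG) 𝓘(ℝ, EG) (fun h : G => g * h * g⁻¹) x
      ((AdEnd EG g).restrictScalars ℝ : EG →L[ℝ] EG) := fun x hx =>
    (hasMFDerivAt_conj g hx).real_of_complex
  have h2 := HasMFDerivAt.comp (0 : ℝ) (h1 (expLie ((0 : ℝ) • v)) (by simp [expLie_zero]))
    (hasMFDerivAt_expLie_smul (G := G) v)
  have h3 := hom_eq_expLie (γ := fun t : ℝ => g * expLie (t • v) * g⁻¹) (v := AdEnd EG g v)
    (fun s t => by rw [expLie_add_smul]; group) hc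
    (h2.congr_mfderiv (ContinuousLinearMap.ext fun (x : ℝ) =>
      ((AdEnd EG g).restrictScalars ℝ).map_smul x v)) 1
  simpa using h3

theorem commute_expLie {a b : EG} (h : adEnd EG G a b = 0) :
    Commute (expLie a : G) (expLie b) := by
  have h1 := conj_expLie (expLie a : G) b
  rw [AdEnd_expLie_apply_of_eq_zero h] at h1
  exact mul_inv_eq_iff_eq_mul.1 h1

theorem expLie_add {a b : EG} (h : adEnd EG G a b = 0) :
    (expLie (a + b) : G) = expLie a * expLie b := by
  have hG : IsTopologicalGroup G := topologicalGroup_of_lieGroup 𝓘(ℂ, EG) ω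
  have hcomm : ∀ s t : ℝ, Commute (expLie (s • a) : G) (expLie (t • b)) := by
    intro s t
    refine commute_expLie ?_
    have e1 : adEnd EG G (s • a) = s • adEnd EG G a := LinearMap.map_smul_of_tower _ s a
    have e2 : adEnd EG G a (t • b) = t • adEnd EG G a b := LinearMap.map_smul_of_tower _ t b
    rw [e1, smul_apply, e2, h, smul_zero, smul_zero]
  have h1 := hasMFDerivAt_mul_of_eq_one (s := fun t : ℝ => (expLie (t • a) : G))
      (l := fun t : ℝ => (expLie (t • b) : G)) (z := 0)
      (by simp [expLie_zero]) (by simp [expLie_zero]) (hasMFDerivAt_expLie_smul a)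
      (hasMFDerivAt_expLie_smul b)
  have h2 := hom_eq_expLie (γ := fun t : ℝ => (expLie (t • a) : G) * expLie (t • b)) (v := a + b)
    (fun s t => by
      rw [expLie_add_smul, expLie_add_smul, mul_assoc, mul_assoc, ← mul_assoc (expLie (t • a)),
        (hcomm t s).eq, mul_assoc])
    ((continuous_expLie_smul a).mul (continuous_expLie_smul b))
    (h1.congr_mfderiv (ContinuousLinearMap.ext fun (x : ℝ) => (smul_add x a b).symm)) 1
  simpa using h2.symm

/-- If the directions of a sequence of small elements `b` with `exp b ∈ L` accumulate at a unit
vector, this vector belongs to the Lie algebra of the closed subgroup `L`. -/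
theorem mem_lieAlgOf_of_tendsto_direction {L : Subgroup G} (hL : IsClosed (L : Set G))
    {b : ℕ → EG} (hb : Filter.Tendsto b Filter.atTop (𝓝 0))
    (hbL : ∀ n, (expLie (b n) : G) ∈ L) {u : EG}
    (hu : Filter.Tendsto (fun n => ‖b n‖⁻¹ • b n) Filter.atTop (𝓝 u)) : u ∈ lieAlgOf EG L := by
  rw [mem_lieAlgOf_iff]
  intro t
  -- the integral multiples `⌊t / ‖b‖⌋ b` tend to `t u`, as the error is at most `‖b‖`
  have hlim : Filter.Tendsto (fun n => ⌊t / ‖b n‖⌋ • b n) Filter.atTop (𝓝 (t • u)) := by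
    have h1 : Filter.Tendsto (fun n => t • ‖b n‖⁻¹ • b n) Filter.atTop (𝓝 (t • u)) :=
      hu.const_smul t
    have h2 : Filter.Tendsto (fun n => Int.fract (t / ‖b n‖) • b n) Filter.atTop (𝓝 0) := by
      rw [tendsto_zero_iff_norm_tendsto_zero]
      refine squeeze_zero (fun n => norm_nonneg _) (fun n => ?_) (tendsto_zero_iff_norm_tendsto_zero.1 hb)
      rw [norm_smul, Real.norm_of_nonneg (Int.fract_nonneg _)]
      exact mul_le_of_le_one_left (norm_nonneg _) (Int.fract_lt_one _).le
    have h3 := h1.sub h2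
    rw [sub_zero] at h3
    refine h3.congr fun n => ?_
    rw [smul_smul, ← sub_smul, ← div_eq_mul_inv, Int.self_sub_fract, Int.cast_smul_eq_zsmul]
  have hlim2 := ((contMDiff_expLie (EG := EG) (G := G)).continuous.tendsto (t • u)).comp hlim
  refine hL.mem_of_tendsto hlim2 (Filter.Eventually.of_forall fun n => ?_)
  simp only [Function.comp_apply]
  have hz : ∀ k : ℤ, (expLie (k • b n) : G) ∈ L := by
    intro k
    obtain ⟨m, rfl | rfl⟩ := k.eq_nat_or_neg
    · rw [natCast_zsmul, expLie_nsmul]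
      exact L.pow_mem (hbL n) m
    · rw [neg_smul, expLie_neg, natCast_zsmul, expLie_nsmul]
      exact L.inv_mem (L.pow_mem (hbL n) m)
  exact hz _

variable (EG) in
/-- Near `1`, a closed subgroup consists of exponentials of elements of its Lie algebra. -/
theorem eventually_mem_exp_lieAlgOf {L : Subgroup G} (hL : IsClosed (L : Set G)) :
    ∀ᶠ g in 𝓝 (1 : G), g ∈ L → ∃ v : EG, v ∈ lieAlgOf EG L ∧ g = expLie v := by
  have hG : LieGroup 𝓘(ℝ, EG) ω G := LieGroup.real_of_complex ω
  have hFD : FiniteDimensional ℝ EG := FiniteDimensional.complexToReal EG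
  have hprop : ProperSpace EG := FiniteDimensional.proper ℝ EG
  obtain ⟨p₀, hp₀⟩ := LinearMap.exists_leftInverse_of_injective
    (lieSubspace (EG := EG) L hL).subtype (Submodule.ker_subtype _)
  let p : EG →L[ℝ] EG := LinearMap.toContinuousLinearMap ((lieSubspace L hL).subtype ∘ₗ p₀)
  have hp1 : ∀ v : EG, p v ∈ lieAlgOf EG L := fun v => (p₀ v).2
  have hp2 : ∀ v : EG, v ∈ lieAlgOf EG L → p v = v := fun v hv =>
    congrArg Subtype.val (LinearMap.congr_fun hp₀ (⟨v, hv⟩ : lieSubspace (EG := EG) L hL))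
  -- exponential coordinates adapted to the splitting of the Lie algebra given by `p`
  let Ψ : EG → G := fun v => expLie (p v) * expLie (v - p v)
  have hΨ0 : Ψ 0 = 1 := by simp [Ψ, expLie_zero]
  have hexp : ContMDiff 𝓘(ℝ, EG) 𝓘(ℝ, EG) ∞ (expLie : EG → G) :=
    (contMDiff_expLie (EG := EG) (G := G)).real_of_complex.of_le (by simp)
  have hG' : LieGroup 𝓘(ℝ, EG) ∞ G := LieGroup.of_le (n := ω) (by simp)
  have hΨ : ContMDiff 𝓘(ℝ, EG) 𝓘(ℝ, EG) ∞ Ψ :=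
    (hexp.comp p.contMDiff).mul (hexp.comp (contDiff_id.sub p.contDiff).contMDiff)
  have hexp0 : ∀ v : EG, v = 0 → HasMFDerivAt 𝓘(ℝ, EG) 𝓘(ℝ, EG) (expLie : EG → G) v
      (ContinuousLinearMap.id ℝ EG) := by
    rintro _ rfl
    exact hasMFDerivAt_expLie_zero
  have hΨd : HasMFDerivAt 𝓘(ℝ, EG) 𝓘(ℝ, EG) Ψ 0 (ContinuousLinearMap.id ℝ EG) := by
    have h1 : HasMFDerivAt 𝓘(ℝ, EG) 𝓘(ℝ, EG) (fun v => (expLie (p v) : G)) 0 p :=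
      HasMFDerivAt.comp (0 : EG) (hexp0 (p 0) (map_zero p)) p.hasFDerivAt.hasMFDerivAt
    have h2 : HasMFDerivAt 𝓘(ℝ, EG) 𝓘(ℝ, EG) (fun v => (expLie (v - p v) : G)) 0
        (ContinuousLinearMap.id ℝ EG - p) :=
      HasMFDerivAt.comp (0 : EG) (hexp0 (0 - p 0) (by simp))
        ((hasFDerivAt_id (0 : EG)).sub p.hasFDerivAt).hasMFDerivAt
    refine (hasMFDerivAt_mul_of_eq_one (by simp [expLie_zero]) (by simp [expLie_zero])
      h1 h2).congr_mfderiv (ContinuousLinearMap.ext fun (v : EG) => ?_)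
    exact add_sub_cancel (p v) v
  obtain ⟨log, hlog1, hlog, hexplog⟩ := exists_local_inverse hΨ0 hΨ hΨd
  -- otherwise the directions of the elements `v - p v` accumulate at a unit vector `u` in the Lie
  -- algebra of `L` with `p u = 0`, whereas `p u = u`
  have key : ∀ᶠ v in 𝓝 (0 : EG), (expLie (v - p v) : G) ∈ L → v - p v = 0 := by
    by_contra hcon
    have hfreq : ∃ᶠ v in 𝓝 (0 : EG), (expLie (v - p v) : G) ∈ L ∧ v - p v ≠ 0 := by
      intro h
      exact hcon (h.mono fun v hv hvL => by_contra fun hne => hv ⟨hvL, hne⟩)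
    obtain ⟨x, hx, hxL⟩ := Filter.exists_seq_forall_of_frequently hfreq
    have hb : Filter.Tendsto (fun n => x n - p (x n)) Filter.atTop (𝓝 0) := by
      have h1 := hx.sub ((p.continuous.tendsto 0).comp hx)
      simpa using h1
    obtain ⟨u, hu, ψ, hψ, hlim⟩ := (isCompact_sphere (0 : EG) 1).tendsto_subseq
      (x := fun n => ‖x n - p (x n)‖⁻¹ • (x n - p (x n))) (fun n => by
        rw [mem_sphere_zero_iff_norm, norm_smul, norm_inv, norm_norm,
          inv_mul_cancel₀ (norm_ne_zero_iff.2 (hxL n).2)])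
    have huL : u ∈ lieAlgOf EG L :=
      mem_lieAlgOf_of_tendsto_direction hL (b := fun n => x (ψ n) - p (x (ψ n)))
        (hb.comp hψ.tendsto_atTop) (fun n => (hxL (ψ n)).1) hlim
    have hpu : p u = 0 := by
      refine tendsto_nhds_unique ((p.continuous.tendsto u).comp hlim) ?_
      refine (tendsto_const_nhds (x := (0 : EG))).congr fun n => ?_
      simp only [Function.comp_apply, map_smul, map_sub]
      rw [hp2 _ (hp1 _), sub_self, smul_zero]
    rw [hp2 u huL] at hpu
    rw [hpu] at hu
    simp at hu
  have hlogc : ContinuousAt log 1 := hlog.continuousAt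
  have key' : ∀ᶠ v in 𝓝 (log 1), (expLie (v - p v) : G) ∈ L → v - p v = 0 := by rwa [hlog1]
  filter_upwards [hexplog, hlogc.eventually key'] with g hg1 hg2 hgL
  have hg3 : expLie (p (log g)) * expLie (log g - p (log g)) = g := hg1
  have hmem : (expLie (p (log g)) : G) ∈ L := by
    simpa using mem_lieAlgOf_iff.1 (hp1 (log g)) 1
  have h4 : (expLie (log g - p (log g)) : G) ∈ L := by
    rw [← L.mul_mem_cancel_left hmem, hg3]
    exact hgL
  refine ⟨p (log g), hp1 _, ?_⟩
  rw [hg2 h4, expLie_zero, mul_one] at hg3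
  exact hg3.symm

end ClosedSubgroups
end HiggsBundle

namespace HiggsBundle

/-! ### Bounded one-parameter groups of matrices -/

section BoundedGroups

variable {V : Type*} [NormedAddCommGroup V] [NormedSpace ℂ V]

theorem exp_smul_apply_of_eigenvector [CompleteSpace V] {A : V →L[ℂ] V} {μ : ℂ} {w : V}
    (h : A w = μ • w) (t : ℝ) :
    NormedSpace.exp (t • A) w = Complex.exp (t * μ) • w := by
  have h1 : ∀ t : ℝ, HasDerivAt
      (fun t : ℝ => Complex.exp (-(t * μ)) • NormedSpace.exp (t • A) w) 0 t := by
    intro t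
    have h2 := hasDerivAt_exp_smul_const (𝕂 := ℝ) A t
    have h3 := (ContinuousLinearMap.apply ℂ V w).restrictScalars ℝ |>.hasFDerivAt.comp_hasDerivAt t h2
    have h4 : HasDerivAt (fun t : ℝ => -((t : ℂ) * μ)) (-(1 * μ)) t :=
      ((Complex.ofRealCLM.hasDerivAt (x := t)).mul_const μ).neg
    refine (h4.cexp.smul h3).congr_deriv ?_
    change Complex.exp (-(t * μ)) • NormedSpace.exp (t • A) (A w) +
      (Complex.exp (-(t * μ)) * -(1 * μ)) • NormedSpace.exp (t • A) w = 0
    rw [h, map_smul, smul_smul, ← add_smul]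
    simp
  have h2 := is_const_of_deriv_eq_zero (fun t => (h1 t).differentiableAt)
    (fun t => (h1 t).deriv) t 0
  simp only [Complex.ofReal_zero, zero_mul, neg_zero, Complex.exp_zero, zero_smul,
    NormedSpace.exp_zero, one_smul, one_apply_eq_self] at h2
  conv_rhs => rw [← h2]
  rw [smul_smul, ← Complex.exp_add]
  simp

/-- The eigenvalues of the generator of a bounded one-parameter group are imaginary. -/
theorem re_eigenvalue_eq_zero_of_bounded [CompleteSpace V] {A : V →L[ℂ] V} {C : ℝ}
    (hC : ∀ t : ℝ, ‖NormedSpace.exp (t • A)‖ ≤ C) {μ : ℂ} {w : V} (hw : w ≠ 0)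
    (h : A w = μ • w) : μ.re = 0 := by
  have hw0 : 0 < ‖w‖ := norm_pos_iff.2 hw
  have h1 : ∀ t : ℝ, Real.exp (t * μ.re) ≤ C := by
    intro t
    have h2 := (NormedSpace.exp (t • A)).le_of_opNorm_le (hC t) w
    rw [exp_smul_apply_of_eigenvector h, norm_smul, Complex.norm_exp] at h2
    simpa using le_of_mul_le_mul_right h2 hw0
  by_contra hμ
  have h2 := h1 ((C + 1) / μ.re)
  rw [div_mul_cancel₀ _ hμ] at h2
  linarith [Real.add_one_le_exp (C + 1)]

/-- The generator of a bounded one-parameter group is not nilpotent unless it vanishes, because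
`exp (t A) w = w + t A w` if `A² w = 0`. -/
theorem eq_zero_of_bounded_of_isNilpotent [CompleteSpace V] {A : V →L[ℂ] V} {C : ℝ}
    (hC : ∀ t : ℝ, ‖NormedSpace.exp (t • A)‖ ≤ C) (hA : IsNilpotent A) : A = 0 := by
  have h1 : ∀ w, A (A w) = 0 → A w = 0 := by
    intro w hw
    have h2 : ∀ t : ℝ, NormedSpace.exp (t • A) w = w + t • A w := by
      intro t
      have h1 : ∀ t : ℝ, HasDerivAt
          (fun t : ℝ => NormedSpace.exp (t • A) w - t • A w) 0 t := by
        intro t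
        have h2 := hasDerivAt_exp_smul_const (𝕂 := ℝ) A t
        have h3 := (ContinuousLinearMap.apply ℂ V w).restrictScalars ℝ
          |>.hasFDerivAt.comp_hasDerivAt t h2
        refine (h3.sub ((hasDerivAt_id t).smul_const (A w))).congr_deriv ?_
        change NormedSpace.exp (t • A) (A w) - (1 : ℝ) • A w = 0
        have h5 := exp_smul_apply_of_eigenvector (A := A) (μ := 0) (w := A w) (by simpa) t
        rw [h5]
        simp
      have h2 := is_const_of_deriv_eq_zero (fun t => (h1 t).differentiableAt)
        (fun t => (h1 t).deriv) t 0
      simp only [zero_smul, NormedSpace.exp_zero, one_apply_eq_self, sub_zero] at h2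
      exact sub_eq_iff_eq_add.1 h2
    by_contra hne
    have hpos : 0 < ‖A w‖ := norm_pos_iff.2 hne
    have h3 : ∀ t : ℝ, |t| * ‖A w‖ ≤ C * ‖w‖ + ‖w‖ := by
      intro t
      have h4 := (NormedSpace.exp (t • A)).le_of_opNorm_le (hC t) w
      rw [h2 t] at h4
      calc |t| * ‖A w‖ = ‖(w + t • A w) - w‖ := by
            rw [add_sub_cancel_left, norm_smul, Real.norm_eq_abs]
        _ ≤ _ := (norm_sub_le _ _).trans (by gcongr)
    have h4 := (le_abs_self _).trans' (le_of_eq rfl) |>.trans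
      ((le_div_iff₀ hpos).2 (h3 ((C * ‖w‖ + ‖w‖) / ‖A w‖ + 1)))
    linarith
  obtain ⟨n, hn⟩ := hA
  have h2 : ∀ n : ℕ, ∀ w, (A ^ (n + 1)) w = 0 → A w = 0 := by
    intro n
    induction n with
    | zero => intro w hw; simpa using hw
    | succ n ih =>
      intro w hw
      rw [pow_succ] at hw
      exact h1 w (ih (A w) hw)
  refine ContinuousLinearMap.ext fun w => h2 n w ?_
  rw [pow_succ', hn, mul_zero]
  rfl

/-- If `A` generates a bounded one-parameter group, the eigenvalues of `A²` are real and at most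
`0`. If their sum vanishes, `A` is nilpotent, hence zero. -/
theorem trace_sq_of_bounded [FiniteDimensional ℂ V] {A : V →L[ℂ] V} {C : ℝ}
    (hC : ∀ t : ℝ, ‖NormedSpace.exp (t • A)‖ ≤ C) :
    ∃ r : ℝ, r ≤ 0 ∧ LinearMap.trace ℂ V ((A : V →ₗ[ℂ] V) ∘ₗ (A : V →ₗ[ℂ] V)) = r ∧
      (r = 0 → A = 0) := by
  have hcs : CompleteSpace V := FiniteDimensional.complete ℂ V
  set f : Module.End ℂ V := (A : V →ₗ[ℂ] V) ∘ₗ (A : V →ₗ[ℂ] V) with hf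
  -- if `A² w = μ² w`, one of the vectors `w` and `A w + μ w` is an eigenvector of `A`, with
  -- eigenvalue `- μ` or `μ`
  have hroot : ∀ z ∈ f.charpoly.roots, ∃ r : ℝ, r ≤ 0 ∧ z = r := by
    intro z hz
    have h1 := (Module.End.hasEigenvalue_iff_isRoot_charpoly f z).2 (Polynomial.isRoot_of_mem_roots hz)
    obtain ⟨w, hw⟩ := h1.exists_hasEigenvector
    have hw1 : A (A w) = z • w := hw.apply_eq_smul
    obtain ⟨μ, hμ⟩ : ∃ μ : ℂ, μ * μ = z := by
      obtain ⟨μ, hμ⟩ := IsAlgClosed.exists_pow_nat_eq z (n := 2) (by norm_num)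
      exact ⟨μ, by rw [← hμ, sq]⟩
    have hre : μ.re = 0 := by
      by_cases h2 : A w + μ • w = 0
      · have h3 := re_eigenvalue_eq_zero_of_bounded hC (μ := -μ) hw.2
          (by rw [neg_smul]; exact eq_neg_of_add_eq_zero_left h2)
        simpa using h3
      · refine re_eigenvalue_eq_zero_of_bounded hC h2 ?_
        rw [map_add, map_smul, hw1, smul_add, smul_smul, hμ, add_comm]
    refine ⟨-(μ.im * μ.im), by nlinarith [mul_self_nonneg μ.im], ?_⟩
    rw [← hμ]
    apply Complex.ext <;> simp [hre]
  have hs := IsAlgClosed.splits f.charpoly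
  have htr := Module.End.trace_eq_sum_roots_charpoly_of_splits hs
  have key : ∀ s : Multiset ℂ, (∀ z ∈ s, ∃ r : ℝ, r ≤ 0 ∧ z = r) →
      ∃ r : ℝ, r ≤ 0 ∧ s.sum = r ∧ (r = 0 → ∀ z ∈ s, z = 0) := by
    intro s
    induction s using Multiset.induction with
    | empty => exact fun _ => ⟨0, le_rfl, by simp, by simp⟩
    | cons a s ih =>
      intro h
      obtain ⟨r, hr, hr2, hr3⟩ := ih fun z hz => h z (Multiset.mem_cons_of_mem hz)
      obtain ⟨r', hr', rfl⟩ := h a (Multiset.mem_cons_self _ _)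
      refine ⟨r' + r, by linarith, by simp [hr2], fun h0 z hz => ?_⟩
      rcases Multiset.mem_cons.1 hz with rfl | hz
      · exact_mod_cast (by linarith : r' = 0)
      · exact hr3 (by linarith) z hz
  obtain ⟨r, hr, hr2, hr3⟩ := key _ hroot
  refine ⟨r, hr, htr.trans hr2, fun h0 => ?_⟩
  have h1 := hs.eq_prod_roots_of_monic f.charpoly_monic
  rw [Multiset.eq_replicate_of_mem (hr3 h0), Multiset.map_replicate, Multiset.prod_replicate] at h1
  have h2 := LinearMap.aeval_self_charpoly f
  rw [h1] at h2
  simp only [map_zero, sub_zero, map_pow, Polynomial.aeval_X] at h2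
  refine eq_zero_of_bounded_of_isNilpotent hC ⟨2 * Multiset.card f.charpoly.roots, ?_⟩
  refine ContinuousLinearMap.ext fun w => ?_
  have h3 : ∀ n w, (A ^ (2 * n)) w = (f ^ n) w := by
    intro n
    induction n with
    | zero => intro w; rfl
    | succ n ih =>
      intro w
      rw [mul_add, pow_add, pow_succ f]
      exact ih (A (A w))
  rw [h3, h2]
  rfl

end BoundedGroups

end HiggsBundle

namespace HiggsBundle

/-! ### The Killing form and the compact real form -/

/-- The orthogonal projection onto the orthogonal complement of `W`, for a positive definite
symmetric bilinear form. -/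
theorem exists_orthogonal_projection {V : Type*} [AddCommGroup V] [Module ℝ V]
    [FiniteDimensional ℝ V] (b : LinearMap.BilinForm ℝ V) (hs : ∀ u v, b u v = b v u)
    (hp : ∀ u, u ≠ 0 → 0 < b u u) (W : Submodule ℝ V) :
    ∃ P : V →ₗ[ℝ] V, (∀ w ∈ W, P w = 0) ∧ (∀ v, v - P v ∈ W) ∧ ∀ v, ∀ w ∈ W, b (P v) w = 0 := by
  have hr : b.IsRefl := fun u v h => by rw [hs, h]
  have hn : (b.restrict W).Nondegenerate := by
    refine ⟨fun w hw => ?_, fun w hw => ?_⟩ <;>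
    · by_contra hne
      exact (hp w.1 (by simpa using hne)).ne' (hw w)
  have hc := LinearMap.BilinForm.isCompl_orthogonal_of_restrict_nondegenerate hr hn
  refine ⟨Submodule.projection _ _ hc.symm, fun w hw => ?_, fun v => ?_, fun v w hw => ?_⟩
  · exact Submodule.projection_apply_of_mem_right hc.symm hw
  · have h := Submodule.projection_add_projection_eq_self hc.symm v
    rw [sub_eq_iff_eq_add'.2 h.symm]
    exact Submodule.projection_apply_mem hc v
  · rw [hs]
    exact Submodule.projection_apply_mem hc.symm v w hw

section Killing

variable {EG : Type*} [NormedAddCommGroup EG] [NormedSpace ℂ EG]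
  {G : Type*} [TopologicalSpace G] [ChartedSpace EG G] [Group G] [LieGroup 𝓘(ℂ, EG) ω G]
  [CompleteSpace EG]

variable (EG G) in
/-- The Killing form of `𝔤`, as a bilinear form on the model space `EG`. -/
noncomputable def killing : EG →ₗ[ℂ] EG →ₗ[ℂ] ℂ := killingForm ℂ (LieAlg EG G)

variable (G) in
theorem adEnd_skew (v w : EG) : adEnd EG G v w = -adEnd EG G w v := by
  rw [adEnd_apply, adEnd_apply]
  exact (lie_skew (L := LieAlg EG G) v w).symm

theorem killing_apply (v w : EG) : killing EG G v w =
    LinearMap.trace ℂ EG ((adEnd EG G v : EG →ₗ[ℂ] EG) ∘ₗ (adEnd EG G w : EG →ₗ[ℂ] EG)) := by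
  refine (killingForm_apply_apply ℂ (LieAlg EG G) v w).trans ?_
  have h : ∀ u : EG, (LieAlgebra.ad ℂ (LieAlg EG G) u : EG →ₗ[ℂ] EG) = (adEnd EG G u : EG →ₗ[ℂ] EG) :=
    fun u => LinearMap.ext fun x => (adEnd_apply u x).symm
  rw [← h, ← h]
  rfl

theorem killing_comm (v w : EG) : killing EG G v w = killing EG G w v :=
  LieModule.traceForm_comm ℂ (LieAlg EG G) (LieAlg EG G) v w

theorem killing_adEnd (x y z : EG) :
    killing EG G (adEnd EG G x y) z = killing EG G x (adEnd EG G y z) := by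
  rw [adEnd_apply, adEnd_apply]
  exact LieModule.traceForm_apply_lie_apply ℂ (LieAlg EG G) (LieAlg EG G) x y z

/-- `Ad g` as a linear automorphism. -/
noncomputable def AdEquiv (g : G) : EG ≃ₗ[ℂ] EG :=
  LinearEquiv.ofLinearMap (AdEnd EG g : EG →ₗ[ℂ] EG) (AdEnd EG g⁻¹ : EG →ₗ[ℂ] EG)
    (LinearMap.ext fun v => AdEnd_apply_inv g v) (LinearMap.ext fun v => AdEnd_inv_apply g v)

/-- The Killing form is invariant under `Ad`. -/
theorem killing_AdEnd (g : G) (v w : EG) :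
    killing EG G (AdEnd EG g v) (AdEnd EG g w) = killing EG G v w := by
  rw [killing_apply, killing_apply, ← LinearMap.trace_conj' (_ ∘ₗ (adEnd EG G w : EG →ₗ[ℂ] EG)) (AdEquiv (EG := EG) g)]
  congr 1
  refine LinearMap.ext fun x => ?_
  change adEnd EG G (AdEnd EG g v) (adEnd EG G (AdEnd EG g w) x) =
    AdEnd EG g (adEnd EG G v (adEnd EG G w (AdEnd EG g⁻¹ x)))
  rw [AdEnd_adEnd, AdEnd_adEnd, AdEnd_apply_inv]

variable [T2Space G] [FiniteDimensional ℂ EG] [LieAlgebra.IsSemisimple ℂ (LieAlg EG G)]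

theorem exists_norm_AdEnd_le {K : Subgroup G} (hK : IsCompact (K : Set G)) :
    ∃ C : ℝ, ∀ k ∈ K, ‖AdEnd EG k‖ ≤ C :=
  hK.exists_bound_of_continuousOn (contMDiff_AdEnd (EG := EG) (G := G)).continuous.continuousOn

/-- The Killing form is real and negative definite on the Lie algebra of a compact subgroup. -/
theorem killing_self {K : Subgroup G} (hK : IsCompact (K : Set G)) {v : EG}
    (hv : v ∈ lieAlgOf EG K) :
    ∃ r : ℝ, r ≤ 0 ∧ killing EG G v v = r ∧ (r = 0 → v = 0) := by
  obtain ⟨C, hC⟩ := exists_norm_AdEnd_le (EG := EG) hK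
  obtain ⟨r, h1, h2, h3⟩ := trace_sq_of_bounded (A := adEnd EG G v) (C := C) fun t => by
    have h4 : t • adEnd EG G v = adEnd EG G (t • v) := (LinearMap.map_smul_of_tower _ t v).symm
    rw [h4, ← AdEnd_expLie]
    exact hC _ (mem_lieAlgOf_iff.1 hv t)
  refine ⟨r, h1, (killing_apply v v).trans h2, fun h => ?_⟩
  exact adEnd_injective EG G ((h3 h).trans (map_zero _).symm)

end Killing

section Conjugation

variable {EG : Type*} [NormedAddCommGroup EG] [NormedSpace ℂ EG]
  {G : Type*} [TopologicalSpace G] [ChartedSpace EG G] [Group G] [LieGroup 𝓘(ℂ, EG) ω G]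
  [CompleteSpace EG] [T2Space G] [FiniteDimensional ℂ EG]
  [LieAlgebra.IsSemisimple ℂ (LieAlg EG G)]
  {K : Subgroup G} {τ : EG →ₛₗ[starRingEnd ℂ] EG}

theorem conj_smul_real (τ : EG →ₛₗ[starRingEnd ℂ] EG) (r : ℝ) (v : EG) : τ (r • v) = r • τ v := by
  rw [← Complex.coe_smul r v, ← Complex.coe_smul r (τ v), map_smulₛₗ, Complex.conj_ofReal]

theorem conj_I_smul (τ : EG →ₛₗ[starRingEnd ℂ] EG) (v : EG) :
    τ (Complex.I • v) = -(Complex.I • τ v) := by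
  rw [map_smulₛₗ, Complex.conj_I, neg_smul]

/-- An antilinear map as a continuous real linear map. -/
noncomputable def conjCLM (τ : EG →ₛₗ[starRingEnd ℂ] EG) : EG →L[ℝ] EG :=
  have : FiniteDimensional ℝ EG := FiniteDimensional.complexToReal EG
  LinearMap.toContinuousLinearMap
    { toFun := τ, map_add' := map_add τ, map_smul' := conj_smul_real τ }

theorem IsCompactConjugation.invol (hτ : IsCompactConjugation (EG := EG) K τ) (v : EG) :
    τ (τ v) = v := hτ.involutive v

theorem IsCompactConjugation.eq_iff (hτ : IsCompactConjugation (EG := EG) K τ) {v : EG} :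
    τ v = v ↔ v ∈ lieAlgOf EG K := hτ.fixed_iff v

/-- To prove a complex linear or antilinear identity on `𝔤 = 𝔨 + i 𝔨`, decompose. -/
theorem IsCompactConjugation.exists_decomp (hτ : IsCompactConjugation (EG := EG) K τ) (v : EG) :
    ∃ a b : EG, τ a = a ∧ τ b = b ∧ v = a + Complex.I • b := by
  refine ⟨(1 / 2 : ℝ) • (v + τ v), (1 / 2 : ℝ) • (-(Complex.I • (v - τ v))), ?_, ?_, ?_⟩
  · rw [conj_smul_real, map_add, hτ.invol, add_comm]
  · rw [conj_smul_real, map_neg, conj_I_smul, map_sub, hτ.invol, neg_neg, ← smul_neg, neg_sub]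
  · rw [smul_comm Complex.I, smul_neg, smul_smul, Complex.I_mul_I, neg_one_smul, neg_neg,
      ← smul_add, add_add_sub_cancel, ← two_smul ℝ v, smul_smul]
    norm_num

/-- `σ_K` commutes with `Ad k` for `k ∈ K`, because `Ad k` preserves `𝔨`. -/
theorem IsCompactConjugation.AdEnd_comm (hτ : IsCompactConjugation (EG := EG) K τ) {k : G}
    (hk : k ∈ K) (v : EG) : τ (AdEnd EG k v) = AdEnd EG k (τ v) := by
  have h : ∀ a : EG, τ a = a → τ (AdEnd EG k a) = AdEnd EG k a := by
    intro a ha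
    rw [hτ.eq_iff, mem_lieAlgOf_iff] at ha ⊢
    intro t
    have h1 := conj_expLie k (t • a)
    rw [(AdEnd EG k).map_smul_of_tower] at h1
    rw [← h1]
    exact K.mul_mem (K.mul_mem hk (ha t)) (K.inv_mem hk)
  obtain ⟨a, b, ha, hb, rfl⟩ := hτ.exists_decomp v
  simp only [map_add, map_smul, conj_I_smul, h a ha, h b hb, ha, hb, map_neg]

/-- `σ_K` is an automorphism of the real Lie algebra `𝔤`, because `𝔨` is a subalgebra, which
is the infinitesimal form of the invariance of `𝔨` under `Ad K`. -/
theorem IsCompactConjugation.adEnd_map (hτ : IsCompactConjugation (EG := EG) K τ) (u v : EG) :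
    τ (adEnd EG G u v) = adEnd EG G (τ u) (τ v) := by
  have h : ∀ a b : EG, τ a = a → τ b = b → τ (adEnd EG G a b) = adEnd EG G a b := by
    intro a b ha hb
    have h1 : HasDerivAt (fun t : ℝ => NormedSpace.exp (t • adEnd EG G a) b) (adEnd EG G a b) 0 := by
      have h2 := hasDerivAt_exp_smul_const (𝕂 := ℝ) (adEnd EG G a) 0
      have h3 := (ContinuousLinearMap.apply ℂ EG b).restrictScalars ℝ
        |>.hasFDerivAt.comp_hasDerivAt (0 : ℝ) h2
      refine h3.congr_deriv ?_
      change NormedSpace.exp ((0 : ℝ) • adEnd EG G a) (adEnd EG G a b) = _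
      rw [zero_smul, NormedSpace.exp_zero]
      rfl
    have h2 := (conjCLM τ).hasFDerivAt.comp_hasDerivAt (0 : ℝ) h1
    refine h2.unique (h1.congr_of_eventuallyEq (Filter.Eventually.of_forall fun t => ?_))
    change τ (NormedSpace.exp (t • adEnd EG G a) b) = NormedSpace.exp (t • adEnd EG G a) b
    have h4 : t • adEnd EG G a = adEnd EG G (t • a) := (LinearMap.map_smul_of_tower _ t a).symm
    rw [h4, ← AdEnd_expLie, hτ.AdEnd_comm, hb]
    exact mem_lieAlgOf_iff.1 (hτ.eq_iff.1 ha) t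
  obtain ⟨a, b, ha, hb, rfl⟩ := hτ.exists_decomp u
  obtain ⟨c, d, hc, hd, rfl⟩ := hτ.exists_decomp v
  simp only [map_add, map_smul, conj_I_smul, add_apply, smul_apply, h a c ha hc, h a d ha hd,
    h b c hb hc, h b d hb hd, ha, hb, hc, hd, map_neg, neg_apply]

theorem IsCompactConjugation.killing_map (hτ : IsCompactConjugation (EG := EG) K τ)
    (hK : IsCompact (K : Set G)) (u v : EG) :
    killing EG G (τ u) (τ v) = starRingEnd ℂ (killing EG G u v) := by
  have h0 : ∀ a : EG, τ a = a → (killing EG G a a).im = 0 := by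
    intro a ha
    obtain ⟨r, -, h, -⟩ := killing_self hK (hτ.eq_iff.1 ha)
    rw [h, Complex.ofReal_im]
  have h : ∀ a b : EG, τ a = a → τ b = b →
      starRingEnd ℂ (killing EG G a b) = killing EG G a b := by
    intro a b ha hb
    rw [Complex.conj_eq_iff_im]
    have h1 := h0 (a + b) (by rw [map_add, ha, hb])
    simp only [map_add, LinearMap.add_apply, Complex.add_im, h0 a ha, h0 b hb, killing_comm b a] at h1
    linarith
  obtain ⟨a, b, ha, hb, rfl⟩ := hτ.exists_decomp u
  obtain ⟨c, d, hc, hd, rfl⟩ := hτ.exists_decomp v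
  simp only [map_add, map_smul, conj_I_smul, LinearMap.add_apply, LinearMap.smul_apply, h a c ha hc, h a d ha hd,
    h b c hb hc, h b d hb hd, ha, hb, hc, hd, map_neg, LinearMap.neg_apply, smul_eq_mul, map_mul, Complex.conj_I]
  ring

variable (G) in
/-- The inner product `⟪u, v⟫ = - Re B(u, σ_K v)` on `𝔤`. -/
noncomputable def metric (τ : EG →ₛₗ[starRingEnd ℂ] EG) : EG →L[ℝ] EG →L[ℝ] ℝ :=
  have : FiniteDimensional ℝ EG := FiniteDimensional.complexToReal EG
  (LinearMap.mk₂ ℝ (fun u v : EG => -(killing EG G u (τ v)).re)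
    (fun u u' v => by simp only [map_add, LinearMap.add_apply, Complex.add_re]; ring)
    (fun r u v => by
      rw [← Complex.coe_smul r u, map_smul, LinearMap.smul_apply]
      simp)
    (fun u v v' => by simp only [map_add, Complex.add_re]; ring)
    (fun r u v => by
      rw [conj_smul_real, ← Complex.coe_smul r (τ v), map_smul]
      simp)).toContinuousBilinearMap

theorem metric_apply (u v : EG) : metric G τ u v = -(killing EG G u (τ v)).re := rfl

theorem IsCompactConjugation.metric_comm (hτ : IsCompactConjugation (EG := EG) K τ)
    (hK : IsCompact (K : Set G)) (u v : EG) : metric G τ u v = metric G τ v u := by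
  have h := hτ.killing_map hK u (τ v)
  rw [hτ.invol, killing_comm] at h
  rw [metric_apply, metric_apply, h, Complex.conj_re]

theorem IsCompactConjugation.metric_map (hτ : IsCompactConjugation (EG := EG) K τ)
    (hK : IsCompact (K : Set G)) (u v : EG) : metric G τ (τ u) (τ v) = metric G τ u v := by
  rw [metric_apply, metric_apply, hτ.killing_map hK, Complex.conj_re]

theorem IsCompactConjugation.killing_conj_self (hτ : IsCompactConjugation (EG := EG) K τ)
    (hK : IsCompact (K : Set G)) {u : EG} (hu : u ≠ 0) :
    (killing EG G u (τ u)).im = 0 ∧ (killing EG G u (τ u)).re < 0 := by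
  obtain ⟨a, b, ha, hb, rfl⟩ := hτ.exists_decomp u
  obtain ⟨r, h1, h2, h3⟩ := killing_self hK (hτ.eq_iff.1 ha)
  obtain ⟨s, h4, h5, h6⟩ := killing_self hK (hτ.eq_iff.1 hb)
  have h : killing EG G (a + Complex.I • b) (τ (a + Complex.I • b)) = ((r + s : ℝ) : ℂ) := by
    simp only [map_add, map_smul, conj_I_smul, LinearMap.add_apply, LinearMap.smul_apply, ha, hb, map_neg,
      smul_eq_mul, killing_comm b a, h2, h5]
    push_cast
    linear_combination (-(s : ℂ)) * Complex.I_mul_I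
  rw [h]
  refine ⟨Complex.ofReal_im _, ?_⟩
  rw [Complex.ofReal_re]
  by_contra hlt
  exact hu (by rw [h3 (by linarith), h6 (by linarith)]; simp)

theorem IsCompactConjugation.metric_self_pos (hτ : IsCompactConjugation (EG := EG) K τ)
    (hK : IsCompact (K : Set G)) {u : EG} (hu : u ≠ 0) : 0 < metric G τ u u := by
  rw [metric_apply]
  linarith [(hτ.killing_conj_self hK hu).2]

theorem IsCompactConjugation.metric_AdEnd (hτ : IsCompactConjugation (EG := EG) K τ) {k : G}
    (hk : k ∈ K) (u v : EG) : metric G τ (AdEnd EG k u) (AdEnd EG k v) = metric G τ u v := by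
  rw [metric_apply, metric_apply, hτ.AdEnd_comm hk, killing_AdEnd]

/-- The adjoint of `ad x` is `- ad (σ_K x)`. -/
theorem IsCompactConjugation.metric_adEnd (hτ : IsCompactConjugation (EG := EG) K τ)
    (x u v : EG) : metric G τ (adEnd EG G x u) v = -metric G τ u (adEnd EG G (τ x) v) := by
  rw [metric_apply, metric_apply, hτ.adEnd_map, hτ.invol, ← killing_adEnd, adEnd_skew G u x, map_neg,
    LinearMap.neg_apply, Complex.neg_re]
  ring

/-- `P` is the orthogonal projection of `𝔤` onto the orthogonal complement of the Lie algebra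
of `L`. -/
structure IsQuotProj (τ : EG →ₛₗ[starRingEnd ℂ] EG) (L : Subgroup G) (P : EG →L[ℝ] EG) :
    Prop where
  apply_eq_zero : ∀ w : EG, w ∈ lieAlgOf EG L → P w = 0
  sub_mem : ∀ v : EG, v - P v ∈ lieAlgOf EG L
  orthogonal : ∀ v w : EG, w ∈ lieAlgOf EG L → metric G τ (P v) w = 0

theorem IsCompactConjugation.exists_isQuotProj (hτ : IsCompactConjugation (EG := EG) K τ)
    (hK : IsCompact (K : Set G)) {L : Subgroup G} (hL : IsClosed (L : Set G)) :
    ∃ P : EG →L[ℝ] EG, IsQuotProj τ L P := by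
  have : FiniteDimensional ℝ EG := FiniteDimensional.complexToReal EG
  obtain ⟨P, h1, h2, h3⟩ := exists_orthogonal_projection
    ((ContinuousLinearMap.coeLM ℝ).comp (metric G τ).toLinearMap)
    (hτ.metric_comm hK) (fun u hu => hτ.metric_self_pos hK hu) (lieSubspace L hL)
  exact ⟨LinearMap.toContinuousLinearMap P, fun w hw => h1 w hw, fun v => h2 v,
    fun v w hw => h3 v w hw⟩

theorem IsQuotProj.eq_self {L : Subgroup G} {P : EG →L[ℝ] EG} (hP : IsQuotProj τ L P)
    (hτ : IsCompactConjugation (EG := EG) K τ) (hK : IsCompact (K : Set G))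
    {v : EG} (hv : ∀ w : EG, w ∈ lieAlgOf EG L → metric G τ v w = 0) : P v = v := by
  have h1 := hP.sub_mem v
  by_contra hne
  have h2 := hτ.metric_self_pos hK (sub_ne_zero.2 (Ne.symm hne))
  have h3 : metric G τ (v - P v) (v - P v) = metric G τ v (v - P v) - metric G τ (P v) (v - P v) := by
    rw [map_sub (metric G τ) v (P v)]
    rfl
  rw [h3, hv _ h1, hP.orthogonal v _ h1, sub_zero] at h2
  exact h2.false

/-- The infimum that defines the metric of `G / L` is attained at the normal part `P v`. -/
theorem IsQuotProj.normSqQuot_eq {L : Subgroup G} {P : EG →L[ℝ] EG} (hP : IsQuotProj τ L P)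
    (hτ : IsCompactConjugation (EG := EG) K τ) (hK : IsCompact (K : Set G))
    (hL : IsClosed (L : Set G)) (v : EG) :
    normSqQuot EG τ L v = metric G τ (P v) (P v) := by
  have hnn : ∀ u : EG, 0 ≤ metric G τ u u := by
    intro u
    by_cases hu : u = 0
    · simp [hu]
    · exact (hτ.metric_self_pos hK hu).le
  have key : ∀ w : EG, w ∈ lieAlgOf EG L →
      metric G τ (P v) (P v) ≤ metric G τ (v - w) (v - w) := by
    intro w hw
    have h1 : v - w = P v + ((v - P v) - w) := by abel
    have h2 : (v - P v) - w ∈ lieAlgOf EG L :=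
      mem_lieSubspace (hL := hL) |>.1 ((lieSubspace L hL).sub_mem
        (mem_lieSubspace.2 (hP.sub_mem v)) (mem_lieSubspace.2 hw))
    rw [h1]
    simp only [map_add, add_apply, hP.orthogonal v _ h2, hτ.metric_comm hK _ (P v)]
    linarith [hnn (v - P v - w)]
  refine le_antisymm ?_ ?_
  · refine (ciInf_le ⟨metric G τ (P v) (P v), ?_⟩ ⟨v - P v, hP.sub_mem v⟩).trans (le_of_eq ?_)
    · rintro _ ⟨w, rfl⟩
      exact key w.1 w.2
    · change metric G τ (v - (v - P v)) (v - (v - P v)) = _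
      rw [sub_sub_cancel]
  · have : Nonempty {w : LieAlg EG G // w ∈ lieAlgOf EG L} := ⟨⟨v - P v, hP.sub_mem v⟩⟩
    exact le_ciInf fun w => key w.1 w.2

theorem AdEnd_mem_lieAlgOf {L : Subgroup G} {l : G} (hl : l ∈ L) {w : EG}
    (hw : w ∈ lieAlgOf EG L) : AdEnd EG l w ∈ lieAlgOf EG L := by
  rw [mem_lieAlgOf_iff] at hw ⊢
  intro t
  have h1 := conj_expLie l (t • w)
  rw [(AdEnd EG l).map_smul_of_tower] at h1
  rw [← h1]
  exact L.mul_mem (L.mul_mem hl (hw t)) (L.inv_mem hl)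

theorem IsQuotProj.AdEnd_comm {L : Subgroup G} {P : EG →L[ℝ] EG} (hP : IsQuotProj τ L P)
    (hτ : IsCompactConjugation (EG := EG) K τ) (hK : IsCompact (K : Set G)) (hLK : L ≤ K)
    {l : G} (hl : l ∈ L) (v : EG) : P (AdEnd EG l v) = AdEnd EG l (P v) := by
  have h1 : AdEnd EG l v = AdEnd EG l (P v) + AdEnd EG l (v - P v) := by
    rw [← map_add, add_sub_cancel]
  rw [h1, map_add, hP.apply_eq_zero _ (AdEnd_mem_lieAlgOf hl (hP.sub_mem v)), add_zero]
  refine hP.eq_self hτ hK fun w hw => ?_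
  rw [← AdEnd_apply_inv l w, hτ.metric_AdEnd (hLK hl)]
  exact hP.orthogonal v _ (AdEnd_mem_lieAlgOf (L.inv_mem hl) hw)

end Conjugation

end HiggsBundle

namespace HiggsBundle

/-! ### Calculus of the Maurer-Cartan form -/

section MaurerCartan

variable {EG : Type*} [NormedAddCommGroup EG] [NormedSpace ℂ EG]
  {G : Type*} [TopologicalSpace G] [ChartedSpace EG G] [Group G] [LieGroup 𝓘(ℂ, EG) ω G]
  [CompleteSpace EG] [T2Space G] [FiniteDimensional ℂ EG]
  [LieAlgebra.IsSemisimple ℂ (LieAlg EG G)]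
  {F : Type*} [NormedAddCommGroup F] [NormedSpace ℝ F]
  {F' : Type*} [NormedAddCommGroup F'] [NormedSpace ℝ F']

variable (G) in
theorem adEnd_bracket (u v : EG) : adEnd EG G (adEnd EG G u v) =
    adEnd EG G u * adEnd EG G v - adEnd EG G v * adEnd EG G u := by
  refine ContinuousLinearMap.ext fun w => ?_
  change adEnd EG G (adEnd EG G u v) w =
    adEnd EG G u (adEnd EG G v w) - adEnd EG G v (adEnd EG G u w)
  simp only [adEnd_apply]
  exact lie_lie (L := LieAlg EG G) (M := LieAlg EG G) u v w

theorem adEnd_AdEnd_mul (g : G) (v : EG) :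
    adEnd EG G (AdEnd EG g v) = AdEnd EG g * adEnd EG G v * AdEnd EG g⁻¹ := by
  refine ContinuousLinearMap.ext fun w => ?_
  change _ = AdEnd EG g (adEnd EG G v (AdEnd EG g⁻¹ w))
  rw [AdEnd_adEnd, AdEnd_apply_inv]

variable (EG) in
/-- The pullback `s⁻¹ ds` of the Maurer-Cartan form by a map `s` on a vector space, as a linear map
into the model space. -/
noncomputable def mcForm (s : F → G) (z : F) : F →L[ℝ] EG :=
  mfderiv 𝓘(ℝ, F) 𝓘(ℝ, EG) (fun w => (s z)⁻¹ * s w) z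

theorem hasFDerivAt_AdEnd_mcForm {s : F → G} {z : F}
    (hs : MDifferentiableAt 𝓘(ℝ, F) 𝓘(ℝ, EG) s z) :
    ∃ L : F →L[ℝ] EG →L[ℂ] EG, HasFDerivAt (fun w => AdEnd EG (s w)) L z ∧
      ∀ v : F, L v = AdEnd EG (s z) * adEnd EG G (mcForm EG s z v) :=
  hasFDerivAt_AdEnd_comp hs

/-- The Maurer-Cartan form of `s` is determined by the derivative of the matrix-valued map
`Ad ∘ s`, because the adjoint representation of a semisimple Lie algebra is faithful. -/
theorem mcForm_eq_of_hasFDerivAt {s : F → G} {z : F}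
    (hs : MDifferentiableAt 𝓘(ℝ, F) 𝓘(ℝ, EG) s z) {L : F →L[ℝ] EG →L[ℂ] EG}
    (hL : HasFDerivAt (fun w => AdEnd EG (s w)) L z) {v : F} {x : EG}
    (h : L v = AdEnd EG (s z) * adEnd EG G x) : mcForm EG s z v = x := by
  obtain ⟨L', h1, h2⟩ := hasFDerivAt_AdEnd_mcForm hs
  apply adEnd_injective EG G
  have h3 : AdEnd EG (s z) * adEnd EG G (mcForm EG s z v) =
      AdEnd EG (s z) * adEnd EG G x := by
    rw [← h2, ← h, hL.unique h1]
  have h4 := congrArg (fun A => AdEnd EG (s z)⁻¹ * A) h3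
  simpa only [← mul_assoc, AdEnd_inv_mul, one_mul] using h4

theorem fderiv_AdEnd_comp {s : F → G} {z : F}
    (hs : MDifferentiableAt 𝓘(ℝ, F) 𝓘(ℝ, EG) s z) (v : F) :
    fderiv ℝ (fun w => AdEnd EG (s w)) z v =
      AdEnd EG (s z) * adEnd EG G (mcForm EG s z v) := by
  obtain ⟨L', h1, h2⟩ := hasFDerivAt_AdEnd_mcForm hs
  rw [h1.fderiv, h2]

theorem mcForm_congr {s s' : F → G} {z : F} (h : s =ᶠ[𝓝 z] s') (v : F) :
    mcForm EG s z v = mcForm EG s' z v := by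
  have h1 : (fun w => (s z)⁻¹ * s w) =ᶠ[𝓝 z] fun w => (s' z)⁻¹ * s' w := by
    filter_upwards [h] with w hw
    rw [hw, h.self_of_nhds]
  have h2 : (mfderiv 𝓘(ℝ, F) 𝓘(ℝ, EG) (fun w => (s z)⁻¹ * s w) z : F →L[ℝ] EG) =
      (mfderiv 𝓘(ℝ, F) 𝓘(ℝ, EG) (fun w => (s' z)⁻¹ * s' w) z : F →L[ℝ] EG) := by
    have key : ∀ y : G, ∀ (f g : F → G), f =ᶠ[𝓝 z] g → f z = y → g z = y →
        (mfderiv 𝓘(ℝ, F) 𝓘(ℝ, EG) f z : F →L[ℝ] EG) = (mfderiv 𝓘(ℝ, F) 𝓘(ℝ, EG) g z : F →L[ℝ] EG) := by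
      intro y f g hfg hf hg
      by_cases hd : MDifferentiableAt 𝓘(ℝ, F) 𝓘(ℝ, EG) f z
      · subst hf
        exact ((hd.hasMFDerivAt.congr_of_eventuallyEq hfg.symm).mfderiv).symm
      · rw [mfderiv_zero_of_not_mdifferentiableAt hd, mfderiv_zero_of_not_mdifferentiableAt
          (fun hd' => hd (hd'.congr_of_eventuallyEq hfg))]
        rfl
    exact key 1 _ _ h1 (inv_mul_cancel _) (inv_mul_cancel _)
  exact congrArg (fun T : F →L[ℝ] EG => T v) h2

theorem mdifferentiableAt_mul {s l : F → G} {z : F}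
    (hs : MDifferentiableAt 𝓘(ℝ, F) 𝓘(ℝ, EG) s z) (hl : MDifferentiableAt 𝓘(ℝ, F) 𝓘(ℝ, EG) l z) :
    MDifferentiableAt 𝓘(ℝ, F) 𝓘(ℝ, EG) (fun w => s w * l w) z := by
  have hG : LieGroup 𝓘(ℝ, EG) ω G := LieGroup.real_of_complex ω
  exact MDifferentiableAt.comp z (g := fun p : G × G => p.1 * p.2)
    ((contMDiff_mul 𝓘(ℝ, EG) ω).mdifferentiableAt (by simp)) (hs.prodMk hl)

/-- The product rule `(s l)⁻¹ d(s l) = Ad(l⁻¹) (s⁻¹ ds) + l⁻¹ dl`. -/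
theorem mcForm_mul {s l : F → G} {z : F}
    (hs : MDifferentiableAt 𝓘(ℝ, F) 𝓘(ℝ, EG) s z) (hl : MDifferentiableAt 𝓘(ℝ, F) 𝓘(ℝ, EG) l z)
    (v : F) : mcForm EG (fun w => s w * l w) z v =
      AdEnd EG (l z)⁻¹ (mcForm EG s z v) + mcForm EG l z v := by
  obtain ⟨S, h1, h2⟩ := hasFDerivAt_AdEnd_mcForm hs
  obtain ⟨L, h3, h4⟩ := hasFDerivAt_AdEnd_mcForm hl
  have h5 : HasFDerivAt (fun w => AdEnd EG (s w * l w))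
      (AdEnd EG (s z) • L + S.smulRight (AdEnd EG (l z))) z := by
    simp only [AdEnd_mul]
    exact h1.mul' h3
  refine mcForm_eq_of_hasFDerivAt (mdifferentiableAt_mul hs hl) h5 ?_
  change AdEnd EG (s z) * L v + S v * AdEnd EG (l z) = _
  rw [h2, h4, map_add, adEnd_AdEnd_mul, inv_inv, AdEnd_mul, mul_add]
  have h6 : AdEnd EG (l z) * AdEnd EG (l z)⁻¹ = 1 := AdEnd_mul_inv _
  have h7 : ∀ A B X Y : EG →L[ℂ] EG, B * Y = 1 → A * B * (Y * X * B) = A * X * B := by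
    intro A B X Y h
    calc A * B * (Y * X * B) = A * (B * Y) * X * B := by noncomm_ring
      _ = _ := by rw [h, mul_one]
  rw [h7 _ _ _ _ h6]
  noncomm_ring

theorem mcForm_const_mul (g : G) {s : F → G} {z : F} (v : F) :
    mcForm EG (fun w => g * s w) z v = mcForm EG s z v := by
  have h : (fun w => (g * s z)⁻¹ * (g * s w)) = fun w => (s z)⁻¹ * s w := by
    ext1 w
    group
  have key : ∀ f f' : F → G, f = f' → ((mfderiv 𝓘(ℝ, F) 𝓘(ℝ, EG) f z : F →L[ℝ] EG) v) =
      (mfderiv 𝓘(ℝ, F) 𝓘(ℝ, EG) f' z : F →L[ℝ] EG) v := by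
    rintro f _ rfl
    rfl
  exact key _ _ h

theorem mcForm_comp {s : F → G} {φ : F' → F} {φ' : F' →L[ℝ] F} {z : F'}
    (hφ : HasFDerivAt φ φ' z) (hs : MDifferentiableAt 𝓘(ℝ, F) 𝓘(ℝ, EG) s (φ z)) (v : F') :
    mcForm EG (fun w => s (φ w)) z v = mcForm EG s (φ z) (φ' v) := by
  obtain ⟨S, h1, h2⟩ := hasFDerivAt_AdEnd_mcForm hs
  refine mcForm_eq_of_hasFDerivAt
    (MDifferentiableAt.comp z hs hφ.differentiableAt.mdifferentiableAt) (h1.comp z hφ) ?_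
  exact h2 _

variable (EG G) in
/-- As `ad` is injective, it has a linear left inverse. -/
theorem exists_leftInverse_adEnd :
    ∃ T : (EG →L[ℂ] EG) →L[ℝ] EG, ∀ v : EG, T (adEnd EG G v) = v := by
  obtain ⟨T, hT⟩ := LinearMap.exists_leftInverse_of_injective
    (adEnd EG G : EG →ₗ[ℂ] EG →L[ℂ] EG) (LinearMap.ker_eq_bot.2 (adEnd_injective EG G))
  exact ⟨(LinearMap.toContinuousLinearMap T).restrictScalars ℝ,
    fun v => congrArg (fun f : EG →ₗ[ℂ] EG => f v) hT⟩

theorem contDiffOn_AdEnd_comp {s : F → G} {V : Set F}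
    (hs : ContMDiffOn 𝓘(ℝ, F) 𝓘(ℝ, EG) ∞ s V) :
    ContDiffOn ℝ ∞ (fun w => AdEnd EG (s w)) V :=
  contMDiffOn_iff_contDiffOn.1
    (((contMDiff_AdEnd (EG := EG) (G := G)).real_of_complex.of_le le_top).comp_contMDiffOn hs)

/-- Smoothness of the Maurer-Cartan form, which is recovered from `Ad(s⁻¹) d(Ad ∘ s)` by a left
inverse of `ad`. -/
theorem contDiffOn_mcForm {s : F → G} {V : Set F} (hV : IsOpen V)
    (hs : ContMDiffOn 𝓘(ℝ, F) 𝓘(ℝ, EG) ∞ s V) (v : F) :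
    ContDiffOn ℝ ∞ (fun z => mcForm EG s z v) V := by
  have hG : LieGroup 𝓘(ℝ, EG) ω G := LieGroup.real_of_complex ω
  obtain ⟨T, hT⟩ := exists_leftInverse_adEnd EG G
  have h1 := contDiffOn_AdEnd_comp hs
  have h2 : ContDiffOn ℝ ∞ (fun w => AdEnd EG (s w)⁻¹) V :=
    contDiffOn_AdEnd_comp ((contMDiff_inv 𝓘(ℝ, EG) ∞).comp_contMDiffOn hs)
  have h3 : ContDiffOn ℝ ∞ (fun w => fderiv ℝ (fun w => AdEnd EG (s w)) w v) V :=
    (h1.fderiv_of_isOpen hV (m := ∞) (by simp)).clm_apply contDiffOn_const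
  refine (T.contDiff.comp_contDiffOn (h2.mul h3)).congr fun z hz => ?_
  have h4 := fderiv_AdEnd_comp ((hs.contMDiffAt (hV.mem_nhds hz)).mdifferentiableAt (by simp)) v
  change _ = T (AdEnd EG (s z)⁻¹ * fderiv ℝ (fun w => AdEnd EG (s w)) z v)
  rw [h4, ← mul_assoc, AdEnd_inv_mul, one_mul, hT]

/-- The Maurer-Cartan equation `dα + [α, α] / 2 = 0` for `α = s⁻¹ ds`. -/
theorem fderiv_mcForm {s : F → G} {V : Set F} (hV : IsOpen V)
    (hs : ContMDiffOn 𝓘(ℝ, F) 𝓘(ℝ, EG) ∞ s V) {z : F} (hz : z ∈ V) (u v : F) :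
    fderiv ℝ (fun z => mcForm EG s z v) z u -
      fderiv ℝ (fun z => mcForm EG s z u) z v +
      adEnd EG G (mcForm EG s z u) (mcForm EG s z v) = 0 := by
  set a : F → EG →L[ℂ] EG := fun w => AdEnd EG (s w) with ha
  have hVz : V ∈ 𝓝 z := hV.mem_nhds hz
  have h1 : ContDiffAt ℝ ∞ a z := (contDiffOn_AdEnd_comp hs).contDiffAt hVz
  have hd : ∀ w ∈ V, MDifferentiableAt 𝓘(ℝ, F) 𝓘(ℝ, EG) s w := fun w hw =>
    (hs.contMDiffAt (hV.mem_nhds hw)).mdifferentiableAt (by simp)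
  have hda : DifferentiableAt ℝ (fderiv ℝ a) z :=
    (h1.fderiv_right (m := 1) (WithTop.coe_le_coe.2 (le_top : (1 + 1 : ℕ∞) ≤ ⊤))).differentiableAt (by simp)
  have h2 : ∀ x y : F, a z * adEnd EG G (mcForm EG s z x) *
      adEnd EG G (mcForm EG s z y) +
      a z * adEnd EG G (fderiv ℝ (fun z => mcForm EG s z y) z x) =
      fderiv ℝ (fderiv ℝ a) z x y := by
    intro x y
    have h3 : (fun w => a w * adEnd EG G (mcForm EG s w y)) =ᶠ[𝓝 z]
        fun w => fderiv ℝ a w y := by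
      filter_upwards [hVz] with w hw
      exact (fderiv_AdEnd_comp (hd w hw) y).symm
    have h4 : DifferentiableAt ℝ (fun z => mcForm EG s z y) z :=
      ((contDiffOn_mcForm hV hs y).contDiffAt hVz).differentiableAt (by simp)
    have h5 : HasFDerivAt (fun w => adEnd EG G (mcForm EG s w y))
        (((adEnd EG G).restrictScalars ℝ : EG →L[ℝ] EG →L[ℂ] EG).comp
          (fderiv ℝ (fun z => mcForm EG s z y) z)) z :=
      ((adEnd EG G).restrictScalars ℝ : EG →L[ℝ] EG →L[ℂ] EG).hasFDerivAt.comp z h4.hasFDerivAt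
    have h6 := ((h1.differentiableAt (by simp)).hasFDerivAt.mul' h5).congr_of_eventuallyEq h3.symm
    have h7 : HasFDerivAt (fun w => fderiv ℝ a w y)
        ((ContinuousLinearMap.apply ℝ (EG →L[ℂ] EG) y).comp (fderiv ℝ (fderiv ℝ a) z)) z :=
      HasFDerivAt.comp z (g := ContinuousLinearMap.apply ℝ (EG →L[ℂ] EG) y)
        (ContinuousLinearMap.hasFDerivAt _) hda.hasFDerivAt
    have h8 := congrArg (fun T : F →L[ℝ] EG →L[ℂ] EG => T x) (h6.unique h7)
    change a z * adEnd EG G (fderiv ℝ (fun z => mcForm EG s z y) z x) +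
      fderiv ℝ a z x * adEnd EG G (mcForm EG s z y) = fderiv ℝ (fderiv ℝ a) z x y at h8
    rw [← h8, fderiv_AdEnd_comp (hd z hz) x, add_comm]
  -- the equation is the symmetry of the second derivative of `Ad ∘ s`
  have h3 : fderiv ℝ (fderiv ℝ a) z u v = fderiv ℝ (fderiv ℝ a) z v u :=
    (h1.isSymmSndFDerivAt
    (by simpa using WithTop.coe_le_coe.2 (le_top : (2 : ℕ∞) ≤ ⊤))) u v
  rw [← h2, ← h2] at h3
  apply adEnd_injective EG G
  rw [map_add, map_sub, map_zero, adEnd_bracket]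
  have h4 := congrArg (fun A => AdEnd EG (s z)⁻¹ * A) h3
  simp only [ha, mul_add, ← mul_assoc, AdEnd_inv_mul, one_mul] at h4
  have h5 : ∀ A B C D : EG →L[ℂ] EG, A + B = C + D → B - D + (A - C) = 0 := by
    intro A B C D h
    rw [eq_sub_of_add_eq h]
    abel
  exact h5 _ _ _ _ h4

end MaurerCartan

end HiggsBundle

namespace HiggsBundle

/-! ### Lifts and the pulled back metric -/

section Lifts

variable {EG : Type*} [NormedAddCommGroup EG] [NormedSpace ℂ EG]
  {G : Type*} [TopologicalSpace G] [ChartedSpace EG G] [Group G] [LieGroup 𝓘(ℂ, EG) ω G]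
  [CompleteSpace EG] [T2Space G] [FiniteDimensional ℂ EG]
  [LieAlgebra.IsSemisimple ℂ (LieAlg EG G)]
  {K L : Subgroup G} {τ : EG →ₛₗ[starRingEnd ℂ] EG} {P : EG →L[ℝ] EG}
  {F : Type*} [NormedAddCommGroup F] [NormedSpace ℝ F]

theorem contMDiffOn_mul {s l : F → G} {V : Set F} (hs : ContMDiffOn 𝓘(ℝ, F) 𝓘(ℝ, EG) ∞ s V)
    (hl : ContMDiffOn 𝓘(ℝ, F) 𝓘(ℝ, EG) ∞ l V) :
    ContMDiffOn 𝓘(ℝ, F) 𝓘(ℝ, EG) ∞ (fun w => s w * l w) V := by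
  have hG : LieGroup 𝓘(ℝ, EG) ∞ G := LieGroup.real_of_complex ∞
  exact hs.mul hl

theorem contMDiffOn_inv {s : F → G} {V : Set F} (hs : ContMDiffOn 𝓘(ℝ, F) 𝓘(ℝ, EG) ∞ s V) :
    ContMDiffOn 𝓘(ℝ, F) 𝓘(ℝ, EG) ∞ (fun w => (s w)⁻¹) V := by
  have hG : LieGroup 𝓘(ℝ, EG) ∞ G := LieGroup.real_of_complex ∞
  exact hs.inv

/-- Two lifts of the same map to `G / L` differ by a map into `L`, so that the normal parts of
their Maurer-Cartan forms differ by the adjoint action of an element of `L`. -/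
theorem IsQuotProj.exists_mcForm_eq (hP : IsQuotProj τ L P)
    (hτ : IsCompactConjugation (EG := EG) K τ) (hK : IsCompact (K : Set G)) (hLK : L ≤ K)
    (hL : IsClosed (L : Set G)) {s s' : F → G} {V : Set F} (hV : IsOpen V)
    (hs : ContMDiffOn 𝓘(ℝ, F) 𝓘(ℝ, EG) ∞ s V) (hs' : ContMDiffOn 𝓘(ℝ, F) 𝓘(ℝ, EG) ∞ s' V)
    (h : ∀ w ∈ V, (s w : G ⧸ L) = s' w) {z : F} (hz : z ∈ V) :
    ∃ l ∈ L, ∀ v, P (mcForm EG s' z v) = AdEnd EG l (P (mcForm EG s z v)) := by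
  have hVz := hV.mem_nhds hz
  have hl : ContMDiffOn 𝓘(ℝ, F) 𝓘(ℝ, EG) ∞ (fun w => (s w)⁻¹ * s' w) V :=
    contMDiffOn_mul (contMDiffOn_inv hs) hs'
  have hlL : ∀ w ∈ V, (s w)⁻¹ * s' w ∈ L := fun w hw => QuotientGroup.eq.1 (h w hw)
  have hld := (hl.contMDiffAt hVz).mdifferentiableAt (by simp)
  have hsd := (hs.contMDiffAt hVz).mdifferentiableAt (by simp)
  refine ⟨((s z)⁻¹ * s' z)⁻¹, L.inv_mem (hlL z hz), fun v => ?_⟩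
  have h1 := mcForm_mul hsd hld v
  have h2 : (fun w => s w * ((s w)⁻¹ * s' w)) = s' := by
    ext1 w
    group
  rw [h2] at h1
  have h3 : mcForm EG (fun w => (s w)⁻¹ * s' w) z v ∈ lieAlgOf EG L :=
    maurerCartan_mem_lieAlgOf hL hld (Filter.eventually_of_mem hVz hlL) v
  rw [h1, map_add, hP.apply_eq_zero _ h3, add_zero,
    hP.AdEnd_comm hτ hK hLK (L.inv_mem (hlL z hz))]

/-- The pulled back metric does not depend on the lift. -/
theorem IsLocalLift.metric_eq (hP : IsQuotProj τ L P)
    (hτ : IsCompactConjugation (EG := EG) K τ) (hK : IsCompact (K : Set G)) (hLK : L ≤ K)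
    (hL : IsClosed (L : Set G)) {f : F → G ⧸ L} {z : F} {s s' : F → G}
    (hs : IsLocalLift EG F L f z s) (hs' : IsLocalLift EG F L f z s') (u v : F) :
    metric G τ (P (mcForm EG s' z u)) (P (mcForm EG s' z v)) =
      metric G τ (P (mcForm EG s z u)) (P (mcForm EG s z v)) := by
  obtain ⟨V, hV, hz, hsV, hsf⟩ := hs
  obtain ⟨V', hV', hz', hsV', hsf'⟩ := hs'
  obtain ⟨l, hl, h⟩ := hP.exists_mcForm_eq hτ hK hLK hL (hV.inter hV')
    (hsV.mono Set.inter_subset_left) (hsV'.mono Set.inter_subset_right)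
    (fun w hw => (hsf w hw.1).trans (hsf' w hw.2).symm) ⟨hz, hz'⟩
  rw [h, h, hτ.metric_AdEnd (hLK hl)]

open Classical in
/-- The value on `u`, `v` of the pullback by `f` of the invariant metric of `G / L`, computed by
means of a local lift of `f`. -/
noncomputable def pullbackMetric (τ : EG →ₛₗ[starRingEnd ℂ] EG) (P : EG →L[ℝ] EG) (f : F → G ⧸ L)
    (u v z : F) : ℝ :=
  if h : ∃ s : F → G, IsLocalLift EG F L f z s then
    metric G τ (P (mcForm EG h.choose z u)) (P (mcForm EG h.choose z v))
  else 0

theorem IsLocalLift.pullbackMetric_eq (hP : IsQuotProj τ L P)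
    (hτ : IsCompactConjugation (EG := EG) K τ) (hK : IsCompact (K : Set G)) (hLK : L ≤ K)
    (hL : IsClosed (L : Set G)) {f : F → G ⧸ L} {z : F} {s : F → G}
    (hs : IsLocalLift EG F L f z s) (u v : F) :
    pullbackMetric τ P f u v z = metric G τ (P (mcForm EG s z u)) (P (mcForm EG s z v)) := by
  have h : ∃ s : F → G, IsLocalLift EG F L f z s := ⟨s, hs⟩
  rw [pullbackMetric, dif_pos h]
  exact IsLocalLift.metric_eq hP hτ hK hLK hL hs h.choose_spec u v

/-- The square norm of the differential of a map to `G / L`, by means of any local lift. -/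
theorem IsLocalLift.normSqDiff_eq (hP : IsQuotProj τ L P)
    (hτ : IsCompactConjugation (EG := EG) K τ) (hK : IsCompact (K : Set G)) (hLK : L ≤ K)
    (hL : IsClosed (L : Set G)) {f : F → G ⧸ L} {z : F} {s : F → G}
    (hs : IsLocalLift EG F L f z s) (v : F) :
    normSqDiff EG F τ L f z v = metric G τ (P (mcForm EG s z v)) (P (mcForm EG s z v)) := by
  have h : ∃ s : F → G, IsLocalLift EG F L f z s := ⟨s, hs⟩
  refine (dif_pos h).trans ?_
  refine (hP.normSqQuot_eq hτ hK hL _).trans ?_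
  exact IsLocalLift.metric_eq hP hτ hK hLK hL hs h.choose_spec v v

theorem contDiffOn_pullbackMetric (hP : IsQuotProj τ L P)
    (hτ : IsCompactConjugation (EG := EG) K τ) (hK : IsCompact (K : Set G)) (hLK : L ≤ K)
    (hL : IsClosed (L : Set G)) {f : F → G ⧸ L} {U : Set F} (hf : IsSmoothOn EG F L f U)
    (u v : F) : ContDiffOn ℝ ∞ (pullbackMetric τ P f u v) U := by
  intro z hz
  obtain ⟨s, V, hV, hzV, hs, hsf⟩ := hf z hz
  have h1 : ∀ v, ContDiffOn ℝ ∞ (fun w => P (mcForm EG s w v)) V := fun v =>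
    P.contDiff.comp_contDiffOn (contDiffOn_mcForm hV hs v)
  have h2 : ContDiffOn ℝ ∞ (pullbackMetric τ P f u v) V :=
    (((metric G τ).contDiff.comp_contDiffOn (h1 u)).clm_apply (h1 v)).congr fun w hw =>
      IsLocalLift.pullbackMetric_eq hP hτ hK hLK hL ⟨V, hV, hw, hs, hsf⟩ u v
  exact (h2.contDiffAt (hV.mem_nhds hzV)).contDiffWithinAt

theorem IsQuotProj.metric_proj (hP : IsQuotProj τ L P) (u v : EG) :
    metric G τ (P u) (P v) = metric G τ (P u) v := by
  have h := hP.orthogonal u _ (hP.sub_mem v)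
  rw [map_sub, sub_eq_zero] at h
  exact h.symm

theorem IsQuotProj.metric_proj' (hP : IsQuotProj τ L P)
    (hτ : IsCompactConjugation (EG := EG) K τ) (hK : IsCompact (K : Set G)) (u v : EG) :
    metric G τ (P u) (P v) = metric G τ u (P v) := by
  rw [hτ.metric_comm hK, hP.metric_proj, hτ.metric_comm hK]

/-- The first variation formula, in infinitesimal form: with `α = S⁻¹ dS`, the derivative in the
direction `t` of half the energy `|α_e|² / 2` in the direction `e` is the derivative in the
direction `e` of `⟪α_e, α_t⟫`, up to the pairing of `α_t` with the tension field. -/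
theorem IsQuotProj.first_variation (hP : IsQuotProj τ L P)
    (hτ : IsCompactConjugation (EG := EG) K τ) (hK : IsCompact (K : Set G))
    {S : F → G} {V : Set F} (hV : IsOpen V) (hS : ContMDiffOn 𝓘(ℝ, F) 𝓘(ℝ, EG) ∞ S V) {q : F}
    (hq : q ∈ V) (e t : F) :
    fderiv ℝ (fun w => metric G τ (P (mcForm EG S w e)) (P (mcForm EG S w e))) q t / 2 =
      fderiv ℝ (fun w => metric G τ (P (mcForm EG S w e)) (P (mcForm EG S w t))) q e -
      metric G τ (mcForm EG S q t) (fderiv ℝ (fun w => P (mcForm EG S w e)) q e +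
        adEnd EG G (τ (mcForm EG S q e)) (P (mcForm EG S q e))) := by
  have hd : ∀ v, DifferentiableAt ℝ (fun w => mcForm EG S w v) q := fun v =>
    ((contDiffOn_mcForm hV hS v).contDiffAt (hV.mem_nhds hq)).differentiableAt (by simp)
  have hPd : ∀ v, HasFDerivAt (fun w => P (mcForm EG S w v))
      (P.comp (fderiv ℝ (fun w => mcForm EG S w v) q)) q := fun v =>
    P.hasFDerivAt.comp q (hd v).hasFDerivAt
  have hm : ∀ u v x, fderiv ℝ (fun w => metric G τ (P (mcForm EG S w u)) (P (mcForm EG S w v))) q x =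
      metric G τ (P (mcForm EG S q u)) (P (fderiv ℝ (fun w => mcForm EG S w v) q x)) +
      metric G τ (P (fderiv ℝ (fun w => mcForm EG S w u) q x)) (P (mcForm EG S q v)) := by
    intro u v x
    have h1 := ((metric G τ).hasFDerivAt.comp q (hPd u)).clm_apply (hPd v)
    exact congrArg (fun T : F →L[ℝ] ℝ => T x) (HasFDerivAt.fderiv h1)
  have hMC := fderiv_mcForm hV hS hq t e
  rw [hm, hm, (hPd e).fderiv]
  change _ = _ - metric G τ _ (P (fderiv ℝ (fun w => mcForm EG S w e) q e) + _)
  rw [hτ.metric_comm hK (P (fderiv ℝ (fun w => mcForm EG S w e) q t)), map_add,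
    hτ.metric_comm hK (P (fderiv ℝ (fun w => mcForm EG S w e) q e)), hP.metric_proj' hτ hK
      (mcForm EG S q t), hP.metric_proj _ (fderiv ℝ (fun w => mcForm EG S w e) q t),
    hP.metric_proj _ (fderiv ℝ (fun w => mcForm EG S w t) q e)]
  have h1 : fderiv ℝ (fun w => mcForm EG S w e) q t = fderiv ℝ (fun w => mcForm EG S w t) q e +
      adEnd EG G (mcForm EG S q e) (mcForm EG S q t) := by
    rw [adEnd_skew G (mcForm EG S q e), ← sub_eq_zero, ← hMC]
    abel
  rw [h1, map_add, hτ.metric_comm hK _ (adEnd EG G (mcForm EG S q e) (mcForm EG S q t)),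
    hτ.metric_adEnd]
  ring

end Lifts

end HiggsBundle

namespace HiggsBundle

/-! ### A criterion for harmonicity -/

/-- The divergence theorem for a function of compact support. -/
theorem integral_fderiv_eq_zero_of_vanish {Y : ℂ → ℝ} {C : Set ℂ} (hC : IsCompact C)
    (hY : ContDiff ℝ 1 Y) (h0 : ∀ z, z ∉ C → Y z = 0) (v : ℂ) :
    ∫ z in C, fderiv ℝ Y z v = 0 := by
  have hsupp : HasCompactSupport Y := HasCompactSupport.intro hC h0
  have hsupp' : HasCompactSupport fun z => fderiv ℝ Y z v := hsupp.fderiv_apply ℝ v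
  have hc : Continuous fun z => fderiv ℝ Y z v := (hY.continuous_fderiv (by simp)).clm_apply continuous_const
  have hvan : ∀ z, z ∉ C → fderiv ℝ Y z v = 0 := by
    intro z hz
    have h1 : Y =ᶠ[𝓝 z] fun _ => 0 :=
      Filter.eventually_of_mem (hC.isClosed.isOpen_compl.mem_nhds hz) h0
    rw [h1.fderiv_eq, fderiv_fun_const]
    rfl
  rw [MeasureTheory.setIntegral_eq_integral_of_forall_compl_eq_zero hvan]
  have h2 := integral_mul_fderiv_eq_neg_fderiv_mul_of_integrable (𝕜 := ℝ) (μ := MeasureTheory.volume)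
    (f := fun _ : ℂ => (1 : ℝ)) (g := Y) (v := v) (by simp)
    (by simpa using hc.integrable_of_hasCompactSupport hsupp')
    (by simpa using hY.continuous.integrable_of_hasCompactSupport hsupp)
    (by fun_prop) (fun x _ => (hY.differentiable (by simp)) x)
  simpa using h2

/-- Differentiation under the integral sign over a compact set. -/
theorem hasDerivAt_setIntegral_of_contDiffOn {e : ℝ × ℂ → ℝ} {O C : Set ℂ} (hO : IsOpen O)
    (hC : IsCompact C) (hCO : C ⊆ O) (he : ContDiffOn ℝ 1 e (Set.univ ×ˢ O)) :
    HasDerivAt (fun t : ℝ => ∫ z in C, e (t, z)) (∫ z in C, fderiv ℝ e (0, z) (1, 0)) 0 := by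
  have hU : IsOpen ((Set.univ : Set ℝ) ×ˢ O) := isOpen_univ.prod hO
  have hf : ContinuousOn (fun q => fderiv ℝ e q (1, 0)) (Set.univ ×ˢ O) :=
    (he.continuousOn_fderiv_of_isOpen hU (by simp)).clm_apply continuousOn_const
  have hslice : ∀ (t : ℝ) (g : ℝ × ℂ → ℝ), ContinuousOn g (Set.univ ×ˢ O) →
      ContinuousOn (fun z => g (t, z)) C := fun t g hg =>
    hg.comp (by fun_prop) fun z hz => ⟨Set.mem_univ _, hCO hz⟩
  obtain ⟨M, hM⟩ := ((isCompact_closedBall (0 : ℝ) 1).prod hC).exists_bound_of_continuousOn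
    (hf.mono (Set.prod_mono (Set.subset_univ _) hCO))
  refine (hasDerivAt_integral_of_dominated_loc_of_deriv_le (s := Metric.ball 0 1)
    (F := fun t z => e (t, z)) (F' := fun t z => fderiv ℝ e (t, z) (1, 0)) (bound := fun _ => M)
    (Metric.ball_mem_nhds _ one_pos) ?_ ?_ ?_ ?_ ?_ ?_).2
  · exact Filter.Eventually.of_forall fun t =>
      (hslice t e he.continuousOn).aestronglyMeasurable hC.measurableSet
  · exact (hslice 0 e he.continuousOn).integrableOn_compact hC
  · exact (hslice 0 _ hf).aestronglyMeasurable hC.measurableSet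
  · refine (MeasureTheory.ae_restrict_iff' hC.measurableSet).2 (Filter.Eventually.of_forall ?_)
    exact fun z hz t ht => hM (t, z) ⟨Metric.ball_subset_closedBall ht, hz⟩
  · exact MeasureTheory.integrableOn_const hC.measure_lt_top.ne
  · refine (MeasureTheory.ae_restrict_iff' hC.measurableSet).2 (Filter.Eventually.of_forall ?_)
    intro z hz t _
    have h1 : DifferentiableAt ℝ e (t, z) :=
      (he.contDiffAt (hU.mem_nhds ⟨Set.mem_univ _, hCO hz⟩)).differentiableAt (by simp)
    have h2 : HasDerivAt (fun t : ℝ => (t, z)) ((1 : ℝ), (0 : ℂ)) t :=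
      (hasDerivAt_id t).prodMk (hasDerivAt_const t z)
    exact h1.hasFDerivAt.comp_hasDerivAt t h2

section Criterion

variable {EG : Type*} [NormedAddCommGroup EG] [NormedSpace ℂ EG]
  {G : Type*} [TopologicalSpace G] [ChartedSpace EG G] [Group G] [LieGroup 𝓘(ℂ, EG) ω G]
  [CompleteSpace EG] [T2Space G] [FiniteDimensional ℂ EG]
  [LieAlgebra.IsSemisimple ℂ (LieAlg EG G)]
  {K L : Subgroup G} {τ : EG →ₛₗ[starRingEnd ℂ] EG} {P : EG →L[ℝ] EG}

/-- The contribution of the direction `e` to the tension field of the map to `G / L` with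
lift `g`. -/
noncomputable def tension (τ : EG →ₛₗ[starRingEnd ℂ] EG) (P : EG →L[ℝ] EG) (g : ℂ → G) (e z : ℂ) :
    EG :=
  fderiv ℝ (fun w => P (mcForm EG g w e)) z e + adEnd EG G (τ (mcForm EG g z e)) (P (mcForm EG g z e))

theorem hasFDerivAt_slice (t : ℝ) (z : ℂ) :
    HasFDerivAt (fun w : ℂ => (t, w)) (ContinuousLinearMap.inr ℝ ℝ ℂ) z :=
  (hasFDerivAt_const t z).prodMk (hasFDerivAt_id z)

theorem IsLocalLift.slice {F : ℝ → ℂ → G ⧸ L} {t : ℝ} {z : ℂ} {S : ℝ × ℂ → G}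
    (hS : IsLocalLift EG (ℝ × ℂ) L (fun q : ℝ × ℂ => F q.1 q.2) (t, z) S) :
    IsLocalLift EG ℂ L (F t) z (fun w => S (t, w)) := by
  obtain ⟨V, hV, hz, hs, hsf⟩ := hS
  have hc : ContDiff ℝ ∞ fun w : ℂ => (t, w) := contDiff_const.prodMk contDiff_id
  exact ⟨(fun w : ℂ => (t, w)) ⁻¹' V, hV.preimage hc.continuous, hz,
    hs.comp hc.contMDiff.contMDiffOn (fun w hw => hw), fun w hw => hsf (t, w) hw⟩

/-- A variation of a map with lift `g` has a lift which extends `g`. -/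
theorem exists_lift_extending {F : ℝ → ℂ → G ⧸ L} {f : ℂ → G ⧸ L} {O : Set ℂ} (hO : IsOpen O)
    (hF : IsSmoothOn EG (ℝ × ℂ) L (fun q : ℝ × ℂ => F q.1 q.2) (Set.univ ×ˢ O))
    (hF0 : ∀ z ∈ O, F 0 z = f z) {z : ℂ} (hz : z ∈ O) {g : ℂ → G}
    (hg : IsLocalLift EG ℂ L f z g) :
    ∃ S : ℝ × ℂ → G, IsLocalLift EG (ℝ × ℂ) L (fun q : ℝ × ℂ => F q.1 q.2) (0, z) S ∧
      ∀ w, S (0, w) = g w := by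
  obtain ⟨S, V, hV, hzV, hS, hSF⟩ := hF (0, z) ⟨Set.mem_univ _, hz⟩
  obtain ⟨W, hW, hzW, hgW, hgf⟩ := hg
  have hc : ContDiff ℝ ∞ fun q : ℝ × ℂ => ((0 : ℝ), q.2) := contDiff_const.prodMk contDiff_snd
  have hc2 : ContDiff ℝ ∞ fun q : ℝ × ℂ => q.2 := contDiff_snd
  refine ⟨fun q => S q * ((S (0, q.2))⁻¹ * g q.2),
    ⟨V ∩ ((fun q : ℝ × ℂ => ((0 : ℝ), q.2)) ⁻¹' V ∩ (fun q : ℝ × ℂ => q.2) ⁻¹' (W ∩ O)),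
      hV.inter ((hV.preimage hc.continuous).inter ((hW.inter hO).preimage hc2.continuous)),
      ⟨hzV, hzV, hzW, hz⟩, ?_, ?_⟩, fun w => by simp⟩
  · refine contMDiffOn_mul (hS.mono fun q hq => hq.1) (contMDiffOn_mul (contMDiffOn_inv ?_) ?_)
    · exact hS.comp hc.contMDiff.contMDiffOn (fun q hq => hq.2.1)
    · exact hgW.comp hc2.contMDiff.contMDiffOn (fun q hq => hq.2.2.1)
  · intro q hq
    rw [← hSF q hq.1]
    refine (QuotientGroup.eq.2 ?_).symm
    have h1 := hSF _ hq.2.1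
    have h2 : ((S (0, q.2) : G) : G ⧸ L) = g q.2 :=
      (h1.trans (hF0 _ hq.2.2.2)).trans (hgf _ hq.2.2.1).symm
    simpa using QuotientGroup.eq.1 h2

/-- A map from a domain in `ℂ` to `G / L` is harmonic if near each point it has a local lift whose
tension field vanishes there. -/
theorem IsQuotProj.isHarmonicOn (hP : IsQuotProj τ L P)
    (hτ : IsCompactConjugation (EG := EG) K τ) (hK : IsCompact (K : Set G)) (hLK : L ≤ K)
    (hL : IsClosed (L : Set G)) {f : ℂ → G ⧸ L} {O : Set ℂ} (hO : IsOpen O)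
    (h : ∀ z ∈ O, ∃ g, IsLocalLift EG ℂ L f z g ∧ tension τ P g 1 z + tension τ P g Complex.I z = 0) :
    IsHarmonicOn EG τ L f O := by
  refine ⟨fun z hz => (h z hz).imp fun g hg => hg.1, ?_⟩
  intro F C hC hCO hF hF0 hFC
  set Fh : ℝ × ℂ → G ⧸ L := fun q => F q.1 q.2 with hFh
  have hU : IsOpen ((Set.univ : Set ℝ) ×ˢ O) := isOpen_univ.prod hO
  have hQ : ∀ u v, ContDiffOn ℝ ∞ (pullbackMetric τ P Fh u v) (Set.univ ×ˢ O) :=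
    fun u v => contDiffOn_pullbackMetric hP hτ hK hLK hL hF u v
  set Q : ℂ → ℝ × ℂ → ℝ := fun a => pullbackMetric τ P Fh (0, a) (0, a) with hQdef
  set R : ℂ → ℝ × ℂ → ℝ := fun a => pullbackMetric τ P Fh (0, a) (1, 0) with hRdef
  have henergy : ∀ t : ℝ, ∀ z ∈ O,
      energyDensity EG τ L (F t) z = Q 1 (t, z) / 2 + Q Complex.I (t, z) / 2 := by
    intro t z hz
    obtain ⟨S, hS⟩ := hF (t, z) ⟨Set.mem_univ _, hz⟩
    have h1 : ∀ a : ℂ, normSqDiff EG ℂ τ L (F t) z a = Q a (t, z) := by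
      intro a
      obtain ⟨V, hV, hz, hs, hsf⟩ := id hS
      have h2 := mcForm_comp (EG := EG) (s := S) (hasFDerivAt_slice t z)
        ((hs.contMDiffAt (hV.mem_nhds hz)).mdifferentiableAt (by simp)) a
      refine (IsLocalLift.normSqDiff_eq hP hτ hK hLK hL (IsLocalLift.slice hS) a).trans ?_
      rw [h2]
      exact (IsLocalLift.pullbackMetric_eq hP hτ hK hLK hL hS _ _).symm
    change (normSqDiff EG ℂ τ L (F t) z (1 : ℂ) + normSqDiff EG ℂ τ L (F t) z Complex.I) / 2 = _
    rw [h1, h1]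
    ring
  -- the first variation formula at time `0`
  have hvar : ∀ z ∈ O, fderiv ℝ (fun q => Q 1 q / 2 + Q Complex.I q / 2) (0, z) (1, 0) =
      fderiv ℝ (fun w => R 1 (0, w)) z 1 + fderiv ℝ (fun w => R Complex.I (0, w)) z Complex.I := by
    intro z hz
    obtain ⟨g, hg, hgt⟩ := h z hz
    obtain ⟨S, hS, hSg⟩ := exists_lift_extending hO hF hF0 hz hg
    obtain ⟨V, hV, hzV, hs, hsf⟩ := id hS
    have hlift : ∀ q ∈ V, IsLocalLift EG (ℝ × ℂ) L Fh q S := fun q hq => ⟨V, hV, hq, hs, hsf⟩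
    have hpm : ∀ u v, pullbackMetric τ P Fh u v =ᶠ[𝓝 (0, z)]
        fun q => metric G τ (P (mcForm EG S q u)) (P (mcForm EG S q v)) := fun u v =>
      Filter.eventually_of_mem (hV.mem_nhds hzV) fun q hq =>
        IsLocalLift.pullbackMetric_eq hP hτ hK hLK hL (hlift q hq) u v
    have hnhds := hU.mem_nhds (show ((0 : ℝ), z) ∈ Set.univ ×ˢ O from ⟨Set.mem_univ _, hz⟩)
    have hdQ : ∀ u v, DifferentiableAt ℝ (pullbackMetric τ P Fh u v) (0, z) := fun u v =>
      ((hQ u v).contDiffAt hnhds).differentiableAt (by simp)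
    have hmc : ∀ a : ℂ, ∀ᶠ w in 𝓝 z, mcForm EG S (0, w) (0, a) = mcForm EG g w a := by
      intro a
      have hc : Continuous fun w : ℂ => ((0 : ℝ), w) := by fun_prop
      filter_upwards [(hV.preimage hc).mem_nhds hzV] with w hw
      have h2 := mcForm_comp (EG := EG) (s := S) (hasFDerivAt_slice 0 w)
        ((hs.contMDiffAt (hV.mem_nhds hw)).mdifferentiableAt (by simp)) a
      rw [funext hSg] at h2
      exact h2.symm
    -- the first variation formula for a lift `S` of the variation that extends `g`: the tension
    -- fields of `S` at time `0` and of `g` agree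
    have hterm : ∀ a : ℂ, fderiv ℝ (Q a) (0, z) (1, 0) / 2 = fderiv ℝ (fun w => R a (0, w)) z a -
        metric G τ (mcForm EG S (0, z) (1, 0)) (tension τ P g a z) := by
      intro a
      have h1 := hP.first_variation hτ hK hV hs hzV (0, a) (1, 0)
      rw [← (hpm _ _).fderiv_eq, ← (hpm _ _).fderiv_eq] at h1
      have h2 : fderiv ℝ (fun w => R a (0, w)) z a = fderiv ℝ (R a) (0, z) (0, a) := by
        have h3 := HasFDerivAt.comp z (hdQ (0, a) (1, 0)).hasFDerivAt (hasFDerivAt_slice 0 z)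
        exact congrArg (fun T : ℂ →L[ℝ] ℝ => T a) h3.fderiv
      have h4 : fderiv ℝ (fun w => P (mcForm EG S w (0, a))) (0, z) (0, a) =
          fderiv ℝ (fun w => P (mcForm EG g w a)) z a := by
        have h5 : DifferentiableAt ℝ (fun w => P (mcForm EG S w (0, a))) (0, z) :=
          ((P.contDiff.comp_contDiffOn (contDiffOn_mcForm hV hs (0, a))).contDiffAt
            (hV.mem_nhds hzV)).differentiableAt (by simp)
        have h6 := HasFDerivAt.comp z h5.hasFDerivAt (hasFDerivAt_slice 0 z)
        have h7 : (fun w => P (mcForm EG g w a)) =ᶠ[𝓝 z]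
            ((fun w => P (mcForm EG S w (0, a))) ∘ fun w : ℂ => ((0 : ℝ), w)) := by
          filter_upwards [hmc a] with w hw
          rw [Function.comp_apply, hw]
        rw [h7.fderiv_eq, h6.fderiv]
        rfl
      rw [h2, tension, ← h4, ← (hmc a).self_of_nhds]
      exact h1
    have hsum : fderiv ℝ (fun q => Q 1 q / 2 + Q Complex.I q / 2) (0, z) (1, 0) =
        fderiv ℝ (Q 1) (0, z) (1, 0) / 2 + fderiv ℝ (Q Complex.I) (0, z) (1, 0) / 2 := by
      have h1 := (((hdQ (0, 1) (0, 1)).hasFDerivAt.mul_const (2⁻¹ : ℝ)).add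
        ((hdQ (0, Complex.I) (0, Complex.I)).hasFDerivAt.mul_const (2⁻¹ : ℝ)))
      simp only [div_eq_mul_inv]
      refine (congrArg (fun T : ℝ × ℂ →L[ℝ] ℝ => T (1, 0)) h1.fderiv).trans ?_
      simp only [add_apply, smul_apply, smul_eq_mul, mul_comm]
      rfl
    rw [hsum, hterm, hterm]
    have h8 : metric G τ (mcForm EG S (0, z) (1, 0)) (tension τ P g 1 z) +
        metric G τ (mcForm EG S (0, z) (1, 0)) (tension τ P g Complex.I z) = 0 := by
      rw [← map_add, hgt, map_zero]
    linarith
  -- the variation is trivial near points of `O \ C`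
  have hR0 : ∀ a : ℂ, ∀ z ∈ O \ C, R a (0, z) = 0 := by
    intro a z hz
    obtain ⟨g, ⟨V, hV, hzV, hgV, hgf⟩, -⟩ := h z hz.1
    have hc2 : ContDiff ℝ ∞ fun q : ℝ × ℂ => q.2 := contDiff_snd
    have hlift : IsLocalLift EG (ℝ × ℂ) L Fh (0, z) (fun q => g q.2) := by
      refine ⟨(fun q : ℝ × ℂ => q.2) ⁻¹' (V ∩ (O \ C)), ?_, ⟨hzV, hz⟩, ?_, ?_⟩
      · exact (hV.inter (hO.sdiff hC.isClosed)).preimage hc2.continuous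
      · exact hgV.comp hc2.contMDiff.contMDiffOn (fun q hq => hq.1)
      · intro q hq
        exact (hgf _ hq.1).trans (hFC q.1 q.2 hq.2).symm
    have h1 := IsLocalLift.pullbackMetric_eq hP hτ hK hLK hL hlift (0, a) (1, 0)
    have h2 := mcForm_comp (EG := EG) (s := g) (φ := fun q : ℝ × ℂ => q.2) (z := (0, z))
      (hasFDerivAt_snd) ((hgV.contMDiffAt (hV.mem_nhds hzV)).mdifferentiableAt (by simp)) (1, 0)
    have h3 : mcForm EG (fun q : ℝ × ℂ => g q.2) (0, z) (1, 0) = 0 := h2.trans (map_zero _)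
    rw [h3, map_zero, map_zero] at h1
    exact h1
  -- `R a (0, ·)` vanishes outside `C`, and extended by zero it is differentiable on `ℂ`, so that
  -- its derivatives integrate to zero
  classical
  set Y : ℂ → ℂ → ℝ := fun a w => if w ∈ O then R a (0, w) else 0 with hY
  have hY0 : ∀ a z, z ∉ C → Y a z = 0 := by
    intro a z hz
    by_cases hzO : z ∈ O
    · exact (if_pos hzO).trans (hR0 a z ⟨hzO, hz⟩)
    · exact if_neg hzO
  have hYR : ∀ a, ∀ z ∈ O, Y a =ᶠ[𝓝 z] fun w => R a (0, w) := fun a z hz =>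
    Filter.eventually_of_mem (hO.mem_nhds hz) fun w hw => if_pos hw
  have hYd : ∀ a, ContDiff ℝ 1 (Y a) := by
    intro a
    rw [contDiff_iff_contDiffAt]
    intro z
    by_cases hz : z ∈ O
    · have hnhds := hU.mem_nhds (show ((0 : ℝ), z) ∈ Set.univ ×ˢ O from ⟨Set.mem_univ _, hz⟩)
      have hc : ContDiff ℝ 1 fun w : ℂ => ((0 : ℝ), w) := contDiff_const.prodMk contDiff_id
      exact ((((hQ (0, a) (1, 0)).contDiffAt hnhds).of_le (by exact_mod_cast le_top)).comp z
        hc.contDiffAt).congr_of_eventuallyEq (hYR a z hz)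
    · refine contDiffAt_const.congr_of_eventuallyEq (Filter.eventually_of_mem
        (hC.isClosed.isOpen_compl.mem_nhds fun hz' => hz (hCO hz')) (hY0 a))
  have hmain := hasDerivAt_setIntegral_of_contDiffOn (e := fun q => Q 1 q / 2 + Q Complex.I q / 2)
    hO hC hCO ((((hQ _ _).of_le (by exact_mod_cast le_top)).div_const 2).add
      (((hQ _ _).of_le (by exact_mod_cast le_top)).div_const 2))
  have hzero : ∫ z in C, fderiv ℝ (fun q => Q 1 q / 2 + Q Complex.I q / 2) (0, z) (1, 0) = 0 := by
    have h1 : ∀ z ∈ C, fderiv ℝ (fun q => Q 1 q / 2 + Q Complex.I q / 2) (0, z) (1, 0) =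
        fderiv ℝ (Y 1) z 1 + fderiv ℝ (Y Complex.I) z Complex.I := by
      intro z hz
      rw [hvar z (hCO hz), (hYR 1 z (hCO hz)).fderiv_eq, (hYR Complex.I z (hCO hz)).fderiv_eq]
    have hint : ∀ a, MeasureTheory.IntegrableOn (fun z => fderiv ℝ (Y a) z a) C := fun a =>
      (((hYd a).continuous_fderiv (by simp)).clm_apply
        continuous_const).continuousOn.integrableOn_compact hC
    rw [MeasureTheory.setIntegral_congr_fun hC.measurableSet h1,
      MeasureTheory.integral_add (hint 1) (hint Complex.I),
      integral_fderiv_eq_zero_of_vanish hC (hYd _) (hY0 _),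
      integral_fderiv_eq_zero_of_vanish hC (hYd _) (hY0 _), add_zero]
  rw [hzero] at hmain
  refine hmain.congr_of_eventuallyEq (Filter.Eventually.of_forall fun t => ?_)
  exact MeasureTheory.setIntegral_congr_fun hC.measurableSet fun z hz => henergy t z (hCO hz)

end Criterion

end HiggsBundle

namespace HiggsBundle

/-! ### The logarithm of a conjugation -/

/-- Commuting operators that are symmetric for some inner product have a joint eigenbasis. -/
theorem exists_joint_eigenbasis {V : Type*} [AddCommGroup V] [Module ℂ V] [FiniteDimensional ℂ V]
    (c : InnerProductSpace.Core ℂ V) {ι : Type*} (T : ι → V →ₗ[ℂ] V)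
    (hT : ∀ i x y, c.inner (T i x) y = c.inner x (T i y)) (hc : ∀ i j, Commute (T i) (T j)) :
    ∃ (n : ℕ) (b : Module.Basis (Fin n) ℂ V), ∀ i k, ∃ μ : ℂ, T i (b k) = μ • b k := by
  classical
  let : NormedAddCommGroup V := c.toNormedAddCommGroup
  let : InnerProductSpace ℂ V := InnerProductSpace.ofCore c.toCore
  have hs : ∀ i, (T i).IsSymmetric := fun i x y => hT i x y
  have hd := LinearMap.IsSymmetric.directSum_isInternal_of_pairwise_commute hs
    (fun i j _ => hc i j)
  let b := hd.collectedBasis fun γ => Module.Free.chooseBasis ℂ _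
  have : Finite ((γ : ι → ℂ) × Module.Free.ChooseBasisIndex ℂ
      ↥(⨅ j, Module.End.eigenspace (T j) (γ j))) := Module.Finite.finite_basis b
  let := Fintype.ofFinite ((γ : ι → ℂ) × Module.Free.ChooseBasisIndex ℂ
      ↥(⨅ j, Module.End.eigenspace (T j) (γ j)))
  refine ⟨_, b.reindex (Fintype.equivFin _), fun i k => ?_⟩
  rw [Module.Basis.reindex_apply]
  set a := (Fintype.equivFin _).symm k
  have h1 := hd.collectedBasis_mem (fun γ => Module.Free.chooseBasis ℂ _) a
  rw [Submodule.mem_iInf] at h1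
  exact ⟨_, Module.End.mem_eigenspace_iff.1 (h1 i)⟩

/-- A diagonalizable operator with positive eigenvalues has a logarithm which is a polynomial in
the operator. -/
theorem exists_polynomial_log {V : Type*} [AddCommGroup V] [Module ℂ V] {n : ℕ}
    (b : Module.Basis (Fin n) ℂ V) (N : Module.End ℂ V) (μ : Fin n → ℝ)
    (hb : ∀ k, N (b k) = (μ k : ℂ) • b k) :
    ∃ p : Polynomial ℂ, ∀ (r : ℝ) (u : V), N u = (r : ℂ) • u →
      Polynomial.aeval N p u = (Real.log r : ℂ) • u := by
  classical
  refine ⟨Lagrange.interpolate (Finset.univ.image fun k => (μ k : ℂ)) id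
    (fun z => (Real.log z.re : ℂ)), fun r u hu => ?_⟩
  by_cases hu0 : u = 0
  · simp [hu0]
  rw [Module.End.aeval_apply_of_hasEigenvector ⟨Module.End.mem_eigenspace_iff.2 hu, hu0⟩]
  have hmem : (r : ℂ) ∈ Finset.univ.image fun k => (μ k : ℂ) := by
    by_contra hne
    apply hu0
    apply b.repr.injective
    ext k
    have h1 : b.repr (N u) k = (μ k : ℂ) * b.repr u k := by
      have h0 : N u = ∑ j, ((μ j : ℂ) * b.repr u j) • b j := by
        conv_lhs => rw [← b.sum_repr u]
        rw [map_sum]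
        exact Finset.sum_congr rfl fun j _ => by rw [map_smul, hb, smul_smul, mul_comm]
      rw [h0, b.repr_sum_self]
    rw [hu, map_smul, Finsupp.smul_apply, smul_eq_mul] at h1
    have h2 : (r : ℂ) - μ k ≠ 0 := fun h => hne
      (Finset.mem_image.2 ⟨k, Finset.mem_univ _, (sub_eq_zero.1 h).symm⟩)
    have h3 : ((r : ℂ) - μ k) * b.repr u k = 0 := by rw [sub_mul, h1, sub_self]
    simpa using (mul_eq_zero.1 h3).resolve_left h2
  have h4 := Lagrange.eval_interpolate_at_node (v := (id : ℂ → ℂ))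
    (fun z : ℂ => (Real.log z.re : ℂ)) Function.injective_id.injOn hmem
  rw [id_eq, Complex.ofReal_re] at h4
  rw [h4]

section Log

variable {EG : Type*} [NormedAddCommGroup EG] [NormedSpace ℂ EG]
  {G : Type*} [TopologicalSpace G] [ChartedSpace EG G] [Group G] [LieGroup 𝓘(ℂ, EG) ω G]
  [CompleteSpace EG] [T2Space G] [FiniteDimensional ℂ EG]
  [LieAlgebra.IsSemisimple ℂ (LieAlg EG G)]
  {K : Subgroup G} {τ : EG →ₛₗ[starRingEnd ℂ] EG}

/-- The Killing form is nondegenerate, because `B(σ_K x, x) < 0` for `x ≠ 0`. -/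
theorem IsCompactConjugation.isKilling (hτ : IsCompactConjugation (EG := EG) K τ)
    (hK : IsCompact (K : Set G)) : LieAlgebra.IsKilling ℂ (LieAlg EG G) := by
  have h : ∀ x : EG, killing EG G (τ x) x = 0 → x = 0 := by
    intro x h2
    by_contra hne
    have h1 := (hτ.killing_conj_self hK hne).2
    rw [killing_comm, h2] at h1
    simp at h1
  refine ⟨(LieSubmodule.eq_bot_iff _).2 fun x hx => h x ?_⟩
  exact (LieIdeal.mem_killingCompl ℂ (LieAlg EG G) ⊤).1 hx (τ x) (LieSubmodule.mem_top _)

/-- The Hermitian inner product `- B(σ_K u, v)` on `𝔤`. -/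
@[reducible] noncomputable def IsCompactConjugation.core (hτ : IsCompactConjugation (EG := EG) K τ)
    (hK : IsCompact (K : Set G)) : InnerProductSpace.Core ℂ EG where
  inner u v := -killing EG G (τ u) v
  conj_inner_symm u v := by
    rw [map_neg, ← hτ.killing_map hK, hτ.invol, killing_comm]
  re_inner_nonneg u := by
    by_cases hu : u = 0
    · simp [hu]
    · have h := (hτ.killing_conj_self hK hu).2
      rw [killing_comm] at h
      simpa using h.le
  add_left u v w := by simp only [map_add, LinearMap.add_apply]; ring
  smul_left u v r := by simp only [map_smulₛₗ, LinearMap.smul_apply, smul_eq_mul, RingHom.id_apply]; ring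
  definite u hu := by
    by_contra hne
    have h := (hτ.killing_conj_self hK hne).2
    rw [killing_comm] at h
    rw [neg_eq_zero] at hu
    rw [hu] at h
    simp at h

/-- A derivation of `𝔤` is inner. -/
theorem IsCompactConjugation.exists_eq_adEnd (hτ : IsCompactConjugation (EG := EG) K τ)
    (hK : IsCompact (K : Set G)) (D : EG →ₗ[ℂ] EG)
    (hD : ∀ u v : EG, D (adEnd EG G u v) = adEnd EG G (D u) v + adEnd EG G u (D v)) :
    ∃ η : EG, ∀ v, D v = adEnd EG G η v := by
  have := hτ.isKilling hK
  have hfin : Module.Finite ℂ (LieAlg EG G) := inferInstanceAs (FiniteDimensional ℂ EG)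
  have hlie : ∀ u v : EG, D (lieBracket EG G u v) =
      lieBracket EG G u (D v) - lieBracket EG G v (D u) := by
    intro u v
    have h := hD u v
    rwa [adEnd_skew G (D u) v, add_comm, ← sub_eq_add_neg, adEnd_apply, adEnd_apply,
      adEnd_apply] at h
  let D' : LieDerivation ℂ (LieAlg EG G) (LieAlg EG G) := LieDerivation.mk (D : LieAlg EG G →ₗ[ℂ] LieAlg EG G)
    (fun u v => hlie u v)
  have h1 : D' ∈ (LieDerivation.ad ℂ (LieAlg EG G)).range := by
    rw [LieDerivation.IsKilling.range_ad_eq_top]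
    exact LieSubalgebra.mem_top _
  obtain ⟨η, hη⟩ := LieHom.mem_range _ _ |>.1 h1
  refine ⟨η, fun v => (Eq.symm ?_ : D v = adEnd EG G η v)⟩
  have h2 := congrArg (fun E : LieDerivation ℂ (LieAlg EG G) (LieAlg EG G) => E v) hη
  have h3 : (LieDerivation.ad ℂ (LieAlg EG G) η) v = lieBracket EG G η v :=
    LieDerivation.ad_apply_apply ℂ (LieAlg EG G) η v
  exact (adEnd_apply (EG := EG) (G := G) η v).trans (h3.symm.trans h2)

/-- If `σ'` is conjugate to `σ_K = τ` by `Ad g`, then `σ' τ = Ad(g⁻¹) Ad(g⁻¹)*` is a positive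
automorphism of `𝔤`, and its logarithm is a derivation `ad η` with `τ η = - η`. Being a polynomial
in `σ' τ`, it preserves the subspaces that `σ'` and `τ` preserve. -/
theorem IsCompactConjugation.exists_log (hτ : IsCompactConjugation (EG := EG) K τ)
    (hK : IsCompact (K : Set G)) {σ' : EG →ₛₗ[starRingEnd ℂ] EG} {g : G}
    (hσ : ∀ v, σ' v = AdEnd EG g⁻¹ (τ (AdEnd EG g v))) (W : Submodule ℂ EG)
    (hWτ : ∀ w ∈ W, τ w ∈ W) (hWσ : ∀ w ∈ W, σ' w ∈ W) :
    ∃ η : EG, τ η = -η ∧ (∀ w ∈ W, adEnd EG G η w ∈ W) ∧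
      ∀ v, σ' (τ v) = NormedSpace.exp (adEnd EG G η) v := by
  let N : EG →ₗ[ℂ] EG := σ'.comp τ
  have hN : ∀ v, N v = AdEnd EG g⁻¹ (τ (AdEnd EG g (τ v))) := fun v => hσ (τ v)
  have hNad : ∀ u v, N (adEnd EG G u v) = adEnd EG G (N u) (N v) := by
    intro u v
    simp only [hN, hτ.adEnd_map, AdEnd_adEnd]
  have hkg : ∀ u v, killing EG G u (AdEnd EG g⁻¹ v) = killing EG G (AdEnd EG g u) v := by
    intro u v
    rw [← killing_AdEnd g, AdEnd_apply_inv]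
  have hinner : ∀ u v, killing EG G (τ u) (N v) =
      killing EG G (AdEnd EG g (τ u)) (τ (AdEnd EG g (τ v))) := by
    intro u v
    rw [hN, hkg]
  have hsymm : ∀ u v, killing EG G (τ (N u)) v = killing EG G (τ u) (N v) := by
    intro u v
    have h1 := hτ.killing_map hK (N u) (τ v)
    rw [hτ.invol] at h1
    rw [h1, killing_comm, hinner, ← hτ.killing_map hK, hτ.invol, killing_comm, ← hinner]
  obtain ⟨n, b, hb⟩ := exists_joint_eigenbasis (hτ.core hK) (fun _ : Unit => N)
    (fun _ u v => congrArg Neg.neg (hsymm u v)) (fun _ _ => Commute.refl _)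
  -- the eigenvalues are positive, since `- B(σ_K u, N u) = |Ad g σ_K u|²`
  have hpos : ∀ k, ∃ μ : ℝ, 0 < μ ∧ N (b k) = (μ : ℂ) • b k := by
    intro k
    obtain ⟨μ, hμ⟩ := hb () k
    have hbk : b k ≠ 0 := b.ne_zero k
    have hne : AdEnd EG g (τ (b k)) ≠ 0 := by
      intro h0
      apply hbk
      have h1 := congrArg (fun x => τ (AdEnd EG g⁻¹ x)) h0
      simpa only [AdEnd_inv_apply, hτ.invol, map_zero] using h1
    have h1 := hτ.killing_conj_self hK hne
    have h2 := hτ.killing_conj_self hK hbk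
    rw [killing_comm] at h2
    rw [← hinner, show N (b k) = μ • b k from hμ, map_smul, smul_eq_mul, Complex.mul_im, Complex.mul_re, h2.1] at h1
    have him : μ.im = 0 := by
      have h3 : μ.im * (killing EG G (τ (b k)) (b k)).re = 0 := by linarith [h1.1]
      exact (mul_eq_zero.1 h3).resolve_right h2.2.ne
    refine ⟨μ.re, ?_, ?_⟩
    · by_contra hle
      nlinarith [h1.2, h2.2, mul_nonneg (neg_nonneg.2 (not_lt.1 hle)) (neg_nonneg.2 h2.2.le)]
    · rw [show ((μ.re : ℝ) : ℂ) = μ from Complex.ext rfl (by simp [him])]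
      exact hμ
  choose μ hμ0 hμ using hpos
  obtain ⟨p, hp⟩ := exists_polynomial_log b N μ hμ
  set D : EG →ₗ[ℂ] EG := Polynomial.aeval N p with hDdef
  have hDb : ∀ k, D (b k) = (Real.log (μ k) : ℂ) • b k := fun k => hp _ _ (hμ k)
  -- on eigenvectors `[b i, b j]` has the eigenvalue `μ i * μ j`, whose logarithm is a sum
  have hDer : ∀ u v : EG, D (adEnd EG G u v) = adEnd EG G (D u) v + adEnd EG G u (D v) := by
    have hl : (LinearMap.compr₂ ((ContinuousLinearMap.coeLM ℂ).comp (adEnd EG G : EG →ₗ[ℂ] EG →L[ℂ] EG)) D) =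
        ((ContinuousLinearMap.coeLM ℂ).comp (adEnd EG G : EG →ₗ[ℂ] EG →L[ℂ] EG)).comp D +
        ((ContinuousLinearMap.coeLM ℂ).comp (adEnd EG G : EG →ₗ[ℂ] EG →L[ℂ] EG)).compl₂ D := by
      refine b.ext fun i => b.ext fun j => ?_
      change D (adEnd EG G (b i) (b j)) = adEnd EG G (D (b i)) (b j) + adEnd EG G (b i) (D (b j))
      have h1 : N (adEnd EG G (b i) (b j)) = ((μ i * μ j : ℝ) : ℂ) • adEnd EG G (b i) (b j) := by
        rw [hNad, hμ, hμ, map_smul, map_smul, smul_apply, smul_smul, Complex.ofReal_mul, mul_comm]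
      rw [hp _ _ h1, hDb, hDb, map_smul, map_smul, smul_apply,
        Real.log_mul (hμ0 i).ne' (hμ0 j).ne', Complex.ofReal_add, add_smul]
    intro u v
    exact congrArg (fun T : EG →ₗ[ℂ] EG →ₗ[ℂ] EG => T u v) hl
  obtain ⟨η, hη⟩ := hτ.exists_eq_adEnd hK D hDer
  -- `σ_K` interchanges the eigenspaces of `N` for `μ` and `μ⁻¹`
  have hNτ : ∀ v, N (τ (N v)) = τ v := by
    intro v
    rw [hN, hN, hτ.invol, AdEnd_apply_inv, hτ.invol, AdEnd_inv_apply]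
  have hDτ : ∀ v, D (τ v) = -τ (D v) := by
    have hl : D.comp τ = -(τ.comp D) := by
      refine b.ext fun k => ?_
      change D (τ (b k)) = -τ (D (b k))
      have h1 := hNτ (b k)
      rw [hμ, map_smulₛₗ, Complex.conj_ofReal, map_smul] at h1
      have h0 : (μ k : ℂ) ≠ 0 := Complex.ofReal_ne_zero.2 (hμ0 k).ne'
      have h2 : N (τ (b k)) = (((μ k)⁻¹ : ℝ) : ℂ) • τ (b k) := by
        conv_rhs => rw [← h1]
        rw [smul_smul, Complex.ofReal_inv, inv_mul_cancel₀ h0, one_smul]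
      rw [hp _ _ h2, hDb, map_smulₛₗ, Complex.conj_ofReal, Real.log_inv, Complex.ofReal_neg,
        neg_smul]
    intro v
    exact congrArg (fun T : EG →ₛₗ[starRingEnd ℂ] EG => T v) hl
  refine ⟨η, ?_, ?_, ?_⟩
  · apply adEnd_injective EG G
    refine ContinuousLinearMap.ext fun v => ?_
    have h1 := hτ.adEnd_map η (τ v)
    rw [hτ.invol, ← hη, hDτ, map_neg, hτ.invol] at h1
    rw [← h1, map_neg, neg_apply, hη]
  · intro w hw
    rw [← hη]
    have hNW : W ≤ W.comap N := fun w hw => hWσ _ (hWτ w hw)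
    have h1 : ∀ q : Polynomial ℂ, Polynomial.aeval N q w ∈ W := by
      intro q
      induction q using Polynomial.induction_on' with
      | add p q hp hq =>
        rw [map_add]
        exact W.add_mem hp hq
      | monomial n a =>
        rw [Polynomial.aeval_monomial]
        have h2 : ∀ n : ℕ, (N ^ n : Module.End ℂ EG) w ∈ W := by
          intro n
          induction n with
          | zero => exact hw
          | succ n ih =>
            rw [pow_succ']
            exact hNW ih
        exact W.smul_mem a (h2 n)
    exact h1 p
  · have hl : N = (NormedSpace.exp (adEnd EG G η) : EG →L[ℂ] EG) := by
      refine b.ext fun k => ?_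
      have h1 := exp_smul_apply_of_eigenvector (A := adEnd EG G η) (w := b k)
        ((hη _).symm.trans (hDb k)) 1
      rw [one_smul, Complex.ofReal_one, one_mul, ← Complex.ofReal_exp, Real.exp_log (hμ0 k)] at h1
      rw [hμ]
      exact h1.symm
    intro v
    exact congrArg (fun T : EG →ₗ[ℂ] EG => T v) hl

end Log

end HiggsBundle

namespace HiggsBundle

/-! ### Maximal tori -/

section Torus

variable {EG : Type*} [NormedAddCommGroup EG] [NormedSpace ℂ EG]
  {G : Type*} [TopologicalSpace G] [ChartedSpace EG G] [Group G] [LieGroup 𝓘(ℂ, EG) ω G]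
  [CompleteSpace EG] [T2Space G] [FiniteDimensional ℂ EG]
  [LieAlgebra.IsSemisimple ℂ (LieAlg EG G)]
  {K T : Subgroup G} {τ : EG →ₛₗ[starRingEnd ℂ] EG}

theorem hasDerivAt_exp_smul_adEnd_apply (a b : EG) :
    HasDerivAt (fun t : ℝ => NormedSpace.exp (t • adEnd EG G a) b) (adEnd EG G a b) 0 := by
  have h2 := hasDerivAt_exp_smul_const (𝕂 := ℝ) (adEnd EG G a) 0
  have h3 := (ContinuousLinearMap.apply ℂ EG b).restrictScalars ℝ
    |>.hasFDerivAt.comp_hasDerivAt (0 : ℝ) h2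
  refine h3.congr_deriv ?_
  change NormedSpace.exp ((0 : ℝ) • adEnd EG G a) (adEnd EG G a b) = _
  rw [zero_smul, NormedSpace.exp_zero]
  rfl

theorem AdEnd_expLie_smul (t : ℝ) (a : EG) :
    AdEnd EG (expLie (t • a) : G) = NormedSpace.exp (t • adEnd EG G a) := by
  have h4 : t • adEnd EG G a = adEnd EG G (t • a) := (LinearMap.map_smul_of_tower _ t a).symm
  rw [h4, AdEnd_expLie]

/-- A one-parameter group determines its velocity. -/
theorem eq_of_expLie_smul_eq {v w : EG} (h : ∀ t : ℝ, (expLie (t • v) : G) = expLie (t • w)) :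
    v = w := by
  apply adEnd_injective EG G
  refine ContinuousLinearMap.ext fun b => ?_
  refine (hasDerivAt_exp_smul_adEnd_apply (G := G) v b).unique
    ((hasDerivAt_exp_smul_adEnd_apply (G := G) w b).congr_of_eventuallyEq
      (Filter.Eventually.of_forall fun t => ?_))
  change NormedSpace.exp (t • adEnd EG G v) b = NormedSpace.exp (t • adEnd EG G w) b
  rw [← AdEnd_expLie_smul, ← AdEnd_expLie_smul, h]

theorem AdEnd_apply_of_commute {g : G} {b : EG} (h : ∀ t : ℝ, Commute g (expLie (t • b))) :
    AdEnd EG g b = b := by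
  refine eq_of_expLie_smul_eq (G := G) fun t => ?_
  have h1 := conj_expLie g (t • b)
  rw [(AdEnd EG g).map_smul_of_tower, (h t).eq, mul_inv_cancel_right] at h1
  exact h1.symm

theorem adEnd_eq_zero_of_commute {a b : EG}
    (h : ∀ s t : ℝ, Commute (expLie (s • a) : G) (expLie (t • b))) : adEnd EG G a b = 0 := by
  refine (hasDerivAt_exp_smul_adEnd_apply (G := G) a b).unique
    ((hasDerivAt_const (0 : ℝ) b).congr_of_eventuallyEq
      (Filter.Eventually.of_forall fun s => ?_))
  change NormedSpace.exp (s • adEnd EG G a) b = b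
  rw [← AdEnd_expLie_smul]
  exact AdEnd_apply_of_commute (h s)

/-- A closed connected subgroup is generated by the exponentials of its Lie algebra. -/
theorem le_of_isConnected (hTc : IsClosed (T : Set G)) (hT : IsConnected (T : Set G))
    {S : Subgroup G} (h : ∀ v : EG, v ∈ lieAlgOf EG T → expLie v ∈ S) : T ≤ S := by
  have hG : IsTopologicalGroup G := topologicalGroup_of_lieGroup 𝓘(ℂ, EG) ω
  have hopen : IsOpen (S.subgroupOf T : Set T) := by
    refine Subgroup.isOpen_of_mem_nhds _ (g := 1) ?_
    have h1 : ∀ᶠ x : T in 𝓝 1, (x : G) ∈ T → ∃ v : EG, v ∈ lieAlgOf EG T ∧ (x : G) = expLie v :=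
      (Continuous.tendsto' continuous_subtype_val (1 : T) (1 : G) rfl).eventually
        (eventually_mem_exp_lieAlgOf EG hTc)
    filter_upwards [h1] with x hx
    obtain ⟨v, hv, hxv⟩ := hx x.2
    change (x : G) ∈ S
    rw [hxv]
    exact h v hv
  have : PreconnectedSpace T := Subtype.preconnectedSpace hT.isPreconnected
  have huniv := IsClopen.eq_univ (s := (S.subgroupOf T : Set T))
    ⟨Subgroup.isClosed_of_isOpen _ hopen, hopen⟩ ⟨1, one_mem _⟩
  intro t ht
  have : (⟨t, ht⟩ : T) ∈ (S.subgroupOf T : Set T) := huniv ▸ Set.mem_univ _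
  exact this

theorem IsMaximalTorus.isClosed (hT : IsMaximalTorus K T) : IsClosed (T : Set G) :=
  hT.1.2.1.isClosed

theorem lieAlgOf_mono {L L' : Subgroup G} (h : L ≤ L') {v : EG} (hv : v ∈ lieAlgOf EG L) :
    v ∈ lieAlgOf EG L' := by
  rw [mem_lieAlgOf_iff] at hv ⊢
  exact fun t => h (hv t)

theorem IsMaximalTorus.adEnd_eq_zero (hT : IsMaximalTorus K T) {a b : EG}
    (ha : a ∈ lieAlgOf EG T) (hb : b ∈ lieAlgOf EG T) : adEnd EG G a b = 0 :=
  adEnd_eq_zero_of_commute fun s t =>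
    hT.1.2.2.2 _ (mem_lieAlgOf_iff.1 ha s) _ (mem_lieAlgOf_iff.1 hb t)

/-- The Lie algebra of a maximal torus is its own centralizer in `𝔨`. -/
theorem IsMaximalTorus.mem_of_centralizes (hT : IsMaximalTorus K T) (hK : IsCompact (K : Set G))
    {ζ : EG} (hζ : ζ ∈ lieAlgOf EG K) (h : ∀ v : EG, v ∈ lieAlgOf EG T → adEnd EG G ζ v = 0) :
    ζ ∈ lieAlgOf EG T := by
  have hG : IsTopologicalGroup G := topologicalGroup_of_lieGroup 𝓘(ℂ, EG) ω
  have hcomm : ∀ t ∈ T, ∀ s : ℝ, Commute t (expLie (s • ζ)) := by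
    have hle : T ≤ Subgroup.centralizer (Set.range fun s : ℝ => (expLie (s • ζ) : G)) := by
      refine le_of_isConnected (EG := EG) hT.isClosed hT.1.2.2.1 fun v hv => ?_
      rw [Subgroup.mem_centralizer_iff]
      rintro _ ⟨s, rfl⟩
      refine (commute_expLie ?_).eq
      have h4 : adEnd EG G (s • ζ) = s • adEnd EG G ζ := LinearMap.map_smul_of_tower _ s ζ
      rw [h4, smul_apply, h v hv, smul_zero]
    intro t ht s
    exact (Subgroup.mem_centralizer_iff.1 (hle ht) _ ⟨s, rfl⟩).symm
  have hadd : ∀ s t : ℝ, (expLie (s • ζ) : G) * expLie (t • ζ) = expLie ((s + t) • ζ) :=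
    fun s t => (expLie_add_smul ζ s t).symm
  -- `M = T · exp (ℝ ζ)`; its closure is compact, connected and abelian, hence contained in `T`
  let M : Subgroup G :=
    { carrier := {g | ∃ t ∈ T, ∃ s : ℝ, g = t * expLie (s • ζ)}
      one_mem' := ⟨1, T.one_mem, 0, by simp [expLie_zero]⟩
      mul_mem' := by
        rintro _ _ ⟨t, ht, s, rfl⟩ ⟨t', ht', s', rfl⟩
        refine ⟨t * t', T.mul_mem ht ht', s + s', ?_⟩
        rw [← hadd, mul_assoc, ← mul_assoc (expLie (s • ζ)), ← (hcomm t' ht' s).eq]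
        simp only [mul_assoc]
      inv_mem' := by
        rintro _ ⟨t, ht, s, rfl⟩
        refine ⟨t⁻¹, T.inv_mem ht, -s, ?_⟩
        rw [mul_inv_rev, neg_smul, expLie_neg]
        exact ((hcomm t ht s).inv_inv).eq.symm }
  have hTM : T ≤ M := fun t ht => ⟨t, ht, 0, by simp [expLie_zero]⟩
  have hMK : M ≤ K := by
    rintro _ ⟨t, ht, s, rfl⟩
    exact K.mul_mem (hT.1.1 ht) (mem_lieAlgOf_iff.1 hζ s)
  have hMcK : M.topologicalClosure ≤ K := M.topologicalClosure_minimal hMK hK.isClosed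
  have hMconn : IsConnected (M : Set G) := by
    have h1 : (M : Set G) = (fun p : G × ℝ => p.1 * expLie (p.2 • ζ)) '' ((T : Set G) ×ˢ Set.univ) := by
      ext g
      constructor
      · rintro ⟨t, ht, s, rfl⟩
        exact ⟨(t, s), ⟨ht, Set.mem_univ _⟩, rfl⟩
      · rintro ⟨⟨t, s⟩, ⟨ht, -⟩, rfl⟩
        exact ⟨t, ht, s, rfl⟩
    rw [h1]
    refine (hT.1.2.2.1.prod isConnected_univ).image _ (Continuous.continuousOn ?_)
    exact continuous_fst.mul ((continuous_expLie_smul ζ).comp continuous_snd)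
  have hMab : ∀ x y : M, x * y = y * x := by
    rintro ⟨_, t, ht, s, rfl⟩ ⟨_, t', ht', s', rfl⟩
    refine Subtype.ext ?_
    have h1 : Commute t t' := hT.1.2.2.2 t ht t' ht'
    have h2 : Commute (expLie (s • ζ) : G) (expLie (s' • ζ)) := by
      change _ * _ = _ * _
      rw [hadd, hadd, add_comm]
    exact ((h1.mul_left (hcomm t' ht' s).symm).mul_right ((hcomm t ht s').mul_left h2)).eq
  have hprop : M.topologicalClosure ≤ K ∧ IsCompact (M.topologicalClosure : Set G) ∧
      IsConnected (M.topologicalClosure : Set G) ∧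
      ∀ a ∈ M.topologicalClosure, ∀ b ∈ M.topologicalClosure, a * b = b * a := by
    refine ⟨hMcK, hK.of_isClosed_subset M.isClosed_topologicalClosure hMcK, hMconn.closure, ?_⟩
    intro a ha b hb
    have h1 := (M.commGroupTopologicalClosure hMab).mul_comm ⟨a, ha⟩ ⟨b, hb⟩
    exact congrArg Subtype.val h1
  have hle := hT.2 hprop (hTM.trans M.le_topologicalClosure)
  refine mem_lieAlgOf_iff.2 fun s => hle (M.le_topologicalClosure ⟨1, T.one_mem, s, ?_⟩)
  rw [one_mul]

theorem mem_complexifiedLieAlgOf_iff {v : EG} : v ∈ complexifiedLieAlgOf EG T ↔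
    ∃ a b : EG, a ∈ lieAlgOf EG T ∧ b ∈ lieAlgOf EG T ∧ v = a + Complex.I • b :=
  ⟨fun ⟨a, ha, b, hb, h⟩ => ⟨a, b, ha, hb, h⟩, fun ⟨a, b, ha, hb, h⟩ => ⟨a, ha, b, hb, h⟩⟩

variable (EG) in
/-- The complex subspace `𝔥 = 𝔱 + i 𝔱` of `𝔤`. -/
noncomputable def cartanSubspace (T : Subgroup G) (hT : IsClosed (T : Set G)) : Submodule ℂ EG where
  carrier := {v | v ∈ complexifiedLieAlgOf EG T}
  zero_mem' := (mem_complexifiedLieAlgOf_iff (EG := EG)).2 ⟨0, 0, (lieSubspace (EG := EG) T hT).zero_mem,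
    (lieSubspace (EG := EG) T hT).zero_mem, by rw [smul_zero, add_zero]⟩
  add_mem' := by
    intro u v hu hv
    obtain ⟨a, b, ha, hb, rfl⟩ := (mem_complexifiedLieAlgOf_iff (EG := EG)).1 hu
    obtain ⟨c, d, hc, hd, rfl⟩ := (mem_complexifiedLieAlgOf_iff (EG := EG)).1 hv
    exact (mem_complexifiedLieAlgOf_iff (EG := EG)).2 ⟨a + c, b + d, (lieSubspace (EG := EG) T hT).add_mem ha hc,
      (lieSubspace (EG := EG) T hT).add_mem hb hd, by module⟩
  smul_mem' := by
    intro r u hu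
    obtain ⟨a, b, ha, hb, rfl⟩ := (mem_complexifiedLieAlgOf_iff (EG := EG)).1 hu
    have hm : ∀ (s : ℝ) {x : EG}, x ∈ lieAlgOf EG T → s • x ∈ lieSubspace (EG := EG) T hT := fun s x hx =>
      (lieSubspace (EG := EG) T hT).smul_mem s hx
    refine (mem_complexifiedLieAlgOf_iff (EG := EG)).2 ⟨r.re • a - r.im • b, r.im • a + r.re • b,
      Submodule.sub_mem _ (hm _ ha) (hm _ hb), Submodule.add_mem _ (hm _ ha) (hm _ hb), ?_⟩
    have h : r = r.re + r.im * Complex.I := (Complex.re_add_im r).symm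
    have h2 : (r.im : ℂ) • b + (r.im : ℂ) • (Complex.I * Complex.I) • b = 0 := by
      rw [Complex.I_mul_I, neg_one_smul, smul_neg, add_neg_cancel]
    conv_lhs => rw [h]
    simp only [← Complex.coe_smul]
    rw [← sub_eq_zero, ← h2]
    module

theorem exists_decomp_of_mem_cartanSubspace {hT : IsClosed (T : Set G)} {v : EG}
    (hv : v ∈ cartanSubspace EG T hT) :
    ∃ a b : EG, a ∈ lieAlgOf EG T ∧ b ∈ lieAlgOf EG T ∧ v = a + Complex.I • b := by
  exact (mem_complexifiedLieAlgOf_iff (EG := EG)).1 hv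

theorem mem_cartanSubspace_of_mem (hT : IsClosed (T : Set G)) {v : EG}
    (hv : v ∈ lieAlgOf EG T) : v ∈ cartanSubspace EG T hT :=
  (mem_complexifiedLieAlgOf_iff (EG := EG)).2 ⟨v, 0, hv, (lieSubspace (EG := EG) T hT).zero_mem,
    by rw [smul_zero, add_zero]⟩

theorem IsMaximalTorus.adEnd_eq_zero_of_mem_cartanSubspace (hT : IsMaximalTorus K T) {u v : EG}
    (hu : u ∈ cartanSubspace EG T hT.isClosed) (hv : v ∈ cartanSubspace EG T hT.isClosed) :
    adEnd EG G u v = 0 := by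
  obtain ⟨a, b, ha, hb, rfl⟩ := exists_decomp_of_mem_cartanSubspace hu
  obtain ⟨c, d, hc, hd, rfl⟩ := exists_decomp_of_mem_cartanSubspace hv
  simp only [map_add, map_smul, add_apply, smul_apply, hT.adEnd_eq_zero ha hc,
    hT.adEnd_eq_zero ha hd, hT.adEnd_eq_zero hb hc, hT.adEnd_eq_zero hb hd, smul_zero, add_zero]

theorem IsCompactConjugation.conj_mem_cartanSubspace (hτ : IsCompactConjugation (EG := EG) K τ)
    (hTK : T ≤ K) {hT : IsClosed (T : Set G)} {v : EG} (hv : v ∈ cartanSubspace EG T hT) :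
    τ v ∈ cartanSubspace EG T hT := by
  obtain ⟨a, b, ha, hb, rfl⟩ := exists_decomp_of_mem_cartanSubspace hv
  rw [map_add, conj_I_smul, hτ.eq_iff.2 (lieAlgOf_mono hTK ha), hτ.eq_iff.2 (lieAlgOf_mono hTK hb)]
  exact Submodule.add_mem _ (mem_cartanSubspace_of_mem hT ha)
    (Submodule.neg_mem _ (Submodule.smul_mem _ _ (mem_cartanSubspace_of_mem hT hb)))

/-- The logarithm of a conjugation which preserves `𝔥` lies in `i 𝔱`. -/
theorem IsMaximalTorus.exists_log (hT : IsMaximalTorus K T)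
    (hτ : IsCompactConjugation (EG := EG) K τ)
    (hK : IsCompact (K : Set G)) {σ' : EG →ₛₗ[starRingEnd ℂ] EG} {g : G}
    (hσ : ∀ v, σ' v = AdEnd EG g⁻¹ (τ (AdEnd EG g v)))
    (hWσ : ∀ w : EG, w ∈ complexifiedLieAlgOf EG T → σ' w ∈ complexifiedLieAlgOf EG T) :
    ∃ η : EG, Complex.I • η ∈ lieAlgOf EG T ∧
      ∀ v, σ' (τ v) = NormedSpace.exp (adEnd EG G η) v := by
  have hTK : T ≤ K := hT.1.1
  obtain ⟨η, hη, hηW, hlog⟩ := hτ.exists_log hK hσ (cartanSubspace EG T hT.isClosed)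
    (fun w hw => hτ.conj_mem_cartanSubspace hTK hw) hWσ
  refine ⟨η, ?_, hlog⟩
  -- `i η ∈ 𝔨` centralizes `𝔱`: for `v ∈ 𝔱` the vector `[i η, v]` lies in `𝔥 ∩ 𝔨` and is isotropic
  -- for `B`, because `𝔥` is abelian
  have hζ : τ (Complex.I • η) = Complex.I • η := by rw [conj_I_smul, hη, smul_neg, neg_neg]
  refine hT.mem_of_centralizes hK (hτ.eq_iff.1 hζ) fun v hv => ?_
  have hτv : τ v = v := hτ.eq_iff.2 (lieAlgOf_mono hTK hv)
  set x := adEnd EG G (Complex.I • η) v with hx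
  have hxh : x ∈ cartanSubspace EG T hT.isClosed := by
    rw [hx, map_smul, smul_apply]
    exact Submodule.smul_mem _ _ (hηW v (mem_cartanSubspace_of_mem _ hv))
  have hxK : τ x = x := by rw [hx, hτ.adEnd_map, hζ, hτv]
  have hB : killing EG G x x = 0 := by
    conv_lhs => rw [hx]
    rw [killing_adEnd, hT.adEnd_eq_zero_of_mem_cartanSubspace (mem_cartanSubspace_of_mem _ hv) hxh,
      map_zero]
  obtain ⟨r, -, h1, h2⟩ := killing_self hK (hτ.eq_iff.1 hxK)
  exact h2 (Complex.ofReal_eq_zero.1 (h1.symm.trans hB))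

/-- A root space decomposition in the form of a joint eigenbasis: the operators `ad η`, `η ∈ i 𝔱`,
commute and are symmetric for `-B(σ_K ·, ·)`, so that their eigenvalues are real. -/
theorem IsMaximalTorus.exists_joint_eigenbasis (hT : IsMaximalTorus K T)
    (hτ : IsCompactConjugation (EG := EG) K τ) (hK : IsCompact (K : Set G)) :
    ∃ (n : ℕ) (b : Module.Basis (Fin n) ℂ EG), ∀ η : EG, Complex.I • η ∈ lieAlgOf EG T →
      ∀ k, ∃ μ : ℝ, adEnd EG G η (b k) = (μ : ℂ) • b k := by
  have hsk : ∀ η : EG, Complex.I • η ∈ lieAlgOf EG T → τ η = -η := by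
    intro η hη
    have h1 := hτ.eq_iff.2 (lieAlgOf_mono hT.1.1 hη)
    rw [conj_I_smul, ← smul_neg] at h1
    have h2 := smul_right_injective EG Complex.I_ne_zero h1
    exact neg_eq_iff_eq_neg.1 h2
  have hsymm : ∀ η : EG, τ η = -η → ∀ u v, killing EG G (τ (adEnd EG G η u)) v =
      killing EG G (τ u) (adEnd EG G η v) := by
    intro η hη u v
    rw [hτ.adEnd_map, hη, map_neg, neg_apply, ← adEnd_skew, killing_adEnd]
  obtain ⟨n, b, hb⟩ := HiggsBundle.exists_joint_eigenbasis (hτ.core hK)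
    (fun η : {η : EG // Complex.I • η ∈ lieAlgOf EG T} => (adEnd EG G η.1 : EG →ₗ[ℂ] EG))
    (fun η u v => congrArg Neg.neg (hsymm η.1 (hsk η.1 η.2) u v)) (by
      intro η ξ
      refine LinearMap.ext fun v => ?_
      have h1 := adEnd_bracket G η.1 ξ.1
      have h2 : adEnd EG G η.1 ξ.1 = 0 := by
        have h3 := hT.adEnd_eq_zero η.2 ξ.2
        rw [map_smul, map_smul, smul_apply, smul_smul, Complex.I_mul_I, neg_one_smul,
          neg_eq_zero] at h3
        exact h3
      rw [h2, map_zero] at h1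
      exact congrArg (fun A : EG →L[ℂ] EG => A v) (sub_eq_zero.1 h1.symm))
  refine ⟨n, b, fun η hη k => ?_⟩
  obtain ⟨μ, hμ⟩ := hb ⟨η, hη⟩ k
  replace hμ : adEnd EG G η (b k) = μ • b k := hμ
  have h1 := hsymm η (hsk η hη) (b k) (b k)
  rw [hμ, τ.map_smulₛₗ, map_smul, LinearMap.smul_apply, map_smul, smul_eq_mul, smul_eq_mul] at h1
  have h2 : killing EG G (τ (b k)) (b k) ≠ 0 := by
    intro h0
    have h3 := (hτ.killing_conj_self hK (b.ne_zero k)).2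
    rw [killing_comm, h0] at h3
    simp at h3
  exact ⟨μ.re, by rw [hμ, Complex.conj_eq_iff_re.1 (mul_right_cancel₀ h2 h1)]⟩

theorem expLie_mem_torusComplexification {v : EG} (hv : v ∈ complexifiedLieAlgOf EG T) :
    (expLie v : G) ∈ torusComplexification EG T :=
  Subgroup.subset_closure ⟨v, hv, fun t => expLie (t • v), isOneParam_expLie v, by simp⟩

/-- `H ∩ K = T`, where `H` is the complexification of `T`. -/
theorem IsMaximalTorus.mem_of_mem_torusComplexification (hT : IsMaximalTorus K T)
    (hK : IsCompact (K : Set G)) {g : G}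
    (hg : g ∈ torusComplexification EG T) (hgK : g ∈ K) : g ∈ T := by
  -- as `𝔥` is abelian, its exponentials form a group
  have hexp : ∀ g ∈ torusComplexification EG T,
      ∃ v : EG, v ∈ cartanSubspace EG T hT.isClosed ∧ g = expLie v := by
    intro g hg
    induction hg using Subgroup.closure_induction with
    | mem x hx =>
      obtain ⟨v, hv, γ, hγ, rfl⟩ := hx
      exact ⟨v, hv, (hγ.eq_expLie 1).trans (congrArg expLie (one_smul ℝ (v : EG)))⟩
    | one => exact ⟨0, Submodule.zero_mem _, (expLie_zero G).symm⟩
    | mul x y _ _ hx hy =>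
      obtain ⟨u, hu, rfl⟩ := hx
      obtain ⟨v, hv, rfl⟩ := hy
      exact ⟨u + v, Submodule.add_mem _ hu hv,
        (expLie_add (hT.adEnd_eq_zero_of_mem_cartanSubspace hu hv)).symm⟩
    | inv x _ hx =>
      obtain ⟨u, hu, rfl⟩ := hx
      exact ⟨-u, Submodule.neg_mem _ hu, (expLie_neg u).symm⟩
  obtain ⟨v, hv, rfl⟩ := hexp g hg
  obtain ⟨a, b, ha, hb, rfl⟩ := exists_decomp_of_mem_cartanSubspace hv
  have hT' := mem_cartanSubspace_of_mem hT.isClosed ha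
  have hT'' := Submodule.smul_mem _ Complex.I (mem_cartanSubspace_of_mem hT.isClosed hb)
  have haT : (expLie a : G) ∈ T := by simpa using mem_lieAlgOf_iff.1 ha 1
  rw [expLie_add (hT.adEnd_eq_zero_of_mem_cartanSubspace hT' hT'')] at hgK ⊢
  have hbK : (expLie (Complex.I • b) : G) ∈ K := by
    have := K.mul_mem (K.inv_mem (hT.1.1 haT)) hgK
    simpa using this
  suffices hb0 : b = 0 by
    rw [hb0, smul_zero, expLie_zero, mul_one]
    exact haT
  -- `exp (t i b)` is bounded, because it lies in `K` for integral `t`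
  obtain ⟨C, hC⟩ := exists_norm_AdEnd_le (EG := EG) hK
  have hint : ∀ n : ℤ, (expLie ((n : ℝ) • Complex.I • b) : G) ∈ K := by
    intro n
    have hnat : ∀ m : ℕ, (expLie ((m : ℝ) • Complex.I • b) : G) ∈ K := fun m => by
      rw [Nat.cast_smul_eq_nsmul, expLie_nsmul]
      exact K.pow_mem hbK m
    obtain ⟨m, rfl | rfl⟩ := n.eq_nat_or_neg
    · simpa using hnat m
    · rw [Int.cast_neg, neg_smul, expLie_neg]
      exact K.inv_mem (by simpa using hnat m)
  have hcont : Continuous fun t : ℝ => AdEnd EG (expLie (t • Complex.I • b) : G) :=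
    (contMDiff_AdEnd (EG := EG) (G := G)).continuous.comp (continuous_expLie_smul _)
  obtain ⟨C', hC'⟩ := isCompact_Icc (a := (0 : ℝ)) (b := 1) |>.exists_bound_of_continuousOn
    hcont.continuousOn
  obtain ⟨r, h1, h2, h3⟩ := trace_sq_of_bounded (A := adEnd EG G (Complex.I • b)) (C := C * C')
    fun t => by
      rw [← AdEnd_expLie_smul]
      have h4 : (expLie (t • Complex.I • b) : G) = expLie ((⌊t⌋ : ℝ) • Complex.I • b) *
          expLie (Int.fract t • Complex.I • b) := by
        rw [← expLie_add_smul, Int.floor_add_fract]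
      rw [h4, AdEnd_mul]
      refine (norm_mul_le _ _).trans (mul_le_mul (hC _ (hint _))
        (hC' _ ⟨Int.fract_nonneg t, (Int.fract_lt_one t).le⟩) (norm_nonneg _)
        ((norm_nonneg _).trans (hC 1 K.one_mem)))
  -- `B(i b, i b) ≤ 0` because `exp (t i b)` is bounded, and `B(b, b) ≤ 0` because `b ∈ 𝔨`
  obtain ⟨s, h5, h6, h7⟩ := killing_self hK (lieAlgOf_mono hT.1.1 hb)
  rw [← killing_apply, map_smul, map_smul, LinearMap.smul_apply, h6, smul_smul, Complex.I_mul_I,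
    neg_one_smul] at h2
  have h8 : -s = r := by exact_mod_cast h2
  exact h7 (by linarith)

end Torus

end HiggsBundle

namespace HiggsBundle

/-! ### The tension field of a harmonic bundle -/

section Tension

variable {EG : Type*} [NormedAddCommGroup EG] [NormedSpace ℂ EG]
  {G : Type*} [TopologicalSpace G] [ChartedSpace EG G] [Group G] [LieGroup 𝓘(ℂ, EG) ω G]
  [CompleteSpace EG] [T2Space G] [FiniteDimensional ℂ EG]
  [LieAlgebra.IsSemisimple ℂ (LieAlg EG G)]
  {K T L : Subgroup G} {τ : EG →ₛₗ[starRingEnd ℂ] EG} {P : EG →L[ℝ] EG}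
  {F : Type*} [NormedAddCommGroup F] [NormedSpace ℝ F]

theorem mdifferentiableAt_expLie_comp {ξ : F → EG} {z : F} (hξ : DifferentiableAt ℝ ξ z) :
    MDifferentiableAt 𝓘(ℝ, F) 𝓘(ℝ, EG) (fun w => (expLie (ξ w) : G)) z :=
  MDifferentiableAt.comp z
    ((contMDiff_expLie (EG := EG) (G := G)).real_of_complex.mdifferentiableAt (by simp))
    hξ.mdifferentiableAt

theorem mcForm_expLie_of_eq_zero {ξ : F → EG} {z : F} (hξ : DifferentiableAt ℝ ξ z)
    (h0 : ξ z = 0) (v : F) : mcForm EG (fun w => (expLie (ξ w) : G)) z v = fderiv ℝ ξ z v := by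
  have h1 : HasFDerivAt (fun w => AdEnd EG (expLie (ξ w) : G))
      (((adEnd EG G).restrictScalars ℝ : EG →L[ℝ] EG →L[ℂ] EG).comp (fderiv ℝ ξ z)) z := by
    have h2 : HasFDerivAt (fun w => adEnd EG G (ξ w))
        (((adEnd EG G).restrictScalars ℝ : EG →L[ℝ] EG →L[ℂ] EG).comp (fderiv ℝ ξ z)) z :=
      HasFDerivAt.comp z (g := (adEnd EG G).restrictScalars ℝ)
        (ContinuousLinearMap.hasFDerivAt _) hξ.hasFDerivAt
    have h3 : HasFDerivAt NormedSpace.exp (1 : (EG →L[ℂ] EG) →L[ℝ] EG →L[ℂ] EG)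
        (adEnd EG G (ξ z)) := by
      rw [h0, map_zero]
      exact hasFDerivAt_exp_zero
    refine (h3.comp z h2).congr_of_eventuallyEq (Filter.Eventually.of_forall fun w => ?_)
    exact AdEnd_expLie (ξ w)
  refine mcForm_eq_of_hasFDerivAt (mdifferentiableAt_expLie_comp hξ) h1 ?_
  rw [h0, expLie_zero, AdEnd_one, one_mul]
  rfl

/-- The Maurer-Cartan form of `exp ∘ ξ` is `dξ` if the values of `ξ` commute. -/
theorem mcForm_expLie {ξ : F → EG} {z : F} (hξ : DifferentiableAt ℝ ξ z)
    (h0 : ∀ᶠ w in 𝓝 z, adEnd EG G (ξ z) (ξ w) = 0) (v : F) :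
    mcForm EG (fun w => (expLie (ξ w) : G)) z v = fderiv ℝ ξ z v := by
  have h1 : (fun w => (expLie (ξ w) : G)) =ᶠ[𝓝 z]
      fun w => expLie (ξ z) * expLie (ξ w - ξ z) := by
    filter_upwards [h0] with w hw
    rw [← expLie_add, add_sub_cancel]
    rw [map_sub, hw, h0.self_of_nhds, sub_zero]
  rw [mcForm_congr h1, mcForm_const_mul, mcForm_expLie_of_eq_zero (hξ.sub_const _) (sub_self _),
    fderiv_sub_const]

theorem IsQuotProj.mem_of_eq_zero (hP : IsQuotProj τ L P) {v : EG} (hv : P v = 0) :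
    v ∈ lieAlgOf EG L := by
  have h := hP.sub_mem v
  rwa [hv, sub_zero] at h

/-- The derivative of a function with values in the subspace `i 𝔱` has values in it. -/
theorem I_smul_fderiv_mem (hT : IsMaximalTorus K T)
    (hτ : IsCompactConjugation (EG := EG) K τ) (hK : IsCompact (K : Set G)) {η : F → EG} {z : F}
    (hη : DifferentiableAt ℝ η z) (h : ∀ᶠ w in 𝓝 z, Complex.I • η w ∈ lieAlgOf EG T) (v : F) :
    Complex.I • fderiv ℝ η z v ∈ lieAlgOf EG T := by
  obtain ⟨P, hP⟩ := hτ.exists_isQuotProj hK hT.isClosed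
  apply hP.mem_of_eq_zero
  have h1 : HasFDerivAt (fun w => P (Complex.I • η w)) (P.comp (Complex.I • fderiv ℝ η z)) z :=
    P.hasFDerivAt.comp z (hη.hasFDerivAt.const_smul Complex.I)
  have h2 : (fun w => P (Complex.I • η w)) =ᶠ[𝓝 z] fun _ => 0 := by
    filter_upwards [h] with w hw
    exact hP.apply_eq_zero _ hw
  have h3 := h1.unique ((hasFDerivAt_const (0 : EG) z).congr_of_eventuallyEq h2)
  exact congrArg (fun A : F →L[ℝ] EG => A v) h3

theorem IsCompactConjugation.eq_neg_of_I_smul_mem (hτ : IsCompactConjugation (EG := EG) K τ)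
    {η : EG} (hη : Complex.I • η ∈ lieAlgOf EG K) : τ η = -η := by
  have h1 := hτ.eq_iff.2 hη
  rw [conj_I_smul, ← smul_neg] at h1
  exact neg_eq_iff_eq_neg.1 (smul_right_injective EG Complex.I_ne_zero h1)

theorem IsMaximalTorus.adEnd_eq_zero_of_I_smul (hT : IsMaximalTorus K T) {a b : EG}
    (ha : Complex.I • a ∈ lieAlgOf EG T) (hb : Complex.I • b ∈ lieAlgOf EG T) :
    adEnd EG G a b = 0 := by
  have h3 := hT.adEnd_eq_zero ha hb
  rwa [map_smul, map_smul, smul_apply, smul_smul, Complex.I_mul_I, neg_one_smul,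
    neg_eq_zero] at h3

/-- The `-1`-eigenspace of `σ_K` is orthogonal to `𝔨`. -/
theorem IsQuotProj.eq_self_of_conj_eq_neg (hP : IsQuotProj τ L P)
    (hτ : IsCompactConjugation (EG := EG) K τ) (hK : IsCompact (K : Set G)) (hLK : L ≤ K)
    {v : EG} (hv : τ v = -v) : P v = v := by
  refine hP.eq_self hτ hK fun w hw => ?_
  have h1 := hτ.metric_map hK v w
  rw [hv, hτ.eq_iff.2 (lieAlgOf_mono hLK hw), map_neg, neg_apply] at h1
  linarith

/-- The derivative of `exp (- ad η / 2) φ` for a function `η` with values in `i 𝔱`. -/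
theorem fderiv_exp_neg_half (hT : IsMaximalTorus K T)
    (hτ : IsCompactConjugation (EG := EG) K τ) (hK : IsCompact (K : Set G))
    {η φ : F → EG} {z : F} (hη : DifferentiableAt ℝ η z)
    (hηT : ∀ᶠ w in 𝓝 z, Complex.I • η w ∈ lieAlgOf EG T) (hφ : DifferentiableAt ℝ φ z) :
    ∃ A : F →L[ℝ] EG,
      HasFDerivAt (fun w => AdEnd EG (expLie ((-1 / 2 : ℝ) • η w) : G) (φ w)) A z ∧
      ∀ v, A v = -((1 / 2 : ℂ) • adEnd EG G (fderiv ℝ η z v)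
        (AdEnd EG (expLie ((-1 / 2 : ℝ) • η z) : G) (φ z))) +
        AdEnd EG (expLie ((-1 / 2 : ℝ) • η z) : G) (fderiv ℝ φ z v) := by
  have hξ : DifferentiableAt ℝ (fun w => (-1 / 2 : ℝ) • η w) z := hη.const_smul _
  have hreal : ∀ (r : ℝ) (a : EG), adEnd EG G (r • a) = r • adEnd EG G a := fun r a =>
    LinearMap.map_smul_of_tower _ r a
  have hcomm : ∀ᶠ w in 𝓝 z, adEnd EG G ((-1 / 2 : ℝ) • η z) ((-1 / 2 : ℝ) • η w) = 0 := by
    filter_upwards [hηT] with w hw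
    rw [hreal, smul_apply, (adEnd EG G (η z)).map_smul_of_tower,
      hT.adEnd_eq_zero_of_I_smul hηT.self_of_nhds hw, smul_zero, smul_zero]
  obtain ⟨S, h1, h2⟩ := hasFDerivAt_AdEnd_mcForm (G := G) (mdifferentiableAt_expLie_comp hξ)
  have h3 : HasFDerivAt (fun w => (AdEnd EG (expLie ((-1 / 2 : ℝ) • η w) : G)).restrictScalars ℝ)
      ((ContinuousLinearMap.restrictScalarsL ℂ EG EG ℝ ℝ).comp S) z :=
    HasFDerivAt.comp z (g := ContinuousLinearMap.restrictScalarsL ℂ EG EG ℝ ℝ)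
      (ContinuousLinearMap.hasFDerivAt _) h1
  refine ⟨_, h3.clm_apply hφ.hasFDerivAt, fun v => ?_⟩
  change AdEnd EG (expLie ((-1 / 2 : ℝ) • η z) : G) (fderiv ℝ φ z v) + S v (φ z) = _
  rw [h2, mcForm_expLie hξ hcomm, add_comm]
  congr 1
  have h4 : fderiv ℝ (fun w => (-1 / 2 : ℝ) • η w) z v = (-1 / 2 : ℝ) • fderiv ℝ η z v :=
    congrArg (fun A : F →L[ℝ] EG => A v) (hη.hasFDerivAt.const_smul (-1 / 2 : ℝ)).fderiv
  change AdEnd EG (expLie ((-1 / 2 : ℝ) • η z) : G)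
    (adEnd EG G (fderiv ℝ (fun w => (-1 / 2 : ℝ) • η w) z v) (φ z)) = _
  have h5 : adEnd EG G ((-1 / 2 : ℝ) • η z) (fderiv ℝ η z v) = 0 := by
    rw [hreal, smul_apply, hT.adEnd_eq_zero_of_I_smul hηT.self_of_nhds
      (I_smul_fderiv_mem hT hτ hK hη hηT v), smul_zero]
  rw [h4, hreal, smul_apply, (AdEnd EG _).map_smul_of_tower, AdEnd_adEnd,
    AdEnd_expLie_apply_of_eq_zero h5, ← Complex.coe_smul]
  push_cast
  rw [← neg_smul, neg_div]

/-- The tension field of a lift with Maurer-Cartan form `A + (φ - σ_K φ)` vanishes, where `φ` is a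
holomorphic `(1,0)`-form conjugated by `exp (- η / 2)` and `A(v) = (i/2) dη(i v)`. -/
theorem tension_add_tension_eq_zero (hT : IsMaximalTorus K T)
    (hτ : IsCompactConjugation (EG := EG) K τ) (hK : IsCompact (K : Set G)) (hTL : T ≤ L)
    (hLK : L ≤ K) (hP : IsQuotProj τ L P) {η φ : ℂ → EG} {g : ℂ → G} {z : ℂ}
    (hη : ∀ᶠ w in 𝓝 z, DifferentiableAt ℝ η w)
    (hηT : ∀ᶠ w in 𝓝 z, Complex.I • η w ∈ lieAlgOf EG T) (hφ : DifferentiableAt ℂ φ z)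
    (hg : ∀ᶠ w in 𝓝 z, ∀ v : ℂ, mcForm EG g w v =
      (Complex.I / 2) • fderiv ℝ η w (Complex.I * v) +
        (v • AdEnd EG (expLie ((-1 / 2 : ℝ) • η w) : G) (φ w) -
          τ (v • AdEnd EG (expLie ((-1 / 2 : ℝ) • η w) : G) (φ w)))) :
    tension τ P g 1 z + tension τ P g Complex.I z = 0 := by
  have hη0 := hη.self_of_nhds
  obtain ⟨A, hA, hAv⟩ := fderiv_exp_neg_half hT hτ hK hη0 hηT (hφ.restrictScalars ℝ)
  set φ' : ℂ → EG := fun w => AdEnd EG (expLie ((-1 / 2 : ℝ) • η w) : G) (φ w) with hφ'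
  have hAT : ∀ᶠ w in 𝓝 z, ∀ v : ℂ,
      (Complex.I / 2) • fderiv ℝ η w (Complex.I * v) ∈ lieAlgOf EG T := by
    filter_upwards [hη, hηT.eventually_nhds] with w hw1 hw2 v
    have h1 := I_smul_fderiv_mem hT hτ hK hw1 hw2 (Complex.I * v)
    have h2 : (Complex.I / 2) • fderiv ℝ η w (Complex.I * v) =
        (1 / 2 : ℝ) • Complex.I • fderiv ℝ η w (Complex.I * v) := by
      rw [← Complex.coe_smul, smul_smul]
      congr 1
      push_cast
      ring
    rw [h2]
    exact (lieSubspace (EG := EG) T hT.isClosed).smul_mem _ h1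
  have hψ : ∀ (x : EG), τ (x - τ x) = -(x - τ x) := fun x => by
    rw [map_sub, hτ.invol, neg_sub]
  have hPmc : ∀ a : ℂ, ∀ᶠ w in 𝓝 z, P (mcForm EG g w a) = a • φ' w - τ (a • φ' w) := by
    intro a
    filter_upwards [hg, hAT] with w hw1 hw2
    rw [hw1, map_add, hP.apply_eq_zero _ (lieAlgOf_mono hTL (hw2 a)), zero_add,
      hP.eq_self_of_conj_eq_neg hτ hK hLK (hψ _)]
  -- the normal part of `g⁻¹ dg` is `φ - σ_K φ`, its part in `𝔱` is `(i/2) dη(i ·)`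
  have hten : ∀ a : ℂ, tension τ P g a z = (a • A a - τ (a • A a)) +
      adEnd EG G ((Complex.I / 2) • fderiv ℝ η z (Complex.I * a)) (a • φ' z - τ (a • φ' z)) := by
    intro a
    have h1 : HasFDerivAt (fun w => a • φ' w - τ (a • φ' w))
        (a • A - (conjCLM τ).comp (a • A)) z :=
      (hA.const_smul a).sub ((conjCLM τ).hasFDerivAt.comp z (hA.const_smul a))
    have h2 : fderiv ℝ (fun w => P (mcForm EG g w a)) z a = a • A a - τ (a • A a) := by
      rw [Filter.EventuallyEq.fderiv_eq (hPmc a), h1.fderiv]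
      rfl
    have h3 : τ (mcForm EG g z a) = (Complex.I / 2) • fderiv ℝ η z (Complex.I * a) -
        (a • φ' z - τ (a • φ' z)) := by
      rw [hg.self_of_nhds, map_add, hψ,
        hτ.eq_iff.2 (lieAlgOf_mono hT.1.1 (hAT.self_of_nhds a)), ← sub_eq_add_neg]
    have h4 : ∀ x : EG, adEnd EG G x x = 0 := fun x => by
      rw [adEnd_apply]
      exact lie_self (L := LieAlg EG G) x
    have h5 : ∀ x y : EG, adEnd EG G (x - y) y = adEnd EG G x y := fun x y => by
      rw [map_sub, sub_apply, h4, sub_zero]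
    rw [tension, h2, (hPmc a).self_of_nhds, h3, h5]
  rw [hten, hten, Complex.I_mul_I, mul_one, map_neg]
  have hφI : fderiv ℝ φ z Complex.I = Complex.I • fderiv ℝ φ z 1 := by
    have h1 := hφ.hasFDerivAt.restrictScalars ℝ
    rw [h1.fderiv]
    change fderiv ℂ φ z Complex.I = Complex.I • fderiv ℂ φ z 1
    rw [← map_smul, smul_eq_mul, mul_one]
  have hτη : ∀ v, τ (fderiv ℝ η z v) = -fderiv ℝ η z v := fun v =>
    hτ.eq_neg_of_I_smul_mem (lieAlgOf_mono hT.1.1 (I_smul_fderiv_mem hT hτ hK hη0 hηT v))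
  rw [hAv, hAv, hφI]
  change (1 : ℂ) • (-((1 / 2 : ℂ) • adEnd EG G (fderiv ℝ η z 1) (φ' z)) + _) - _ + _ +
    (Complex.I • (-((1 / 2 : ℂ) • adEnd EG G (fderiv ℝ η z Complex.I) (φ' z)) + _) - _ + _) = 0
  have hhalf : ∀ x : EG, τ ((1 / 2 : ℂ) • x) = (1 / 2 : ℂ) • τ x := by
    intro x
    rw [τ.map_smulₛₗ]
    rw [map_div₀, map_one, Complex.conj_ofNat]
  -- the derivatives of `φ` cancel as `φ` is holomorphic; the terms `[dη, φ]` cancel against those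
  -- from the part of `g⁻¹ dg` in `𝔱`
  simp only [one_smul, map_add, map_neg, hhalf, conj_I_smul, hτ.adEnd_map, hτη, map_sub,
    map_smul, smul_apply, neg_apply]
  match_scalars <;> ring_nf <;> simp

end Tension

end HiggsBundle

namespace HiggsBundle

/-! ### The logarithm of the involution on the subbundle -/

section SmoothLog

variable {EG : Type*} [NormedAddCommGroup EG] [NormedSpace ℂ EG]
  {G : Type*} [TopologicalSpace G] [ChartedSpace EG G] [Group G] [LieGroup 𝓘(ℂ, EG) ω G]
  [CompleteSpace EG] [T2Space G] [FiniteDimensional ℂ EG]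
  [LieAlgebra.IsSemisimple ℂ (LieAlg EG G)]
  {K T : Subgroup G} {τ : EG →ₛₗ[starRingEnd ℂ] EG}
  {EP : Type*} [NormedAddCommGroup EP] [NormedSpace ℂ EP]
  {P : Type*} [TopologicalSpace P] [ChartedSpace EP P] [MulAction Gᵐᵒᵖ P]
  {σ : P → EG →ₛₗ[starRingEnd ℂ] EG}

/-- `σ_K` inverts the positive transformations `exp (ad η)`, `η ∈ i 𝔱`. -/
theorem IsMaximalTorus.conj_AdEnd_expLie (hT : IsMaximalTorus K T)
    (hτ : IsCompactConjugation (EG := EG) K τ) (hK : IsCompact (K : Set G)) {η : EG}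
    (hη : Complex.I • η ∈ lieAlgOf EG T) (t : ℝ) (v : EG) :
    τ (AdEnd EG (expLie (t • η) : G) v) = AdEnd EG (expLie ((-t) • η) : G) (τ v) := by
  obtain ⟨n, b, hb⟩ := hT.exists_joint_eigenbasis hτ hK
  have hτη : τ η = -η := hτ.eq_neg_of_I_smul_mem (lieAlgOf_mono hT.1.1 hη)
  have key : τ.comp (AdEnd EG (expLie (t • η) : G) : EG →ₗ[ℂ] EG) =
      (AdEnd EG (expLie ((-t) • η) : G) : EG →ₗ[ℂ] EG).comp τ := by
    refine b.ext fun k => ?_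
    change τ (AdEnd EG (expLie (t • η) : G) (b k)) = AdEnd EG (expLie ((-t) • η) : G) (τ (b k))
    obtain ⟨μ, hμ⟩ := hb η hη k
    have h1 : adEnd EG G η (τ (b k)) = ((-μ : ℝ) : ℂ) • τ (b k) := by
      have h2 := hτ.adEnd_map η (b k)
      rw [hμ, hτη, map_neg, neg_apply, map_smulₛₗ, Complex.conj_ofReal] at h2
      rw [Complex.ofReal_neg, neg_smul, h2, neg_neg]
    rw [AdEnd_expLie_smul, AdEnd_expLie_smul, exp_smul_apply_of_eigenvector hμ,
      exp_smul_apply_of_eigenvector h1, map_smulₛₗ, ← Complex.exp_conj]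
    simp
  exact congrArg (fun f : EG →ₛₗ[starRingEnd ℂ] EG => f v) key

/-- If `σ` corresponds to `exp (ad η) σ_K` at `p`, then it corresponds to `σ_K` at
`p · exp (η / 2)`. -/
theorem action_expLie_mem_compactSubbundle (hT : IsMaximalTorus K T)
    (hτ : IsCompactConjugation (EG := EG) K τ) (hK : IsCompact (K : Set G))
    (hσ : IsAdjointInvolution EG (G := G) EP τ σ) {p : P} {η : EG}
    (hη : Complex.I • η ∈ lieAlgOf EG T)
    (h : ∀ v, σ p (τ v) = NormedSpace.exp (adEnd EG G η) v) :
    p <• (expLie ((1 / 2 : ℝ) • η) : G) ∈ compactSubbundle EG (G := G) τ σ := by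
  refine LinearMap.ext fun (v : EG) => ?_
  refine (hσ.equivariant p _ v).trans ?_
  change AdEnd EG (expLie ((1 / 2 : ℝ) • η) : G)⁻¹
    (σ p (AdEnd EG (expLie ((1 / 2 : ℝ) • η) : G) v)) = τ v
  have h1 : AdEnd EG (expLie ((1 / 2 : ℝ) • η) : G) v =
      τ (AdEnd EG (expLie ((-(1 / 2) : ℝ) • η) : G) (τ v)) := by
    rw [hT.conj_AdEnd_expLie hτ hK hη, neg_neg, hτ.invol]
  have h2 : NormedSpace.exp (adEnd EG G η) = AdEnd EG (expLie ((1 : ℝ) • η) : G) := by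
    rw [AdEnd_expLie_smul, one_smul]
  have h3 : (expLie ((1 / 2 : ℝ) • η) : G)⁻¹ = expLie ((-(1 / 2) : ℝ) • η) := by
    rw [neg_smul, expLie_neg]
  have h4 : ∀ (g g' : G) (x : EG), AdEnd EG g (AdEnd EG g' x) = AdEnd EG (g * g') x := fun g g' x => by
    rw [AdEnd_mul]
    rfl
  rw [h1, h, h2, h3, h4, h4, ← expLie_add_smul, ← expLie_add_smul]
  norm_num [expLie_zero, AdEnd_one]

/-- The logarithm `η ∈ i 𝔱` of `σ σ_K`, where it exists, depends smoothly on the point. -/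
theorem exists_contMDiffAt_log (hT : IsMaximalTorus K T)
    (hτ : IsCompactConjugation (EG := EG) K τ) (hK : IsCompact (K : Set G))
    (hσ : IsAdjointInvolution EG (G := G) EP τ σ) :
    ∃ η : P → EG, ∀ p, (∃ ζ : EG, Complex.I • ζ ∈ lieAlgOf EG T ∧
        ∀ v, σ p (τ v) = NormedSpace.exp (adEnd EG G ζ) v) →
      ContMDiffAt 𝓘(ℝ, EP) 𝓘(ℝ, EG) ∞ η p ∧ Complex.I • η p ∈ lieAlgOf EG T ∧
        ∀ v, σ p (τ v) = NormedSpace.exp (adEnd EG G (η p)) v := by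
  obtain ⟨n, b, hb⟩ := hT.exists_joint_eigenbasis hτ hK
  obtain ⟨R, hR⟩ := exists_leftInverse_adEnd EG G
  -- `σ σ_K` is diagonal in a basis that does not depend on the point, and `η` is obtained from the
  -- logarithms of its diagonal entries
  let E : Fin n → EG →L[ℂ] EG := fun k =>
    LinearMap.toContinuousLinearMap ((b.coord k).smulRight (b k))
  let c : Fin n → EG →L[ℂ] ℂ := fun k => LinearMap.toContinuousLinearMap (b.coord k)
  let L : (Fin n → ℝ) → EG := fun y => R (∑ k, Real.log (y k) • E k)
  let d : P → Fin n → ℝ := fun p k => (c k (σ p (τ (b k)))).re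
  refine ⟨fun p => L (d p), fun p ⟨ζ, hζ, h⟩ => ?_⟩
  choose μ hμ using hb ζ hζ
  have h1 : ∀ k, σ p (τ (b k)) = (Real.exp (μ k) : ℂ) • b k := by
    intro k
    have h2 := exp_smul_apply_of_eigenvector (hμ k) 1
    rw [one_smul, ← h] at h2
    rw [h2]
    simp
  have hd : ∀ k, d p k = Real.exp (μ k) := by
    intro k
    change (b.coord k (σ p (τ (b k)))).re = _
    rw [h1, map_smul, Module.Basis.coord_apply, Module.Basis.repr_self, Finsupp.single_eq_same,
      smul_eq_mul, mul_one, Complex.ofReal_re]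
  have hL : L (d p) = ζ := by
    have h2 : ∑ k, Real.log (d p k) • E k = adEnd EG G ζ := by
      refine ContinuousLinearMap.coe_injective (b.ext fun j => ?_)
      change (∑ k, Real.log (d p k) • E k) (b j) = adEnd EG G ζ (b j)
      rw [hμ, sum_apply, Finset.sum_eq_single j]
      · rw [hd, Real.log_exp]
        change μ j • (b.coord j (b j)) • b j = _
        rw [Module.Basis.coord_apply, Module.Basis.repr_self, Finsupp.single_eq_same, one_smul,
          Complex.coe_smul]
      · intro k _ hk
        change Real.log (d p k) • (b.coord k (b j)) • b k = _
        rw [Module.Basis.coord_apply, Module.Basis.repr_self, Finsupp.single_eq_of_ne hk, zero_smul,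
          smul_zero]
      · simp
    change R _ = _
    rw [h2, hR]
  suffices hsm : ContMDiffAt 𝓘(ℝ, EP) 𝓘(ℝ, EG) ∞ (fun p => L (d p)) p by
    refine ⟨hsm, ?_⟩
    change Complex.I • L (d p) ∈ lieAlgOf EG T ∧
      ∀ v, σ p (τ v) = NormedSpace.exp (adEnd EG G (L (d p))) v
    rw [hL]
    exact ⟨hζ, h⟩
  have hLs : ContDiffAt ℝ ∞ L (d p) := by
    refine R.contDiff.contDiffAt.comp _ (ContDiffAt.sum fun k _ => ?_)
    refine ContDiffAt.smul (f := fun y : Fin n → ℝ => Real.log (y k)) (g := fun _ => E k) ?_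
      contDiffAt_const
    refine ContDiffAt.log (contDiff_apply ℝ ℝ k).contDiffAt ?_
    rw [hd]
    exact (Real.exp_pos _).ne'
  have hds : ContMDiffAt 𝓘(ℝ, EP) 𝓘(ℝ, Fin n → ℝ) ∞ d p := by
    refine contMDiffAt_pi_space.2 fun k => ?_
    let r : EG →L[ℝ] ℝ := Complex.reCLM.comp ((c k).restrictScalars ℝ)
    exact ContMDiffAt.comp p (g := r) r.contDiff.contMDiff.contMDiffAt
      (hσ.smooth (τ (b k))).contMDiffAt
  exact hLs.comp_contMDiffAt hds

end SmoothLog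

end HiggsBundle

namespace HiggsBundle

/-! ### Pullbacks of equivariant forms -/

section PullForm

variable {EG : Type*} [NormedAddCommGroup EG] [NormedSpace ℂ EG]
  {G : Type*} [TopologicalSpace G] [ChartedSpace EG G] [Group G] [LieGroup 𝓘(ℂ, EG) ω G]
  [CompleteSpace EG] [T2Space G] [FiniteDimensional ℂ EG]
  [LieAlgebra.IsSemisimple ℂ (LieAlg EG G)]
  {EX : Type*} [NormedAddCommGroup EX] [NormedSpace ℂ EX]
  {X : Type*} [TopologicalSpace X] [ChartedSpace EX X]
  {EP : Type*} [NormedAddCommGroup EP] [NormedSpace ℂ EP]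
  {P : Type*} [TopologicalSpace P] [ChartedSpace EP P] [MulAction Gᵐᵒᵖ P]
  {F : Type*} [NormedAddCommGroup F] [NormedSpace ℝ F]
  {τ : EG →ₛₗ[starRingEnd ℂ] EG} {σ : P → EG →ₛₗ[starRingEnd ℂ] EG}
  {proj : P → X} {θ Φ η : LieForm EG EP G P}

/-- The value at `p` of a form on `P`, as a linear map between the model spaces. -/
def formAt (η : LieForm EG EP G P) (p : P) : EP →ₗ[ℝ] EG := η p

theorem formAt_congr (η : LieForm EG EP G P) {p p' : P} (h : p = p') (a : EP) :
    formAt η p a = formAt η p' a := by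
  rw [h]

/-- The pullback of a form on `P` by a map from a vector space. -/
noncomputable def pullForm (η : LieForm EG EP G P) (u : F → P) (z : F) : F →ₗ[ℝ] EG :=
  (formAt η (u z)).comp (M₂ := EP)
    (ContinuousLinearMap.toLinearMap (M := F) (M₂ := EP) (mfderiv 𝓘(ℝ, F) 𝓘(ℝ, EP) u z))

theorem pullForm_eq (η : LieForm EG EP G P) {u : F → P} {z : F} {A : F →L[ℝ] EP}
    (hA : HasMFDerivAt 𝓘(ℝ, F) 𝓘(ℝ, EP) u z A) (v : F) :
    pullForm η u z v = formAt η (u z) (A v) := by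
  change formAt η (u z) ((mfderiv 𝓘(ℝ, F) 𝓘(ℝ, EP) u z : F →L[ℝ] EP) v) = _
  rw [hA.mfderiv]
  rfl

theorem pullForm_congr (η : LieForm EG EP G P) {u u' : F → P} {z : F} (h : u =ᶠ[𝓝 z] u') (v : F) :
    pullForm η u z v = pullForm η u' z v := by
  have h1 : (mfderiv 𝓘(ℝ, F) 𝓘(ℝ, EP) u z : F →L[ℝ] EP) = mfderiv 𝓘(ℝ, F) 𝓘(ℝ, EP) u' z :=
    h.mfderiv_eq
  change formAt η (u z) ((mfderiv 𝓘(ℝ, F) 𝓘(ℝ, EP) u z : F →L[ℝ] EP) v) =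
    formAt η (u' z) ((mfderiv 𝓘(ℝ, F) 𝓘(ℝ, EP) u' z : F →L[ℝ] EP) v)
  rw [h1]
  exact formAt_congr η h.self_of_nhds _

/-- The form takes the value `c ξ` on the fundamental vector field of `ξ`. -/
def HasVerticalValue (η : LieForm EG EP G P) (c : ℝ) : Prop :=
  ∀ (p : P) (ξ : EG) (B : EG →L[ℝ] EP),
    HasMFDerivAt 𝓘(ℝ, EG) 𝓘(ℝ, EP) (fun g : G => p <• g) 1 B → formAt η p (B ξ) = c • ξ

/-- It suffices to evaluate the form at `p · 1`, where the differential of the orbit map takes its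
values. -/
theorem hasVerticalValue_of_action_one {c : ℝ}
    (h : ∀ (p : P) (ξ : EG) (B : EG →L[ℝ] EP),
      HasMFDerivAt 𝓘(ℝ, EG) 𝓘(ℝ, EP) (fun g : G => p <• g) 1 B →
        formAt η (p <• (1 : G)) (B ξ) = c • ξ) : HasVerticalValue η c := by
  intro p ξ B hB
  rw [← h p ξ B hB]
  exact formAt_congr η (by simp) _

theorem IsConnectionForm.hasVerticalValue (hθ : IsConnectionForm EG EP θ) :
    HasVerticalValue θ 1 := by
  refine hasVerticalValue_of_action_one fun p ξ B hB => ?_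
  rw [one_smul]
  refine Eq.trans ?_ (hθ.vertical p ξ)
  rw [hB.mfderiv]
  rfl

/-- A horizontal form vanishes on fundamental vector fields. -/
theorem HasVerticalValue.of_horizontal (hproj : ContMDiff 𝓘(ℂ, EP) 𝓘(ℂ, EX) ω proj)
    (hpa : ∀ (p : P) (g : G), proj (p <• g) = proj p)
    (hη : ∀ (p : P) (v : TangentSpace 𝓘(ℝ, EP) p),
      mfderiv 𝓘(ℝ, EP) 𝓘(ℝ, EX) proj p v = 0 → η p v = 0) : HasVerticalValue η 0 := by
  refine hasVerticalValue_of_action_one fun p ξ B hB => ?_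
  rw [zero_smul]
  refine hη (p <• (1 : G)) (B ξ : EP) ?_
  have h1 := ((hproj.real_of_complex.mdifferentiableAt (x := p <• (1 : G))
    (by simp)).hasMFDerivAt).comp (1 : G) hB
  have h2 : (proj ∘ fun g : G => p <• g) = fun _ => proj p := funext fun g => hpa p g
  rw [h2] at h1
  exact congrArg (fun A : EG →L[ℝ] EX => A ξ)
    (h1.mfderiv.symm.trans (hasMFDerivAt_const (I := 𝓘(ℝ, EG)) (I' := 𝓘(ℝ, EX)) (proj p) (1 : G)).mfderiv)

/-- The differential of `r · k`, split into the differential of `r` moved by `k` and the fundamental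
vector field of the Maurer-Cartan form of `k`. -/
theorem hasMFDerivAt_action (hact : ContMDiff (𝓘(ℂ, EP).prod 𝓘(ℂ, EG)) 𝓘(ℂ, EP) ω
      (fun q : P × G => q.1 <• q.2)) {r : F → P} {k : F → G} {z : F}
    (hr : MDifferentiableAt 𝓘(ℝ, F) 𝓘(ℝ, EP) r z) (hk : MDifferentiableAt 𝓘(ℝ, F) 𝓘(ℝ, EG) k z) :
    ∃ (A : EP →L[ℝ] EP) (B : EG →L[ℝ] EP) (C : F →L[ℝ] EP),
      HasMFDerivAt 𝓘(ℝ, EP) 𝓘(ℝ, EP) (fun q : P => q <• k z) (r z) A ∧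
      HasMFDerivAt 𝓘(ℝ, EG) 𝓘(ℝ, EP) (fun g : G => (r z <• k z) <• g) 1 B ∧
      HasMFDerivAt 𝓘(ℝ, F) 𝓘(ℝ, EP) (fun w => r w <• k w) z C ∧
      ∀ v, C v = A ((mfderiv 𝓘(ℝ, F) 𝓘(ℝ, EP) r z : F →L[ℝ] EP) v) + B (mcForm EG k z v) := by
  have hG : LieGroup 𝓘(ℝ, EG) ω G := LieGroup.real_of_complex ω
  have ha : MDifferentiable (𝓘(ℝ, EP).prod 𝓘(ℝ, EG)) 𝓘(ℝ, EP) (fun q : P × G => q.1 <• q.2) :=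
    hact.real_of_complex_prod.mdifferentiable (by simp)
  have hA : MDifferentiable 𝓘(ℝ, EP) 𝓘(ℝ, EP) (fun q : P => q <• k z) := fun q =>
    MDifferentiableAt.comp (g := fun q : P × G => q.1 <• q.2) (f := fun q : P => (q, k z)) q
      (ha (q, k z)) (mdifferentiableAt_id.prodMk mdifferentiableAt_const)
  have hB : ∀ p : P, MDifferentiable 𝓘(ℝ, EG) 𝓘(ℝ, EP) (fun g : G => p <• g) := fun p g =>
    MDifferentiableAt.comp (g := fun q : P × G => q.1 <• q.2) (f := fun g : G => (p, g)) g
      (ha (p, g)) (mdifferentiableAt_const.prodMk mdifferentiableAt_id)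
  have hl : HasMFDerivAt 𝓘(ℝ, F) 𝓘(ℝ, EG) (fun w => (k z)⁻¹ * k w) z
      (mcForm EG (F := F) k z) :=
    (mdifferentiableAt_mul mdifferentiableAt_const hk).hasMFDerivAt
  have hC : HasMFDerivAt 𝓘(ℝ, F) 𝓘(ℝ, EP) (fun w => r w <• k w) z
      ((mfderiv (𝓘(ℝ, EP).prod 𝓘(ℝ, EG)) 𝓘(ℝ, EP) (fun q : P × G => q.1 <• q.2) (r z, k z) :
        EP × EG →L[ℝ] EP).comp ((mfderiv 𝓘(ℝ, F) 𝓘(ℝ, EP) r z : F →L[ℝ] EP).prod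
          (mfderiv 𝓘(ℝ, F) 𝓘(ℝ, EG) k z : F →L[ℝ] EG))) :=
    ((ha (r z, k z)).hasMFDerivAt).comp z (hr.hasMFDerivAt.prodMk hk.hasMFDerivAt)
  let B : EG →L[ℝ] EP := mfderiv 𝓘(ℝ, EG) 𝓘(ℝ, EP) (fun g : G => (r z <• k z) <• g) 1
  have hB1 : HasMFDerivAt 𝓘(ℝ, EG) 𝓘(ℝ, EP) (fun g : G => (r z <• k z) <• g) 1 B :=
    (hB _ _).hasMFDerivAt
  refine ⟨mfderiv 𝓘(ℝ, EP) 𝓘(ℝ, EP) (fun q : P => q <• k z) (r z), B, _, (hA _).hasMFDerivAt, hB1,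
    hC, fun v => ?_⟩
  refine (mfderiv_prod_eq_add_apply (ha (r z, k z))).trans ?_
  refine congrArg₂ (HAdd.hAdd (α := EP) (β := EP) (γ := EP)) rfl ?_
  -- `r z · k w = (r z · k z) · ((k z)⁻¹ k w)`, where the second factor is near `1`
  have h1 : ∀ x : G, x = 1 →
      HasMFDerivAt 𝓘(ℝ, EG) 𝓘(ℝ, EP) (fun g : G => (r z <• k z) <• g) x B := by
    rintro _ rfl
    exact hB1
  have h2 := (h1 ((k z)⁻¹ * k z) (by simp)).comp z hl
  have h3 := (hB (r z) (k z)).hasMFDerivAt.comp z hk.hasMFDerivAt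
  have h4 : ((fun g : G => (r z <• k z) <• g) ∘ fun w => (k z)⁻¹ * k w) =
      (fun g : G => r z <• g) ∘ k := by
    funext w
    simp [smul_smul]
  rw [h4] at h2
  exact congrArg (fun T : F →L[ℝ] EP => T v) (hasMFDerivAt_unique h3 h2)

/-- The product rule for the pullback of an equivariant form: a change of gauge by `k` acts by
`Ad(k⁻¹)` and adds a multiple of the Maurer-Cartan form of `k`. -/
theorem pullForm_action (hact : ContMDiff (𝓘(ℂ, EP).prod 𝓘(ℂ, EG)) 𝓘(ℂ, EP) ω
      (fun q : P × G => q.1 <• q.2)) (hη : IsEquivariantForm EG EP η) {c : ℝ}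
    (hc : HasVerticalValue η c) {r : F → P} {k : F → G} {z : F}
    (hr : MDifferentiableAt 𝓘(ℝ, F) 𝓘(ℝ, EP) r z) (hk : MDifferentiableAt 𝓘(ℝ, F) 𝓘(ℝ, EG) k z)
    (v : F) : pullForm η (fun w => r w <• k w) z v =
      AdEnd EG (k z)⁻¹ (pullForm η r z v) + c • mcForm EG k z v := by
  obtain ⟨A, B, C, hA, hB, hC, h⟩ := hasMFDerivAt_action hact hr hk
  rw [pullForm_eq η hC, h, map_add, hc _ _ B hB]
  congr 1
  refine Eq.trans ?_ (hη (r z) (k z) (mfderiv 𝓘(ℝ, F) 𝓘(ℝ, EP) r z v))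
  rw [hA.mfderiv]
  rfl

theorem formAt_harmonicConnection (p : P) (a : EP) :
    formAt (harmonicConnection EG (G := G) EP θ Φ σ) p a =
      formAt θ p a + formAt Φ p a - σ p (formAt Φ p a) := rfl

theorem pullForm_harmonicConnection (u : F → P) (z v : F) :
    pullForm (harmonicConnection EG (G := G) EP θ Φ σ) u z v =
      pullForm θ u z v + pullForm Φ u z v - σ (u z) (pullForm Φ u z v) := rfl

theorem isEquivariantForm_harmonicConnection (hθ : IsEquivariantForm EG EP θ)
    (hΦ : IsEquivariantForm EG EP Φ) (hσ : IsAdjointInvolution EG (G := G) EP τ σ) :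
    IsEquivariantForm EG EP (harmonicConnection EG (G := G) EP θ Φ σ) := by
  intro p g v
  change formAt θ (p <• g) _ + formAt Φ (p <• g) _ - σ (p <• g) (formAt Φ (p <• g) _) =
    AdEnd EG g⁻¹ (formAt θ p v + formAt Φ p v - σ p (formAt Φ p v))
  have h1 : formAt θ (p <• g) (mfderiv 𝓘(ℝ, EP) 𝓘(ℝ, EP) (fun q : P => q <• g) p v) =
    AdEnd EG g⁻¹ (formAt θ p v) := hθ p g v
  have h2 : formAt Φ (p <• g) (mfderiv 𝓘(ℝ, EP) 𝓘(ℝ, EP) (fun q : P => q <• g) p v) =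
    AdEnd EG g⁻¹ (formAt Φ p v) := hΦ p g v
  have h : ∀ x : EG, σ (p <• g) (AdEnd EG g⁻¹ x) = AdEnd EG g⁻¹ (σ p x) := by
    intro x
    refine (hσ.equivariant p g _).trans ?_
    change AdEnd EG g⁻¹ (σ p (AdEnd EG g (AdEnd EG g⁻¹ x))) = _
    rw [AdEnd_apply_inv]
  rw [map_sub, map_add, ← h, ← h1, ← h2]

theorem HasVerticalValue.harmonicConnection (hθ : HasVerticalValue θ 1)
    (hΦ : HasVerticalValue Φ 0) :
    HasVerticalValue (harmonicConnection EG (G := G) EP θ Φ σ) 1 := by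
  intro p ξ B hB
  rw [formAt_harmonicConnection, hθ p ξ B hB, hΦ p ξ B hB, zero_smul, map_zero, add_zero, sub_zero]

end PullForm

end HiggsBundle

namespace HiggsBundle

/-! ### Harmonic bundles along holomorphic curves -/

section Curves

variable {EG : Type*} [NormedAddCommGroup EG] [NormedSpace ℂ EG]
  {G : Type*} [TopologicalSpace G] [ChartedSpace EG G] [Group G] [LieGroup 𝓘(ℂ, EG) ω G]
  [CompleteSpace EG] [T2Space G] [FiniteDimensional ℂ EG]
  [LieAlgebra.IsSemisimple ℂ (LieAlg EG G)]
  {EX : Type*} [NormedAddCommGroup EX] [NormedSpace ℂ EX]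
  {X : Type*} [TopologicalSpace X] [ChartedSpace EX X]
  {EP : Type*} [NormedAddCommGroup EP] [NormedSpace ℂ EP]
  {P : Type*} [TopologicalSpace P] [ChartedSpace EP P] [MulAction Gᵐᵒᵖ P]
  {F : Type*} [NormedAddCommGroup F] [NormedSpace ℝ F]
  {F' : Type*} [NormedAddCommGroup F'] [NormedSpace ℝ F']
  {K T : Subgroup G} {τ : EG →ₛₗ[starRingEnd ℂ] EG} {σ : P → EG →ₛₗ[starRingEnd ℂ] EG}
  {proj : P → X} {θ Φ η : LieForm EG EP G P}

theorem pullForm_comp (η : LieForm EG EP G P) {u : F → P} {φ : F' → F} {φ' : F' →L[ℝ] F} {z : F'}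
    (hφ : HasFDerivAt φ φ' z) (hu : MDifferentiableAt 𝓘(ℝ, F) 𝓘(ℝ, EP) u (φ z)) (v : F') :
    pullForm η (fun w => u (φ w)) z v = pullForm η u (φ z) (φ' v) := by
  have h : HasMFDerivAt 𝓘(ℝ, F') 𝓘(ℝ, EP) (fun w => u (φ w)) z
      ((mfderiv 𝓘(ℝ, F) 𝓘(ℝ, EP) u (φ z) : F →L[ℝ] EP).comp φ') :=
    hu.hasMFDerivAt.comp z hφ.hasMFDerivAt
  exact pullForm_eq η h v

/-- The real differential of a holomorphic map is complex linear. -/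
theorem exists_hasMFDerivAt_restrictScalars {E M E' M' : Type*} [NormedAddCommGroup E]
    [NormedSpace ℂ E] [TopologicalSpace M] [ChartedSpace E M] [NormedAddCommGroup E']
    [NormedSpace ℂ E'] [TopologicalSpace M'] [ChartedSpace E' M'] {r : M → M'} {z : M}
    (hr : MDifferentiableAt 𝓘(ℂ, E) 𝓘(ℂ, E') r z) :
    ∃ A : E →L[ℂ] E', HasMFDerivAt 𝓘(ℝ, E) 𝓘(ℝ, E') r z (A.restrictScalars ℝ : E →L[ℝ] E') :=
  ⟨_, HasMFDerivAt.real_of_complex hr.hasMFDerivAt⟩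

theorem map_smul_of_map_I_smul {E E' : Type*} [AddCommGroup E] [Module ℂ E] [AddCommGroup E']
    [Module ℂ E'] (f : E →ₗ[ℝ] E') (h : ∀ v, f (Complex.I • v) = Complex.I • f v) (a : ℂ) (v : E) :
    f (a • v) = a • f v := by
  have h1 : ∀ (r : ℝ) (x : E), f ((r : ℂ) • x) = (r : ℂ) • f x := fun r x => by
    rw [Complex.coe_smul, Complex.coe_smul, map_smul]
  rw [← Complex.re_add_im a, add_smul, map_add, add_smul, mul_smul, mul_smul, h1, h1, h]

/-- The pullback of a holomorphic form by a holomorphic curve is complex linear. -/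
theorem pullForm_smul_of_holomorphic (hΦ : IsHolomorphicForm EG EP Φ) {r : ℂ → P} {z : ℂ}
    (hr : MDifferentiableAt 𝓘(ℂ, ℂ) 𝓘(ℂ, EP) r z) (v : ℂ) :
    pullForm Φ r z v = v • pullForm Φ r z 1 := by
  obtain ⟨A, hA⟩ := exists_hasMFDerivAt_restrictScalars hr
  rw [pullForm_eq Φ hA, pullForm_eq Φ hA]
  change formAt Φ (r z) (A v) = v • formAt Φ (r z) (A 1)
  rw [← map_smul_of_map_I_smul (formAt Φ (r z)) (hΦ.1 (r z)), ← map_smul, smul_eq_mul, mul_one]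

/-- The coefficient of the pullback of a holomorphic form by a holomorphic curve is
holomorphic. -/
theorem differentiableAt_pullForm [FiniteDimensional ℂ EP] [IsManifold 𝓘(ℂ, EP) ω P]
    (hΦ : IsHolomorphicForm EG EP Φ) {r : ℂ → P} {z : ℂ}
    (hr : ContMDiffAt 𝓘(ℂ, ℂ) 𝓘(ℂ, EP) ω r z) :
    DifferentiableAt ℂ (fun w => pullForm Φ r w 1) z := by
  have hP : IsManifold 𝓘(ℝ, EP) ω P := IsManifold.real_of_complex (E := EP) ω
  set φ := extChartAt 𝓘(ℂ, EP) (r z) with hφ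
  have hy : ContDiffAt ℂ ω (fun w => φ (r w)) z :=
    ((contMDiffAt_extChartAt (I := 𝓘(ℂ, EP)) (n := ω) (x := r z)).comp z hr).contDiffAt
  have hyz : φ (r z) ∈ φ.target := φ.map_source (mem_extChartAt_source (I := 𝓘(ℂ, EP)) (r z))
  have hsymm : ∀ y ∈ φ.target, MDifferentiableAt 𝓘(ℂ, EP) 𝓘(ℂ, EP) φ.symm y := fun y hy =>
    ((contMDiffOn_extChartAt_symm (I := 𝓘(ℂ, EP)) (n := ω) (r z)).contMDiffAt
      ((isOpen_extChartAt_target (I := 𝓘(ℂ, EP)) (r z)).mem_nhds hy)).mdifferentiableAt (by simp)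
  have hcoord : ∀ y ∈ φ.target, ∀ (a : ℂ) (v : EP),
      coordForm EG EP Φ (r z) (a • v) y = a • coordForm EG EP Φ (r z) v y := by
    intro y hy a v
    obtain ⟨A, hA⟩ := exists_hasMFDerivAt_restrictScalars (hsymm y hy)
    have h1 : ∀ v : EP, coordForm EG EP Φ (r z) v y = formAt Φ (φ.symm y) (A v) := by
      intro v
      have h2 : (mfderiv 𝓘(ℝ, EP) 𝓘(ℝ, EP) (extChartAt 𝓘(ℝ, EP) (r z)).symm y : EP →L[ℝ] EP) =
        A.restrictScalars ℝ := hA.mfderiv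
      exact congrArg (fun B : EP →L[ℝ] EP => formAt Φ (φ.symm y) (B v)) h2
    rw [h1, h1, map_smul, map_smul_of_map_I_smul (formAt Φ (φ.symm y)) (hΦ.1 (φ.symm y))]
  have hadd : ∀ y (u v : EP),
      coordForm EG EP Φ (r z) (u + v) y = coordForm EG EP Φ (r z) u y +
        coordForm EG EP Φ (r z) v y := by
    intro y u v
    exact ((formAt Φ ((extChartAt 𝓘(ℝ, EP) (r z)).symm y)).comp (M₂ := EP)
      (ContinuousLinearMap.toLinearMap (M := EP) (M₂ := EP)
        (mfderiv 𝓘(ℝ, EP) 𝓘(ℝ, EP) (extChartAt 𝓘(ℝ, EP) (r z)).symm y))).map_add u v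
  let b := Module.finBasis ℂ EP
  have hsum : ∀ y ∈ φ.target, ∀ v, coordForm EG EP Φ (r z) v y =
      ∑ k, b.repr v k • coordForm EG EP Φ (r z) (b k) y := by
    intro y hy v
    let f : EP →ₗ[ℂ] EG :=
      { toFun := fun v => coordForm EG EP Φ (r z) v y
        map_add' := hadd y
        map_smul' := hcoord y hy }
    have h1 := congrArg f (b.sum_repr v)
    rw [map_sum] at h1
    simp only [map_smul] at h1
    exact h1.symm
  -- in the chart, the pullback is the coordinate expression of the form at the velocity
  have hev : (fun w => pullForm Φ r w 1) =ᶠ[𝓝 z] fun w =>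
      ∑ k, b.repr (deriv (fun w => φ (r w)) w) k • coordForm EG EP Φ (r z) (b k) (φ (r w)) := by
    have h1 : ∀ᶠ w in 𝓝 z, r w ∈ φ.source :=
      hr.continuousAt.eventually (extChartAt_source_mem_nhds (I := 𝓘(ℂ, EP)) (r z))
    have h2 : ∀ᶠ w in 𝓝 z, DifferentiableAt ℂ (fun w => φ (r w)) w :=
      (hy.eventually (by simp)).mono fun w hw => hw.differentiableAt (by simp)
    filter_upwards [h1.eventually_nhds, h2] with w hw1 hw2
    have hws := hw1.self_of_nhds
    rw [← hsum _ (φ.map_source hws)]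
    have h3 : r =ᶠ[𝓝 w] fun x => φ.symm (φ (r x)) := hw1.mono fun x hx => (φ.left_inv hx).symm
    obtain ⟨A, hA⟩ := exists_hasMFDerivAt_restrictScalars (hsymm _ (φ.map_source hws))
    rw [pullForm_congr Φ h3]
    have h4 := pullForm_comp Φ (u := φ.symm) (φ := fun x => φ (r x))
      (hw2.hasFDerivAt.restrictScalars ℝ) hA.mdifferentiableAt 1
    rw [h4]
    rfl
  refine DifferentiableAt.congr_of_eventuallyEq ?_ hev
  have hdy : DifferentiableAt ℂ (deriv fun w => φ (r w)) z :=
    (hy.analyticAt.deriv).differentiableAt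
  refine DifferentiableAt.fun_sum fun k _ => DifferentiableAt.smul ?_ ?_
  · let l : EP →L[ℂ] ℂ := LinearMap.toContinuousLinearMap (b.coord k)
    exact l.differentiableAt.comp z hdy
  · have h5 : DifferentiableAt ℂ (coordForm EG EP Φ (r z) (b k)) (φ (r z)) :=
      (hΦ.2 (r z) (b k)).differentiableAt
        ((isOpen_extChartAt_target (I := 𝓘(ℂ, EP)) (r z)).mem_nhds hyz)
    exact DifferentiableAt.comp z h5 (hy.differentiableAt (by simp))

/-- Along holomorphic curves in the image of a holomorphic section, the Chern connection form is of
type `(1,0)`. -/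
theorem IsChernConnection.pullForm_I_mul
    (hθ : IsChernConnection EX EG EP proj K τ σ θ) {U : Set X} {p : X → P} (hU : IsOpen U)
    (hp : ContMDiffOn 𝓘(ℂ, EX) 𝓘(ℂ, EP) ω p U) (hpp : ∀ y ∈ U, proj (p y) = y) {y : ℂ → X} {z : ℂ}
    (hy : MDifferentiableAt 𝓘(ℂ, ℂ) 𝓘(ℂ, EX) y z) (hyU : y z ∈ U) (v : ℂ) :
    pullForm θ (fun w => p (y w)) z (Complex.I * v) =
      Complex.I • pullForm θ (fun w => p (y w)) z v := by
  obtain ⟨Y, hY⟩ := exists_hasMFDerivAt_restrictScalars hy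
  obtain ⟨A, hA⟩ := exists_hasMFDerivAt_restrictScalars
    ((hp.contMDiffAt (hU.mem_nhds hyU)).mdifferentiableAt (by simp))
  have hAY : HasMFDerivAt 𝓘(ℝ, ℂ) 𝓘(ℝ, EP) (fun w => p (y w)) z
      ((A.restrictScalars ℝ : EX →L[ℝ] EP).comp (Y.restrictScalars ℝ : ℂ →L[ℝ] EX)) :=
    HasMFDerivAt.comp z hA hY
  rw [pullForm_eq θ hAY, pullForm_eq θ hAY]
  change formAt θ (p (y z)) (A (Y (Complex.I * v))) = Complex.I • formAt θ (p (y z)) (A (Y v))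
  have h := hθ.type_one_zero U p hU hp hpp (y z) hyU (Y v)
  rw [hA.mfderiv] at h
  rw [← smul_eq_mul, map_smul]
  exact h

/-- Along maps into `P_K`, the Chern connection form takes values in `𝔨`. -/
theorem IsChernConnection.pullForm_mem
    (hθ : IsChernConnection EX EG EP proj K τ σ θ) {u : F → P} {z : F}
    (hu : ContMDiffAt 𝓘(ℝ, F) 𝓘(ℝ, EP) ∞ u z)
    (huK : ∀ᶠ w in 𝓝 z, u w ∈ compactSubbundle EG (G := G) τ σ) (v : F) :
    pullForm θ u z v ∈ lieAlgOf EG K := by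
  have h0 : z + (0 : ℝ) • v = z := by simp
  have hc : HasFDerivAt (fun t : ℝ => z + t • v) (ContinuousLinearMap.smulRight (1 : ℝ →L[ℝ] ℝ) v)
      0 := (((hasDerivAt_id (0 : ℝ)).smul_const v).const_add z).hasFDerivAt.congr_fderiv
        (by ext; simp)
  have hcs : ContMDiffAt 𝓘(ℝ, ℝ) 𝓘(ℝ, F) ∞ (fun t : ℝ => z + t • v) 0 :=
    (contDiff_const.add (contDiff_id.smul contDiff_const)).contMDiff.contMDiffAt
  have hu' : ContMDiffAt 𝓘(ℝ, F) 𝓘(ℝ, EP) ∞ u (z + (0 : ℝ) • v) := h0.symm ▸ hu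
  have hlim : Filter.Tendsto (fun t : ℝ => z + t • v) (𝓝 0) (𝓝 z) := by
    have := hc.continuousAt.tendsto
    rwa [h0] at this
  have h1 : pullForm θ (fun t : ℝ => u (z + t • v)) 0 1 ∈ lieAlgOf EG K :=
    hθ.compact_valued (fun t : ℝ => u (z + t • v)) (hu'.comp 0 hcs) (hlim.eventually huK)
  rw [pullForm_comp θ (u := u) hc (hu'.mdifferentiableAt (by simp)), h0] at h1
  simpa using h1

/-- The Maurer-Cartan form of the frame change `g` from a parallel frame `s` to the frame
`s · g = r · exp (η / 2)` in `P_K ∩ P_H`, along a holomorphic curve. -/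
theorem eventually_mcForm_eq (hT : IsMaximalTorus K T)
    (hτ : IsCompactConjugation (EG := EG) K τ) (hK : IsCompact (K : Set G))
    (hE : IsHarmonicBundle EX EG EP proj K τ Φ σ θ) {U : Set X} {p : X → P} (hU : IsOpen U)
    (hp : ContMDiffOn 𝓘(ℂ, EX) 𝓘(ℂ, EP) ω p U) (hpp : ∀ y ∈ U, proj (p y) = y)
    {y : ℂ → X} {η : ℂ → EG} {s : ℂ → P} {g : ℂ → G} {z : ℂ}
    (hyU : ∀ᶠ w in 𝓝 z, y w ∈ U) (hy : ∀ᶠ w in 𝓝 z, MDifferentiableAt 𝓘(ℂ, ℂ) 𝓘(ℂ, EX) y w)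
    (hη : ∀ᶠ w in 𝓝 z, DifferentiableAt ℝ η w)
    (hηT : ∀ᶠ w in 𝓝 z, Complex.I • η w ∈ lieAlgOf EG T)
    (hu : ∀ᶠ w in 𝓝 z, ContMDiffAt 𝓘(ℝ, ℂ) 𝓘(ℝ, EP) ∞ (fun w => s w <• g w) w)
    (huK : ∀ᶠ w in 𝓝 z, s w <• g w ∈ compactSubbundle EG (G := G) τ σ)
    (hs : ∀ᶠ w in 𝓝 z, MDifferentiableAt 𝓘(ℝ, ℂ) 𝓘(ℝ, EP) s w)
    (hg : ∀ᶠ w in 𝓝 z, MDifferentiableAt 𝓘(ℝ, ℂ) 𝓘(ℝ, EG) g w)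
    (hsp : ∀ᶠ w in 𝓝 z, ∀ v, pullForm (harmonicConnection EG (G := G) EP θ Φ σ) s w v = 0)
    (hsg : ∀ᶠ w in 𝓝 z, s w <• g w = p (y w) <• (expLie ((1 / 2 : ℝ) • η w) : G)) :
    ∀ᶠ w in 𝓝 z, ∀ v : ℂ, mcForm EG g w v =
      (Complex.I / 2) • fderiv ℝ η w (Complex.I * v) +
        (v • AdEnd EG (expLie ((-1 / 2 : ℝ) • η w) : G) (pullForm Φ (fun w => p (y w)) w 1) -
          τ (v • AdEnd EG (expLie ((-1 / 2 : ℝ) • η w) : G)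
            (pullForm Φ (fun w => p (y w)) w 1))) := by
  have hact := hE.principal.holomorphic_action
  have hθ := hE.chern.isConnection
  have hΦv : HasVerticalValue Φ 0 := HasVerticalValue.of_horizontal hE.principal.holomorphic_proj
    hE.principal.proj_action hE.higgs.horizontal
  filter_upwards [hyU, hy, hη, hηT.eventually_nhds, hu, huK.eventually_nhds, hs, hg, hsp,
    hsg.eventually_nhds] with w hyU hy hη hηT hu huK hs hg hsp hsg v
  have hr : MDifferentiableAt 𝓘(ℂ, ℂ) 𝓘(ℂ, EP) (fun w => p (y w)) w :=
    MDifferentiableAt.comp w ((hp.contMDiffAt (hU.mem_nhds hyU)).mdifferentiableAt (by simp)) hy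
  have hrR : MDifferentiableAt 𝓘(ℝ, ℂ) 𝓘(ℝ, EP) (fun w => p (y w)) w := by
    obtain ⟨A, hA⟩ := exists_hasMFDerivAt_restrictScalars hr
    exact hA.mdifferentiableAt
  have hreal : ∀ (r : ℝ) (a : EG), adEnd EG G (r • a) = r • adEnd EG G a := fun r a =>
    LinearMap.map_smul_of_tower _ r a
  have hξ : DifferentiableAt ℝ (fun w => (1 / 2 : ℝ) • η w) w := hη.const_smul _
  have hcomm : ∀ᶠ x in 𝓝 w, adEnd EG G ((1 / 2 : ℝ) • η w) ((1 / 2 : ℝ) • η x) = 0 := by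
    filter_upwards [hηT] with x hx
    rw [hreal, smul_apply, (adEnd EG G (η w)).map_smul_of_tower,
      hT.adEnd_eq_zero_of_I_smul hηT.self_of_nhds hx, smul_zero, smul_zero]
  have hmc : ∀ v, mcForm EG (fun w => (expLie ((1 / 2 : ℝ) • η w) : G)) w v =
      (1 / 2 : ℝ) • fderiv ℝ η w v := by
    intro v
    rw [mcForm_expLie hξ hcomm]
    exact congrArg (fun A : ℂ →L[ℝ] EG => A v) (hη.hasFDerivAt.const_smul (1 / 2 : ℝ)).fderiv
  have hinv : (expLie ((1 / 2 : ℝ) • η w) : G)⁻¹ = expLie ((-1 / 2 : ℝ) • η w) := by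
    rw [← expLie_neg, ← neg_smul, neg_div]
  have hrule : ∀ {ζ : LieForm EG EP G P} {c : ℝ}, IsEquivariantForm EG EP ζ →
      HasVerticalValue ζ c → ∀ v, pullForm ζ (fun w => s w <• g w) w v =
        AdEnd EG (expLie ((-1 / 2 : ℝ) • η w) : G) (pullForm ζ (fun w => p (y w)) w v) +
          c • (1 / 2 : ℝ) • fderiv ℝ η w v := by
    intro ζ c h1 h2 v
    rw [pullForm_congr ζ hsg, pullForm_action hact h1 h2 hrR (mdifferentiableAt_expLie_comp hξ),
      hmc, hinv]
  have hD := pullForm_action hact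
    (isEquivariantForm_harmonicConnection hθ.equivariant hE.higgs.equivariant hE.involution)
    (HasVerticalValue.harmonicConnection (σ := σ) hθ.hasVerticalValue hΦv) hs hg v
  rw [hsp, map_zero, zero_add, one_smul, pullForm_harmonicConnection] at hD
  have hστ : σ (s w <• g w) = τ := huK.self_of_nhds
  -- the `θ`-part is determined by its compatibility with both structures
  have hθv : pullForm θ (fun w => s w <• g w) w v =
      (Complex.I / 2) • fderiv ℝ η w (Complex.I * v) := by
    have hA : ∀ v, τ (pullForm θ (fun w => s w <• g w) w v) =
        pullForm θ (fun w => s w <• g w) w v := fun v =>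
      hτ.eq_iff.2 (hE.chern.pullForm_mem hu huK v)
    have hτη : ∀ v, τ (fderiv ℝ η w v) = -fderiv ℝ η w v := fun v =>
      hτ.eq_neg_of_I_smul_mem (lieAlgOf_mono hT.1.1 (I_smul_fderiv_mem hT hτ hK hη hηT v))
    have h1 := hrule hθ.equivariant hθ.hasVerticalValue v
    have h2 := hrule hθ.equivariant hθ.hasVerticalValue (Complex.I * v)
    rw [hE.chern.pullForm_I_mul hU hp hpp hy hyU, map_smul, one_smul] at h2
    rw [one_smul] at h1
    rw [← sub_eq_iff_eq_add] at h1
    rw [← h1] at h2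
    have h3 := congrArg τ h2
    rw [hA, map_add, conj_I_smul, map_sub, hA, conj_smul_real, conj_smul_real, hτη, hτη, h2] at h3
    generalize pullForm θ (fun w => s w <• g w) w v = A at h3 ⊢
    generalize fderiv ℝ η w v = B at h3 ⊢
    generalize fderiv ℝ η w (Complex.I * v) = C at h3 ⊢
    have h4 : (2 * Complex.I) • A + C = 0 := by
      rw [← sub_eq_zero] at h3
      rw [← h3, ← Complex.coe_smul, ← Complex.coe_smul, ← Complex.coe_smul, ← Complex.coe_smul]
      push_cast
      module
    have h5 : A = (Complex.I / 2) • C + (-Complex.I / 2) • ((2 * Complex.I) • A + C) := by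
      rw [smul_add, smul_smul]
      have : -Complex.I / 2 * (2 * Complex.I) = 1 := by
        linear_combination -Complex.I_mul_I
      rw [this]
      module
    rw [h5, h4, smul_zero, add_zero]
  have hΦ := hrule hE.higgs.equivariant hΦv v
  rw [pullForm_smul_of_holomorphic hE.higgs.holomorphic hr, zero_smul, add_zero, map_smul] at hΦ
  rw [← hD, hστ, hθv, hΦ, add_sub_assoc]

end Curves

end HiggsBundle

namespace HiggsBundle

/-! ### The lift to `G / T` -/

section Lift

variable {EG : Type*} [NormedAddCommGroup EG] [NormedSpace ℂ EG]
  {G : Type*} [TopologicalSpace G] [ChartedSpace EG G] [Group G] [LieGroup 𝓘(ℂ, EG) ω G]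
  [CompleteSpace EG] [T2Space G] [FiniteDimensional ℂ EG]
  [LieAlgebra.IsSemisimple ℂ (LieAlg EG G)]
  {EX : Type*} [NormedAddCommGroup EX] [NormedSpace ℂ EX]
  {X : Type*} [TopologicalSpace X] [ChartedSpace EX X]
  {X' : Type*} [TopologicalSpace X'] [ChartedSpace EX X']
  {EP : Type*} [NormedAddCommGroup EP] [NormedSpace ℂ EP]
  {P : Type*} [TopologicalSpace P] [ChartedSpace EP P] [MulAction Gᵐᵒᵖ P]
  {K T L : Subgroup G} {τ : EG →ₛₗ[starRingEnd ℂ] EG} {σ : P → EG →ₛₗ[starRingEnd ℂ] EG}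
  {proj : P → X} {q : X' → X} {θ Φ : LieForm EG EP G P} {PH : Set P}

theorem expLie_smul_mem_torusComplexification (hT : IsMaximalTorus K T) (r : ℝ) {η : EG}
    (hη : Complex.I • η ∈ lieAlgOf EG T) :
    (expLie (r • η) : G) ∈ torusComplexification EG T := by
  refine expLie_mem_torusComplexification (mem_complexifiedLieAlgOf_iff.2
    ⟨0, (-r) • Complex.I • η, (lieSubspace (EG := EG) T hT.isClosed).zero_mem,
      (lieSubspace (EG := EG) T hT.isClosed).smul_mem _ hη, ?_⟩)
  rw [zero_add, smul_comm, smul_smul, Complex.I_mul_I, neg_one_smul, neg_smul, smul_neg, neg_neg]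

/-- On `P_H` the involution has a logarithm in `i 𝔱`. -/
theorem exists_log_of_preservesDiagonal (hT : IsMaximalTorus K T)
    (hτ : IsCompactConjugation (EG := EG) K τ) (hK : IsCompact (K : Set G))
    (hσ : IsAdjointInvolution EG (G := G) EP τ σ) (hPH : PreservesDiagonal EG T PH σ) {p : P}
    (hp : p ∈ PH) : ∃ ζ : EG, Complex.I • ζ ∈ lieAlgOf EG T ∧
      ∀ v, σ p (τ v) = NormedSpace.exp (adEnd EG G ζ) v := by
  obtain ⟨g, hg⟩ := hσ.conjugate p
  exact hT.exists_log hτ hK hg (hPH p hp)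

/-- There is a function `η` with values in `i 𝔱`, smooth at the points of `P_H`, such that
`p · exp (η / 2)` lies in `P_K ∩ P_H` for `p` in `P_H`. -/
theorem exists_frame_log (hT : IsMaximalTorus K T) (hτ : IsCompactConjugation (EG := EG) K τ)
    (hK : IsCompact (K : Set G)) (hinv : IsAdjointInvolution EG (G := G) EP τ σ)
    (hPH : IsHolomorphicSubbundle EX EP proj (torusComplexification EG T) PH)
    (hσ : PreservesDiagonal EG T PH σ) :
    ∃ η : P → EG, ∀ p ∈ PH, ContMDiffAt 𝓘(ℝ, EP) 𝓘(ℝ, EG) ∞ η p ∧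
      Complex.I • η p ∈ lieAlgOf EG T ∧
      p <• (expLie ((1 / 2 : ℝ) • η p) : G) ∈ compactSubbundle EG (G := G) τ σ ∧
      p <• (expLie ((1 / 2 : ℝ) • η p) : G) ∈ PH := by
  obtain ⟨η, hη⟩ := exists_contMDiffAt_log (P := P) hT hτ hK hinv
  refine ⟨η, fun p hp => ?_⟩
  obtain ⟨h1, h2, h3⟩ := hη p (exists_log_of_preservesDiagonal hT hτ hK hinv hσ hp)
  exact ⟨h1, h2, action_expLie_mem_compactSubbundle hT hτ hK hinv h2 h3,
    hPH.action_mem p hp _ (expLie_smul_mem_torusComplexification hT (1 / 2) h2)⟩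

/-- A parallel frame `s` and the frame `r · exp (η / 2)` obtained from a local holomorphic section
`r` of `P_H` differ by a smooth map to `G`. -/
theorem exists_frame_change (hE : IsHolomorphicPrincipalBundle EX EG (G := G) EP proj)
    (hq : IsLocalDiffeomorph 𝓘(ℂ, EX) 𝓘(ℂ, EX) ω q) {H : Subgroup G}
    (hPH : IsHolomorphicSubbundle EX EP proj H PH) {s : X' → P}
    (hs : ContMDiff 𝓘(ℝ, EX) 𝓘(ℝ, EP) ∞ s) (hsq : ∀ x, proj (s x) = q x) {η : P → EG}
    (hη : ∀ p ∈ PH, ContMDiffAt 𝓘(ℝ, EP) 𝓘(ℝ, EG) ∞ η p) (x₀ : X') :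
    ∃ (U : Set X) (p : X → P) (V : Set X') (g : X' → G), IsOpen U ∧
      ContMDiffOn 𝓘(ℂ, EX) 𝓘(ℂ, EP) ω p U ∧ (∀ y ∈ U, proj (p y) = y ∧ p y ∈ PH) ∧
      IsOpen V ∧ x₀ ∈ V ∧ (∀ x ∈ V, q x ∈ U) ∧ ContMDiffOn 𝓘(ℝ, EX) 𝓘(ℝ, EG) ∞ g V ∧
      ContMDiffOn 𝓘(ℝ, EX) 𝓘(ℝ, EG) ∞ (fun x => η (p (q x))) V ∧
      ∀ x ∈ V, s x <• g x = p (q x) <• (expLie ((1 / 2 : ℝ) • η (p (q x))) : G) := by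
  have hG : LieGroup 𝓘(ℝ, EG) ∞ G := LieGroup.real_of_complex ∞
  obtain ⟨U, hU, hxU, p, hp, hpU⟩ := hPH.locally_section (q x₀)
  obtain ⟨W, hW, hxW, s', a, -, -, ha, hsa⟩ := hE.locally_trivial (q x₀)
  have hqs : ContMDiff 𝓘(ℝ, EX) 𝓘(ℝ, EX) ∞ q := hq.contMDiff.real_of_complex.of_le (by simp)
  have hr : ContMDiffOn 𝓘(ℝ, EX) 𝓘(ℝ, EP) ∞ (fun x => p (q x)) (q ⁻¹' (U ∩ W)) :=
    (hp.real_of_complex.of_le (by simp)).comp hqs.contMDiffOn fun x hx => hx.1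
  have ha' : ContMDiffOn 𝓘(ℝ, EP) 𝓘(ℝ, EG) ∞ a (proj ⁻¹' W) :=
    ha.real_of_complex.of_le (by simp)
  have hηr : ContMDiffOn 𝓘(ℝ, EX) 𝓘(ℝ, EG) ∞ (fun x => η (p (q x))) (q ⁻¹' (U ∩ W)) := fun x hx =>
    (hη _ (hpU _ hx.1).2).comp_contMDiffWithinAt x (hr x hx)
  have hh : ContMDiffOn 𝓘(ℝ, EX) 𝓘(ℝ, EG) ∞
      (fun x => (expLie ((1 / 2 : ℝ) • η (p (q x))) : G)) (q ⁻¹' (U ∩ W)) := by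
    refine ContMDiff.comp_contMDiffOn (g := fun v : EG => (expLie ((1 / 2 : ℝ) • v) : G)) ?_ hηr
    exact ContMDiff.comp (g := (expLie : EG → G))
      ((contMDiff_expLie (EG := EG) (G := G)).real_of_complex.of_le (by simp))
      (contDiff_id.const_smul (1 / 2 : ℝ)).contMDiff
  have has : ContMDiffOn 𝓘(ℝ, EX) 𝓘(ℝ, EG) ∞ (fun x => a (s x)) (q ⁻¹' (U ∩ W)) :=
    ha'.comp hs.contMDiffOn fun x hx => by
      change proj (s x) ∈ W
      rw [hsq]
      exact hx.2
  have har : ContMDiffOn 𝓘(ℝ, EX) 𝓘(ℝ, EG) ∞ (fun x => a (p (q x))) (q ⁻¹' (U ∩ W)) :=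
    ha'.comp hr fun x hx => by
      change proj (p (q x)) ∈ W
      rw [(hpU _ hx.1).1]
      exact hx.2
  refine ⟨U, p, q ⁻¹' (U ∩ W), fun x => (a (s x))⁻¹ * a (p (q x)) * expLie ((1 / 2 : ℝ) • η (p (q x))),
    hU, hp, hpU, (hU.inter hW).preimage hqs.continuous, ⟨hxU, hxW⟩, fun x hx => hx.1,
    (has.inv.mul har).mul hh, hηr, fun x hx => ?_⟩
  have h1 : s' (q x) <• a (s x) = s x := by
    have h := hsa (s x) (by change proj (s x) ∈ W; rw [hsq]; exact hx.2)
    rwa [hsq] at h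
  have h2 : s' (q x) <• a (p (q x)) = p (q x) := by
    have h := hsa (p (q x)) (by change proj (p (q x)) ∈ W; rw [(hpU _ hx.1).1]; exact hx.2)
    rwa [(hpU _ hx.1).1] at h
  have h3 : s x <• ((a (s x))⁻¹ * a (p (q x))) = p (q x) := by
    have h4 : ∀ (y : P) (b : G), (y <• b) <• b⁻¹ = y := fun y b => by
      rw [smul_smul, ← MulOpposite.op_mul, mul_inv_cancel, MulOpposite.op_one, one_smul]
    have h5 := h4 (s' (q x)) (a (s x))
    rw [h1] at h5
    rw [MulOpposite.op_mul, mul_smul, h5, h2]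
  rw [MulOpposite.op_mul, mul_smul, h3]

/-- Every fibre of the pulled back bundle meets `P_K ∩ P_H`. -/
theorem exists_frame (hT : IsMaximalTorus K T) (hτ : IsCompactConjugation (EG := EG) K τ)
    (hK : IsCompact (K : Set G)) (hE : IsHarmonicBundle EX EG EP proj K τ Φ σ θ)
    (hq : IsLocalDiffeomorph 𝓘(ℂ, EX) 𝓘(ℂ, EX) ω q)
    (hPH : IsHolomorphicSubbundle EX EP proj (torusComplexification EG T) PH)
    (hσ : PreservesDiagonal EG T PH σ) {s : X' → P}
    (hs : IsParallelSection EX EG EP proj q (harmonicConnection EG (G := G) EP θ Φ σ) s) (x : X') :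
    ∃ g : G, s x <• g ∈ compactSubbundle EG (G := G) τ σ ∧ s x <• g ∈ PH := by
  obtain ⟨η, hη⟩ := exists_frame_log hT hτ hK hE.involution hPH hσ
  obtain ⟨U, p, V, g, -, -, hpU, -, hxV, hVU, -, -, hsg⟩ := exists_frame_change hE.principal hq hPH
    hs.smooth hs.proj_eq (fun p hp => (hη p hp).1) x
  refine ⟨g x, ?_⟩
  rw [hsg x hxV]
  exact (hη _ (hpU _ (hVU x hxV)).2).2.2

/-- A map to `G / L`, `T ≤ L ≤ K`, that is represented by the frames in `P_K ∩ P_H`, is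
pluriharmonic. -/
theorem isPluriharmonic_of_frames [FiniteDimensional ℂ EP] [IsManifold 𝓘(ℂ, EP) ω P]
    (hT : IsMaximalTorus K T) (hτ : IsCompactConjugation (EG := EG) K τ)
    (hK : IsCompact (K : Set G)) (hTL : T ≤ L) (hLK : L ≤ K) (hL : IsClosed (L : Set G))
    (hE : IsHarmonicBundle EX EG EP proj K τ Φ σ θ)
    (hq : IsLocalDiffeomorph 𝓘(ℂ, EX) 𝓘(ℂ, EX) ω q)
    (hPH : IsHolomorphicSubbundle EX EP proj (torusComplexification EG T) PH)
    (hσ : PreservesDiagonal EG T PH σ) {s : X' → P}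
    (hs : IsParallelSection EX EG EP proj q (harmonicConnection EG (G := G) EP θ Φ σ) s)
    {f : X' → G ⧸ L} (hf : ∀ x (g : G), s x <• g ∈ compactSubbundle EG (G := G) τ σ →
      s x <• g ∈ PH → (g : G ⧸ L) = f x) : IsPluriharmonic EG EX τ L f := by
  obtain ⟨η, hη⟩ := exists_frame_log hT hτ hK hE.involution hPH hσ
  obtain ⟨Q, hQ⟩ := hτ.exists_isQuotProj hK hL
  have hframe := fun p hp => (hη p hp).2.2
  have hchange := exists_frame_change hE.principal hq hPH hs.smooth hs.proj_eq
    (fun p hp => (hη p hp).1)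
  refine ⟨fun x _ => ?_, fun O c hO hc => ?_⟩
  · obtain ⟨U, p, V, g, hU, hp, hpU, hV, hxV, hVU, hg, -, hsg⟩ := hchange x
    refine ⟨g, V, hV, hxV, hg, fun w hw => hf w (g w) ?_ ?_⟩ <;> rw [hsg w hw]
    · exact (hframe _ (hpU _ (hVU w hw)).2).1
    · exact (hframe _ (hpU _ (hVU w hw)).2).2
  · refine hQ.isHarmonicOn hτ hK hLK hL hO fun z hz => ?_
    obtain ⟨U, p, V, g, hU, hp, hpU, hV, hxV, hVU, hg, hηV, hsg⟩ := hchange (c z)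
    have hcR : ContMDiffOn 𝓘(ℝ, ℂ) 𝓘(ℝ, EX) ∞ c O := hc.real_of_complex.of_le (by simp)
    set N : Set ℂ := O ∩ c ⁻¹' V with hN
    have hNo : IsOpen N := hc.continuousOn.isOpen_inter_preimage hO hV
    have hNz : N ∈ 𝓝 z := hNo.mem_nhds ⟨hz, hxV⟩
    have hgc : ContMDiffOn 𝓘(ℝ, ℂ) 𝓘(ℝ, EG) ∞ (fun w => g (c w)) N :=
      hg.comp (hcR.mono Set.inter_subset_left) fun w hw => hw.2
    have hsc : ContMDiffOn 𝓘(ℝ, ℂ) 𝓘(ℝ, EP) ∞ (fun w => s (c w)) N :=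
      hs.smooth.comp_contMDiffOn (hcR.mono Set.inter_subset_left)
    have hηc : ContMDiffOn 𝓘(ℝ, ℂ) 𝓘(ℝ, EG) ∞ (fun w => η (p (q (c w)))) N :=
      hηV.comp (hcR.mono Set.inter_subset_left) fun w hw => hw.2
    have hu : ContMDiffOn 𝓘(ℝ, ℂ) 𝓘(ℝ, EP) ∞ (fun w => s (c w) <• g (c w)) N :=
      ((hE.principal.holomorphic_action.real_of_complex_prod.of_le le_top).comp_contMDiffOn
        (hsc.prodMk hgc) :)
    have hcC : ∀ w ∈ N, ContMDiffAt 𝓘(ℂ, ℂ) 𝓘(ℂ, EX) ω c w := fun w hw =>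
      hc.contMDiffAt (hO.mem_nhds hw.1)
    have hqc : ∀ w ∈ N, ContMDiffAt 𝓘(ℂ, ℂ) 𝓘(ℂ, EX) ω (fun w => q (c w)) w := fun w hw =>
      hq.contMDiff.contMDiffAt.comp w (hcC w hw)
    have hev : ∀ {S : ℂ → Prop}, (∀ w ∈ N, S w) → ∀ᶠ w in 𝓝 z, S w := fun h =>
      Filter.eventually_of_mem hNz h
    have hpc : ∀ w ∈ N, p (q (c w)) ∈ PH := fun w hw => (hpU _ (hVU _ hw.2)).2
    refine ⟨fun w => g (c w), ⟨N, hNo, ⟨hz, hxV⟩, hgc, fun w hw => hf _ _ ?_ ?_⟩, ?_⟩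
    · rw [hsg _ hw.2]
      exact (hframe _ (hpc w hw)).1
    · rw [hsg _ hw.2]
      exact (hframe _ (hpc w hw)).2
    refine tension_add_tension_eq_zero hT hτ hK hTL hLK hQ
      (η := fun w => η (p (q (c w)))) (φ := fun w => pullForm Φ (fun w => p (q (c w))) w 1)
      (hev fun w hw => (hηc.contMDiffAt (hNo.mem_nhds hw)).contDiffAt.differentiableAt (by simp))
      (hev fun w hw => (hη _ (hpc w hw)).2.1) ?_ ?_
    · refine differentiableAt_pullForm hE.higgs.holomorphic ?_
      exact (hp.contMDiffAt (hU.mem_nhds (hVU _ hxV))).comp z (hqc z ⟨hz, hxV⟩)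
    · refine eventually_mcForm_eq hT hτ hK hE hU hp (fun y hy => (hpU y hy).1)
        (y := fun w => q (c w)) (s := fun w => s (c w))
        (hev fun w hw => hVU _ hw.2) (hev fun w hw => (hqc w hw).mdifferentiableAt (by simp))
        (hev fun w hw => (hηc.contMDiffAt (hNo.mem_nhds hw)).contDiffAt.differentiableAt (by simp))
        (hev fun w hw => (hη _ (hpc w hw)).2.1)
        (hev fun w hw => hu.contMDiffAt (hNo.mem_nhds hw)) (hev fun w hw => ?_)
        (hev fun w hw => (hsc.contMDiffAt (hNo.mem_nhds hw)).mdifferentiableAt (by simp))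
        (hev fun w hw => (hgc.contMDiffAt (hNo.mem_nhds hw)).mdifferentiableAt (by simp))
        (hev fun w hw v => ?_) (hev fun w hw => hsg _ hw.2)
      · rw [hsg _ hw.2]
        exact (hframe _ (hpc w hw)).1
      · have h1 := ((hcR.contMDiffAt (hO.mem_nhds hw.1)).mdifferentiableAt (by simp)).hasMFDerivAt
        have h2 := ((hs.smooth.mdifferentiableAt (x := c w) (by simp)).hasMFDerivAt).comp w h1
        refine (pullForm_eq (harmonicConnection EG (G := G) EP θ Φ σ) h2 v).trans ?_
        exact hs.parallel (c w) _

end Lift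

end HiggsBundle

theorem theorem3
    -- a complex connected semisimple Lie group `G`
    {EG : Type*} [NormedAddCommGroup EG] [NormedSpace ℂ EG] [FiniteDimensional ℂ EG]
    [CompleteSpace EG]
    {G : Type*} [TopologicalSpace G] [ChartedSpace EG G] [Group G] [LieGroup 𝓘(ℂ, EG) ω G]
    [T2Space G] [ConnectedSpace G]
    [LieAlgebra.IsSemisimple ℂ (HiggsBundle.LieAlg EG G)]
    -- a maximal compact subgroup `K`, its conjugation `τ = σ_K`, a maximal torus `T` of `K`
    (K T : Subgroup G) (hK : HiggsBundle.IsMaximalCompact K) (hT : HiggsBundle.IsMaximalTorus K T)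
    (τ : HiggsBundle.LieAlg EG G →ₛₗ[starRingEnd ℂ] HiggsBundle.LieAlg EG G)
    (hτ : HiggsBundle.IsCompactConjugation EG K τ)
    -- a connected complex manifold `X` and its universal covering `X'`
    {EX : Type*} [NormedAddCommGroup EX] [NormedSpace ℂ EX] [FiniteDimensional ℂ EX]
    {X : Type*} [TopologicalSpace X] [ChartedSpace EX X] [IsManifold 𝓘(ℂ, EX) ω X]
    [T2Space X] [ConnectedSpace X]
    {X' : Type*} [TopologicalSpace X'] [ChartedSpace EX X'] [IsManifold 𝓘(ℂ, EX) ω X']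
    (q : X' → X) (hq : HiggsBundle.IsUniversalCovering EX q)
    -- the total space `P` of a holomorphic principal bundle
    {EP : Type*} [NormedAddCommGroup EP] [NormedSpace ℂ EP] [FiniteDimensional ℂ EP]
    {P : Type*} [TopologicalSpace P] [ChartedSpace EP P] [IsManifold 𝓘(ℂ, EP) ω P]
    [MulAction Gᵐᵒᵖ P] (proj : P → X)
    -- a `G`-harmonic bundle `(P, Φ, σ)` with Chern connection `θ`
    (Φ : HiggsBundle.LieForm EG EP G P)
    (σ : P → HiggsBundle.LieAlg EG G →ₛₗ[starRingEnd ℂ] HiggsBundle.LieAlg EG G)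
    (θ : HiggsBundle.LieForm EG EP G P)
    (hP : HiggsBundle.IsHarmonicBundle EX EG EP proj K τ Φ σ θ)
    -- a holomorphic `H`-subbundle `P_H` such that `σ` preserves `P_H ×_H 𝔥`
    (PH : Set P)
    (hPH : HiggsBundle.IsHolomorphicSubbundle EX EP proj
      (HiggsBundle.torusComplexification EG T) PH)
    (hσ : HiggsBundle.PreservesDiagonal EG T PH σ)
    -- the associated map
    (f : X' → G ⧸ K) (hf : HiggsBundle.IsAssociatedMap EX EG EP proj q K τ Φ σ θ f) :
    HiggsBundle.IsPluriharmonic EG EX τ K f ∧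
    ∃ fT : X' → G ⧸ T, HiggsBundle.IsPluriharmonic EG EX τ T fT ∧
      f = Subgroup.quotientMapOfLE hT.1.1 ∘ fT := by
  obtain ⟨s, hs, hsf⟩ := hf
  have hKc : IsCompact (K : Set G) := hK.1
  have hexists : ∀ x, ∃ g : G,
      s x <• g ∈ HiggsBundle.compactSubbundle EG τ σ ∧ s x <• g ∈ PH :=
    HiggsBundle.exists_frame hT hτ hKc hP hq.localDiffeo hPH hσ hs
  -- the element `g x` is determined up to `H ∩ K = T`, so its coset is the lift of `f x`
  choose g hgK hgH using hexists
  have hfg : ∀ x (g' : G), s x <• g' ∈ HiggsBundle.compactSubbundle EG τ σ →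
      s x <• g' ∈ PH → (g' : G ⧸ T) = g x := by
    intro x g' h1 h2
    refine (QuotientGroup.eq.2 (hT.mem_of_mem_torusComplexification (EG := EG) hKc ?_ ?_)).symm
    · refine hPH.mem_of_action _ (hgH x) _ ?_
      rwa [smul_smul, ← MulOpposite.op_mul, mul_inv_cancel_left]
    · exact QuotientGroup.eq.1 (((hsf x _).2 (hgK x)).trans ((hsf x _).2 h1).symm)
  refine ⟨HiggsBundle.isPluriharmonic_of_frames hT hτ hKc hT.1.1 le_rfl hKc.isClosed hP
      hq.localDiffeo hPH hσ hs fun x g' h1 _ => (hsf x g').2 h1,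
    fun x => (g x : G ⧸ T), HiggsBundle.isPluriharmonic_of_frames hT hτ hKc le_rfl hT.1.1
      hT.isClosed hP hq.localDiffeo hPH hσ hs hfg, ?_⟩
  funext x
  exact ((hsf x _).2 (hgK x)).symm
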